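/- Let $p$ be an odd prime, $\mathbb F$ a field of characteristic $p$, $E=\langle e_1,\dots,e_4\rangle\cong(\mathbb Z/p)^4$, and $M=(c_{ij})\in\mathbb F^{2\times 4}$. Let $e_j$ act on $\mathbb F[V_M]=\mathbb F[x,y,z]$ by $x\mapsto x$, $y\mapsto y+c_{1j}x$, $z\mapsto z+2c_{1j}y+(c_{1j}^2+c_{2j})x$. Use the graded reverse lexicographic order with $x<y<z$; $\mathrm{LM}$ and $\mathrm{LT}$ denote lead monomial and lead term. For $f\in\mathbb F[x,y,z]$ let $N_M(f)$ be the product of the distinct elements of the $E$-orbit of $f$. Let $\Gamma(M)$ be the matrix whose rows $2k+1$ and $2k+2$ ($k=0,1,\dots,4$) are $(c_{11}^{p^k},\dots,c_{14}^{p^k})$ and $(c_{21}^{p^k},\dots,c_{24}^{p^k})$, and let $\gamma_{ijk\ell}$ be its $4\times4$ minor in the rows $i,j,k,\ell$. Put $\delta=y^2-xz$. Suppose $\gamma_{1234}\ne0$, $\gamma_{1235}\neq0$ and $\gamma_{1357}=0$. Put $\beta_3=\gamma_{1235}/\gamma_{1234}$, $\alpha_2=-\gamma_{1237}/\gamma_{1235}$,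 $\alpha_1=\gamma_{1257}/\gamma_{1235}$. Let $\bar f_1$ be $x^{p^2}$ times the determinant of the $5\times5$ matrix formed by rows $1,\dots,5$ of $\Gamma(M)$ augmented by the column $\left(\frac yx,-\frac{\delta}{x^2},\left(\frac yx\right)^p,\left(-\frac{\delta}{x^2}\right)^p,\left(\frac yx\right)^{p^2}\right)^T$, and define $$\hat f_1=\bar f_1/\gamma_{1234},\qquad \tilde h_2=N_M(y)-\hat f_1^{\,p}+\beta_3^p x^{p^3-2p^2}\hat f_1^{\,2},\qquad h_2=\frac{\gamma_{1234}^{p+1}\,\tilde h_2}{2\gamma_{1235}^{p+1}x^{p^3-p^2-2p}},$$ for $p\ge5$ $$\tilde h_3=h_2^p-\hat f_1^{\,p+2}+2\beta_3\hat f_1^{\,p}h_2x^{p^2-2p}-\beta_3^{-p}\Bigl(\alpha_2\hat f_1^{\,p+1}x^{p^2}-\alpha_2\beta_3\hat f_1^{\,p-1}h_2x^{2p^2-2p}+\alpha_1\hat f_1^{\,(p-3)/2}h_2^{(p+1)/2}x^{2p^2-p}\Bigr),$$ for $p=3$ $$\tilde h_3=h_2^3-\hat f_1^{\,5}+2\beta_3\hat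 f_1^{\,3}h_2x^3-(\alpha_2\beta_3^{-3}+\beta_3^3)\bigl(\hat f_1^{\,4}x^9-\beta_3\hat f_1^{\,2}h_2x^{12}\bigr)-(\alpha_1\beta_3^{-3}+\alpha_2\beta_3^{-1}+\beta_3^5)h_2^2x^{15},$$ and in both cases $$h_3=\frac{\gamma_{1235}^{p+1}\,\tilde h_3}{\gamma_{2357}\,\gamma_{1234}^p\,x^{2p^2-1}}.$$ Then $\gamma_{2357}\neq0$, the divisions by powers of $x$ are exact in $\mathbb F[x,y,z]$, and the following hold. 1. $\mathcal B=\{x,\hat f_1,h_2,h_3,N_M(z)\}$ is a SAGBI basis of $\mathbb F[V_M]^E$ (it is contained in $\mathbb F[V_M]^E$, and its lead monomials generate the algebra generated by the lead monomials of the non-zero elements of $\mathbb F[V_M]^E$). It generates the algebra $\mathbb F[V_M]^E$, and its elements are non-zero and homogeneous of degrees $1,\ p^2,\ p^2+2p,\ p^3+1,\ p^4$ respectively. 2. $\mathbb F[V_M]^E$ is a complete intersection, that is, it has a presentation by finitely many generators in which the ideal of relations is generated by a regular sequence. More precisely, consider the pairs $(h_2^{\,p},\ \hat f_1^{\,p+2})$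 and $(h_3^{\,p},\ \hat f_1^{\,(p^2-2p-1)/2}h_2^{(p^2+1)/2})$. For each such pair $(u,v)$ there is $c\in\mathbb F$ such that $\mathrm{LT}(u)=\mathrm{LT}(cv)$ and $u-cv$ subducts to zero over $\mathcal B$, i.e. one can reach $0$ from $u-cv$ by repeatedly subtracting a scalar multiple of a power product of elements of $\mathcal B$ which has the same lead term as the current non-zero polynomial. Any such subduction expresses $u-cv$ as a polynomial in the elements of $\mathcal B$, and so gives a relation in $\mathbb F[X_0,\dots,X_4]$ among the elements of $\mathcal B$. For any choice of these subductions, the two resulting relations generate the kernel of $\mathbb F[X_0,\dots,X_4]\to\mathbb F[V_M]^E$, $(X_0,\dots,X_4)\mapsto(x,\hat f_1,h_2,h_3,N_M(z))$, and form a regular sequence. -/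

import Mathlib

namespace RankFour

open MvPolynomial

/-! ### The graded reverse lexicographic order with `x < y < z` and SAGBI bases

The variables `x, y, z` are `X 0, X 1, X 2`. -/

/-- A copy of the exponent vectors `(a₀, a₁, a₂)`, ordered by grevlex with `x < y < z`. -/
def GrevLex : Type := Fin 3 →₀ ℕ

noncomputable instance : AddCommMonoid GrevLex :=
  inferInstanceAs (AddCommMonoid (Fin 3 →₀ ℕ))

/-- Comparing the triples `(a₀ + a₁ + a₂, a₁ + a₂, a₂)` lexicographically is the same as comparing
`a` in the grevlex order, see `grevlex_lt_iff`. -/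
def grevKey (a : Fin 3 →₀ ℕ) : ℕ ×ₗ ℕ ×ₗ ℕ :=
  toLex (a 0 + a 1 + a 2, toLex (a 1 + a 2, a 2))

theorem grevKey_injective : Function.Injective grevKey := by
  intro a b h
  simp only [grevKey, EmbeddingLike.apply_eq_iff_eq, Prod.mk.injEq] at h
  obtain ⟨h0, h1, h2⟩ := h
  refine Finsupp.ext (fun i => ?_)
  fin_cases i
  · show a 0 = b 0
    omega
  · show a 1 = b 1
    omega
  · exact h2

theorem grevKey_add (a b : Fin 3 →₀ ℕ) : grevKey (a + b) = grevKey a + grevKey b := by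
  have e : ∀ u v u' v' w w' : ℕ, (toLex (u, toLex (v, w)) : ℕ ×ₗ ℕ ×ₗ ℕ) + toLex (u', toLex (v', w'))
      = toLex (u + u', toLex (v + v', w + w')) := fun _ _ _ _ _ _ => rfl
  simp only [grevKey]
  rw [e]
  simp only [EmbeddingLike.apply_eq_iff_eq, Prod.mk.injEq, Finsupp.add_apply]
  exact ⟨by omega, by omega, trivial⟩

noncomputable instance : LinearOrder GrevLex :=
  LinearOrder.lift' (fun a : GrevLex => grevKey a) grevKey_injective

instance : IsOrderedAddMonoid GrevLex where
  add_le_add_left a b hab c := by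
    show grevKey _ ≤ grevKey _
    have h : ∀ u v : GrevLex, grevKey (u + v) = grevKey u + grevKey v := grevKey_add
    rw [h, h]
    exact add_le_add_left (show grevKey a ≤ grevKey b from hab) _

instance : WellFoundedLT GrevLex :=
  ⟨InvImage.wf (fun a : GrevLex => grevKey a) (wellFounded_lt (α := ℕ ×ₗ ℕ ×ₗ ℕ))⟩

/-- The graded reverse lexicographic order on monomials in `x < y < z`. -/
noncomputable def grevlex : MonomialOrder (Fin 3) where
  syn := GrevLex
  toSyn := { toEquiv := Equiv.refl (Fin 3 →₀ ℕ), map_add' := fun _ _ => rfl }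
  toSyn_monotone := by
    intro a b h
    have h0 := h 0
    have h1 := h 1
    have h2 := h 2
    show grevKey a ≤ grevKey b
    simp only [grevKey]
    exact Prod.Lex.toLex_mono (Prod.mk_le_mk.2 ⟨by omega,
      Prod.Lex.toLex_mono (Prod.mk_le_mk.2 ⟨by omega, h2⟩)⟩)

open scoped MonomialOrder in
theorem grevlex_lt_iff (a b : Fin 3 →₀ ℕ) :
    a ≺[grevlex] b ↔ a 0 + a 1 + a 2 < b 0 + b 1 + b 2 ∨
      (a 0 + a 1 + a 2 = b 0 + b 1 + b 2 ∧ (b 0 < a 0 ∨ (a 0 = b 0 ∧ b 1 < a 1))) := by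
  have h : a ≺[grevlex] b ↔ grevKey a < grevKey b := Iff.rfl
  rw [h]
  simp only [grevKey, Prod.Lex.toLex_lt_toLex]
  omega

/-- The subalgebra generated by the lead monomials of the non-zero elements of a set. -/
noncomputable def leadAlgebra {F : Type*} [Field F] (S : Set (MvPolynomial (Fin 3) F)) :
    Subalgebra F (MvPolynomial (Fin 3) F) :=
  Algebra.adjoin F {m | ∃ f ∈ S, f ≠ 0 ∧ m = monomial (grevlex.degree f) 1}

/-- `B` is a SAGBI basis of the subalgebra `A`: it lies in `A`, and its lead monomials generate
the lead term algebra of `A`. -/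
def IsSagbiBasis {F : Type*} [Field F] (B : Set (MvPolynomial (Fin 3) F))
    (A : Subalgebra F (MvPolynomial (Fin 3) F)) : Prop :=
  B ⊆ A ∧ leadAlgebra B = leadAlgebra (A : Set (MvPolynomial (Fin 3) F))

/-- The power product `h^I = ∏ j, h_j ^ I_j`. -/
noncomputable def powerProduct {F : Type*} [Field F] {n : ℕ}
    (h : Fin n → MvPolynomial (Fin 3) F) (I : Fin n →₀ ℕ) : MvPolynomial (Fin 3) F :=
  ∏ j, h j ^ I j

/-- `Subducts h f P`: the iterated subtraction of terms `c h^I` whose lead term is the current lead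
term takes `f` to zero, and `P` is the sum of the corresponding terms `c X^I`, so `f = P(h)`. -/
inductive Subducts {F : Type*} [Field F] {n : ℕ} (h : Fin n → MvPolynomial (Fin 3) F) :
    MvPolynomial (Fin 3) F → MvPolynomial (Fin n) F → Prop
  | zero : Subducts h 0 0
  | step (f : MvPolynomial (Fin 3) F) (c : F) (I : Fin n →₀ ℕ) (P : MvPolynomial (Fin n) F) :
      f ≠ 0 →
      grevlex.leadingTerm f = grevlex.leadingTerm (C c * powerProduct h I) →
      Subducts h (f - C c * powerProduct h I) P →
      Subducts h f (monomial I c + P)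

/-- `r` is the relation `X^I - c X^J - P` which a subduction to zero of the tête-à-tête
`(h^I, h^J)` gives: `c` is chosen such that `LT(h^I) = LT(c h^J)`, and `h^I - c h^J` subducts to
zero with associated expression `P`. -/
def IsTeteATeteRelation {F : Type*} [Field F] {n : ℕ} (h : Fin n → MvPolynomial (Fin 3) F)
    (I J : Fin n →₀ ℕ) (r : MvPolynomial (Fin n) F) : Prop :=
  ∃ (c : F) (P : MvPolynomial (Fin n) F),
    grevlex.leadingTerm (powerProduct h I) = grevlex.leadingTerm (C c * powerProduct h J) ∧
    Subducts h (powerProduct h I - C c * powerProduct h J) P ∧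
    r = monomial I 1 - monomial J c - P

/-- A complete intersection: an algebra with a presentation by finitely many generators whose ideal
of relations is generated by a regular sequence. -/
def IsCompleteIntersection (F A : Type*) [Field F] [CommRing A] [Algebra F A] : Prop :=
  ∃ (n : ℕ) (φ : MvPolynomial (Fin n) F →ₐ[F] A) (rs : List (MvPolynomial (Fin n) F)),
    Function.Surjective φ ∧ RingHom.ker φ = Ideal.ofList rs ∧
    RingTheory.Sequence.IsRegular (MvPolynomial (Fin n) F) rs

/-! ### The representation `V_M` of `E = (ℤ/p)⁴` and its invariants -/

/-- The representation `σ` of the group `(F², +)`. -/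
def sigma {F : Type*} [Field F] (c₁ c₂ : F) : Matrix (Fin 3) (Fin 3) F :=
  !![1, 2 * c₁, c₁ ^ 2 + c₂; 0, 1, c₁; 0, 0, 1]

theorem sigma_add {F : Type*} [Field F] (a₁ a₂ b₁ b₂ : F) :
    sigma (a₁ + b₁) (a₂ + b₂) = sigma a₁ a₂ * sigma b₁ b₂ := by
  ext i j
  fin_cases i <;> fin_cases j <;> simp [sigma, Matrix.mul_apply, Fin.sum_univ_three] <;> ring

/-- Entry `i` of `M e`, for `e ∈ E = (ℤ/p)⁴` written in the basis `e_1, …, e_4`. -/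
def coord {F : Type*} [Field F] (p : ℕ) (M : Matrix (Fin 2) (Fin 4) F) (i : Fin 2)
    (e : Fin 4 → ZMod p) : F :=
  ∑ j, (ZMod.cast (e j) : F) * M i j

/-- The action of `e ∈ E` on `F[x,y,z]`, where `e_j` acts as `σ(c_{1j}, c_{2j})` by right
multiplication on the row vectors `x = [0 0 1]`, `y = [0 1 0]`, `z = [1 0 0]`. -/
noncomputable def act {F : Type*} [Field F] (p : ℕ) (M : Matrix (Fin 2) (Fin 4) F)
    (e : Fin 4 → ZMod p) : MvPolynomial (Fin 3) F →ₐ[F] MvPolynomial (Fin 3) F :=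
  aeval fun i => ∑ j, C (sigma (coord p M 0 e) (coord p M 1 e) (Fin.rev i) (Fin.rev j)) * X j

theorem act_x {F : Type*} [Field F] (p : ℕ) (M : Matrix (Fin 2) (Fin 4) F)
    (e : Fin 4 → ZMod p) : act p M e (X 0) = X 0 := by
  simp [act, sigma, Fin.sum_univ_three, Fin.rev]

theorem act_y {F : Type*} [Field F] (p : ℕ) (M : Matrix (Fin 2) (Fin 4) F)
    (e : Fin 4 → ZMod p) : act p M e (X 1) = X 1 + C (coord p M 0 e) * X 0 := by
  simp [act, sigma, Fin.sum_univ_three, Fin.rev]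
  ring

theorem act_z {F : Type*} [Field F] (p : ℕ) (M : Matrix (Fin 2) (Fin 4) F)
    (e : Fin 4 → ZMod p) : act p M e (X 2) =
      X 2 + C (2 * coord p M 0 e) * X 1 + C (coord p M 0 e ^ 2 + coord p M 1 e) * X 0 := by
  simp [act, sigma, Fin.sum_univ_three, Fin.rev]
  ring

/-- The ring of invariants `F[V_M]^E`. -/
noncomputable def invariants {F : Type*} [Field F] (p : ℕ) (M : Matrix (Fin 2) (Fin 4) F) :
    Subalgebra F (MvPolynomial (Fin 3) F) :=
  ⨅ e : Fin 4 → ZMod p, AlgHom.equalizer (act p M e) (AlgHom.id F _)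

theorem mem_invariants {F : Type*} [Field F] (p : ℕ) (M : Matrix (Fin 2) (Fin 4) F)
    (f : MvPolynomial (Fin 3) F) : f ∈ invariants p M ↔ ∀ e, act p M e f = f := by
  simp [invariants, Algebra.mem_iInf, AlgHom.mem_equalizer]

open Classical in
/-- The orbit product `N_M(f)`: the product of the distinct elements of the orbit of `f`. -/
noncomputable def orbitNorm {F : Type*} [Field F] (p : ℕ) [Fact p.Prime]
    (M : Matrix (Fin 2) (Fin 4) F) (f : MvPolynomial (Fin 3) F) : MvPolynomial (Fin 3) F :=
  ∏ g ∈ Finset.univ.image (fun e : Fin 4 → ZMod p => act p M e f), g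

/-! ### The minors `γ_{ijkl}(M)` and the invariants `f̂₁, h₂, h₃` -/

/-- Row `r` (numbered from `1`) of `Γ(M)`: rows `2k+1` and `2k+2` are the `p^k`-th powers of the
first and of the second row of `M`. -/
def gammaRow {F : Type*} [Field F] (p : ℕ) (M : Matrix (Fin 2) (Fin 4) F) (r : ℕ) : Fin 4 → F :=
  fun j => (if Odd r then M 0 j else M 1 j) ^ p ^ ((r - 1) / 2)

/-- The minor `γ_{ijkl}(M)` of `Γ(M)` in the rows `i, j, k, l`. -/
def gam {F : Type*} [Field F] (p : ℕ) (M : Matrix (Fin 2) (Fin 4) F) (i j k l : ℕ) : F :=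
  Matrix.det (Matrix.of ![gammaRow p M i, gammaRow p M j, gammaRow p M k, gammaRow p M l])

/-- `δ = y² - xz`. -/
noncomputable def delta (F : Type*) [Field F] : MvPolynomial (Fin 3) F := X 1 ^ 2 - X 0 * X 2

/-- The entry in row `r ≤ 5` of the column with entries `(y/x)^(p^k)` in row `2k+1` and
`(-δ/x²)^(p^k)` in row `2k+2`, multiplied by `x^(p^2)`. -/
noncomputable def augEntry (F : Type*) [Field F] (p r : ℕ) : MvPolynomial (Fin 3) F :=
  if Odd r then X 1 ^ p ^ ((r - 1) / 2) * X 0 ^ (p ^ 2 - p ^ ((r - 1) / 2))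
  else (-delta F) ^ p ^ ((r - 1) / 2) * X 0 ^ (p ^ 2 - 2 * p ^ ((r - 1) / 2))

/-- `f̄₁`: the minor in the rows `1, …, 5` of `Γ(M)` augmented by the column
`(y/x, -δ/x², …)`, multiplied by `x^(p^2)`. -/
noncomputable def f1bar {F : Type*} [Field F] (p : ℕ) (M : Matrix (Fin 2) (Fin 4) F) :
    MvPolynomial (Fin 3) F :=
  Matrix.det (Matrix.of fun a : Fin 5 =>
    (Fin.snoc (fun j => C (gammaRow p M (a + 1) j)) (augEntry F p (a + 1)) :
      Fin 5 → MvPolynomial (Fin 3) F))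

theorem f1bar_eq {F : Type*} [Field F] (p : ℕ) (hp : Odd p) (M : Matrix (Fin 2) (Fin 4) F) :
    f1bar p M = C (gam p M 1 2 3 4) * X 1 ^ p ^ 2
      + C (gam p M 1 2 3 5) * delta F ^ p * X 0 ^ (p ^ 2 - 2 * p)
      + C (gam p M 1 2 4 5) * X 1 ^ p * X 0 ^ (p ^ 2 - p)
      + C (gam p M 1 3 4 5) * delta F * X 0 ^ (p ^ 2 - 2)
      + C (gam p M 2 3 4 5) * X 1 * X 0 ^ (p ^ 2 - 1) := by
  have key : ∀ (A : Fin 5 → Fin 4 → F) (v : Fin 5 → MvPolynomial (Fin 3) F),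
      Matrix.det (Matrix.of fun a : Fin 5 =>
        (Fin.snoc (fun j => C (A a j)) (v a) : Fin 5 → MvPolynomial (Fin 3) F)) =
      C (Matrix.det (Matrix.of ![A 0, A 1, A 2, A 3])) * v 4
      - C (Matrix.det (Matrix.of ![A 0, A 1, A 2, A 4])) * v 3
      + C (Matrix.det (Matrix.of ![A 0, A 1, A 3, A 4])) * v 2
      - C (Matrix.det (Matrix.of ![A 0, A 2, A 3, A 4])) * v 1
      + C (Matrix.det (Matrix.of ![A 1, A 2, A 3, A 4])) * v 0 := by
    intro A v
    have sub : ∀ B : Fin 4 → Fin 4 → F,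
        Matrix.det (Matrix.of fun a j : Fin 4 => (C (B a j) : MvPolynomial (Fin 3) F)) =
          C (Matrix.det (Matrix.of B)) := fun B => (RingHom.map_det C (Matrix.of B)).symm
    have sub' : ∀ i : Fin 5, Matrix.det ((Matrix.of fun a : Fin 5 =>
        (Fin.snoc (fun j => C (A a j)) (v a) : Fin 5 → MvPolynomial (Fin 3) F)).submatrix
          i.succAbove (Fin.last 4).succAbove) =
        C (Matrix.det (Matrix.of fun a => A (i.succAbove a))) := by
      intro i
      rw [← sub]
      congr 1
      ext1 a j
      simp only [Matrix.submatrix_apply, Matrix.of_apply, Fin.succAbove_last]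
      exact Fin.snoc_castSucc (α := fun _ => MvPolynomial (Fin 3) F) _ _ _
    have row : ∀ i : Fin 5, (fun a => A (i.succAbove a)) =
        ![A (i.succAbove 0), A (i.succAbove 1), A (i.succAbove 2), A (i.succAbove 3)] := by
      intro i
      ext1 a
      fin_cases a <;> rfl
    have col : ∀ i : Fin 5, (Fin.snoc (fun j => C (A i j)) (v i) :
        Fin 5 → MvPolynomial (Fin 3) F) (Fin.last 4) = v i := fun i => Fin.snoc_last _ _
    have s0 : (0 : Fin 5).succAbove = ![1, 2, 3, 4] := by decide
    have s1 : (1 : Fin 5).succAbove = ![0, 2, 3, 4] := by decide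
    have s2 : (2 : Fin 5).succAbove = ![0, 1, 3, 4] := by decide
    have s3 : (3 : Fin 5).succAbove = ![0, 1, 2, 4] := by decide
    have s4 : (4 : Fin 5).succAbove = ![0, 1, 2, 3] := by decide
    rw [Matrix.det_succ_column _ (Fin.last 4)]
    simp only [sub', Matrix.of_apply, col, row, Fin.sum_univ_five, s0, s1, s2, s3, s4]
    have e1 : ((-1 : MvPolynomial (Fin 3) F)) ^ (((1 : Fin 5) : ℕ) + ((Fin.last 4 : Fin 5) : ℕ)) = -1 :=
      Odd.neg_one_pow (by decide)
    have e3 : ((-1 : MvPolynomial (Fin 3) F)) ^ (((3 : Fin 5) : ℕ) + ((Fin.last 4 : Fin 5) : ℕ)) = -1 :=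
      Odd.neg_one_pow (by decide)
    have e0 : ((-1 : MvPolynomial (Fin 3) F)) ^ (((0 : Fin 5) : ℕ) + ((Fin.last 4 : Fin 5) : ℕ)) = 1 :=
      Even.neg_one_pow (by decide)
    have e2 : ((-1 : MvPolynomial (Fin 3) F)) ^ (((2 : Fin 5) : ℕ) + ((Fin.last 4 : Fin 5) : ℕ)) = 1 :=
      Even.neg_one_pow (by decide)
    have e4 : ((-1 : MvPolynomial (Fin 3) F)) ^ (((4 : Fin 5) : ℕ) + ((Fin.last 4 : Fin 5) : ℕ)) = 1 :=
      Even.neg_one_pow (by decide)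
    rw [e0, e1, e2, e3, e4]
    simp only [Matrix.cons_val]
    ring
  have v0 : augEntry F p 1 = X 1 * X 0 ^ (p ^ 2 - 1) := by simp [augEntry]
  have v1 : augEntry F p 2 = -delta F * X 0 ^ (p ^ 2 - 2) := by
    simp [augEntry, show ¬ Odd 2 by decide]
  have v2 : augEntry F p 3 = X 1 ^ p * X 0 ^ (p ^ 2 - p) := by
    simp [augEntry, show Odd 3 by decide]
  have v3 : augEntry F p 4 = -(delta F ^ p) * X 0 ^ (p ^ 2 - 2 * p) := by
    simp [augEntry, show ¬ Odd 4 by decide, hp.neg_pow]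
  have v4 : augEntry F p 5 = X 1 ^ p ^ 2 := by
    simp [augEntry, show Odd 5 by decide]
  rw [f1bar, key (fun a => gammaRow p M (a + 1)) (fun a => augEntry F p (a + 1))]
  have w0 : ((0 : Fin 5) : ℕ) + 1 = 1 := rfl
  have w1 : ((1 : Fin 5) : ℕ) + 1 = 2 := rfl
  have w2 : ((2 : Fin 5) : ℕ) + 1 = 3 := rfl
  have w3 : ((3 : Fin 5) : ℕ) + 1 = 4 := rfl
  have w4 : ((4 : Fin 5) : ℕ) + 1 = 5 := rfl
  simp only [w0, w1, w2, w3, w4, v0, v1, v2, v3, v4, gam]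
  ring

/-- `f̂₁ = f̄₁ / γ₁₂₃₄(M)`. -/
noncomputable def f1hat {F : Type*} [Field F] (p : ℕ) (M : Matrix (Fin 2) (Fin 4) F) :
    MvPolynomial (Fin 3) F :=
  C (gam p M 1 2 3 4)⁻¹ * f1bar p M

/-- `β₃ = γ₁₂₃₅(M) / γ₁₂₃₄(M)`. -/
noncomputable def beta3 {F : Type*} [Field F] (p : ℕ) (M : Matrix (Fin 2) (Fin 4) F) : F :=
  gam p M 1 2 3 5 / gam p M 1 2 3 4

/-- `α₂ = -γ₁₂₃₇(M) / γ₁₂₃₅(M)`. -/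
noncomputable def alpha2 {F : Type*} [Field F] (p : ℕ) (M : Matrix (Fin 2) (Fin 4) F) : F :=
  -gam p M 1 2 3 7 / gam p M 1 2 3 5

/-- `α₁ = γ₁₂₅₇(M) / γ₁₂₃₅(M)`. -/
noncomputable def alpha1 {F : Type*} [Field F] (p : ℕ) (M : Matrix (Fin 2) (Fin 4) F) : F :=
  gam p M 1 2 5 7 / gam p M 1 2 3 5

/-- The subduction `N_M(y) - f̂₁^p + β₃^p x^(p³-2p²) f̂₁²` of `N_M(y)`. -/
noncomputable def h2tilde {F : Type*} [Field F] (p : ℕ) [Fact p.Prime]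
    (M : Matrix (Fin 2) (Fin 4) F) : MvPolynomial (Fin 3) F :=
  orbitNorm p M (X 1) - f1hat p M ^ p
    + C (beta3 p M ^ p) * X 0 ^ (p ^ 3 - 2 * p ^ 2) * f1hat p M ^ 2

/-- `h₂ = γ₁₂₃₄^(p+1) h̃₂ / (2 γ₁₂₃₅^(p+1) x^(p³-p²-2p))`. -/
noncomputable def h2 {F : Type*} [Field F] (p : ℕ) [Fact p.Prime]
    (M : Matrix (Fin 2) (Fin 4) F) : MvPolynomial (Fin 3) F :=
  C (gam p M 1 2 3 4 ^ (p + 1) / (2 * gam p M 1 2 3 5 ^ (p + 1))) *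
    (h2tilde p M).divMonomial (Finsupp.single 0 (p ^ 3 - p ^ 2 - 2 * p))

/-- The partial subduction of the tête-à-tête `(h₂^p, f̂₁^(p+2))`. -/
noncomputable def h3tilde {F : Type*} [Field F] (p : ℕ) [Fact p.Prime]
    (M : Matrix (Fin 2) (Fin 4) F) : MvPolynomial (Fin 3) F :=
  if p = 3 then
    h2 p M ^ 3 - f1hat p M ^ 5 + C (2 * beta3 p M) * f1hat p M ^ 3 * h2 p M * X 0 ^ 3
      - C (alpha2 p M * (beta3 p M ^ 3)⁻¹ + beta3 p M ^ 3) *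
          (f1hat p M ^ 4 * X 0 ^ 9 - C (beta3 p M) * f1hat p M ^ 2 * h2 p M * X 0 ^ 12)
      - C (alpha1 p M * (beta3 p M ^ 3)⁻¹ + alpha2 p M * (beta3 p M)⁻¹ + beta3 p M ^ 5) *
          h2 p M ^ 2 * X 0 ^ 15
  else
    h2 p M ^ p - f1hat p M ^ (p + 2)
      + C (2 * beta3 p M) * f1hat p M ^ p * h2 p M * X 0 ^ (p ^ 2 - 2 * p)
      - C (beta3 p M ^ p)⁻¹ *
          (C (alpha2 p M) * f1hat p M ^ (p + 1) * X 0 ^ p ^ 2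
            - C (alpha2 p M * beta3 p M) * f1hat p M ^ (p - 1) * h2 p M * X 0 ^ (2 * p ^ 2 - 2 * p)
            + C (alpha1 p M) * f1hat p M ^ ((p - 3) / 2) * h2 p M ^ ((p + 1) / 2) *
                X 0 ^ (2 * p ^ 2 - p))

/-- `h₃ = γ₁₂₃₅^(p+1) h̃₃ / (γ₂₃₅₇ γ₁₂₃₄^p x^(2p²-1))`. -/
noncomputable def h3 {F : Type*} [Field F] (p : ℕ) [Fact p.Prime]
    (M : Matrix (Fin 2) (Fin 4) F) : MvPolynomial (Fin 3) F :=
  C (gam p M 1 2 3 5 ^ (p + 1) / (gam p M 2 3 5 7 * gam p M 1 2 3 4 ^ p)) *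
    (h3tilde p M).divMonomial (Finsupp.single 0 (2 * p ^ 2 - 1))

/-- The family `x, f̂₁, h₂, h₃, N_M(z)`. -/
noncomputable def gens {F : Type*} [Field F] (p : ℕ) [Fact p.Prime]
    (M : Matrix (Fin 2) (Fin 4) F) : Fin 5 → MvPolynomial (Fin 3) F :=
  ![X 0, f1hat p M, h2 p M, h3 p M, orbitNorm p M (X 2)]

end RankFour

open RankFour

/-! Set `x = 1`. The first coordinates `c₁(e)` of the elements of `E` form an additive group of
order `p³`, and the `e` with `c₁(e) = 0` form a group of order `p` which acts on `F[y][z]` by `z ↦ z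
+ c₂(e)` (`card_ker`): `γ₁₂₃₅ ≠ 0` bounds this kernel by `p`, and `γ₁₃₅₇ = 0` makes every `c₁(e)` a
root of the additive polynomial `normPoly` of degree `p³`. Hence `normPoly` is `N_M(y)` at `x = 1`,
and since 0 is a simple root, `γ₂₃₅₇ ≠ 0`. An invariant of `z`-degree below `p` is free of `z`, and
an invariant in `F[y]` is a polynomial in `normPoly`. Given a monic invariant `f_l` of `z`-degree
`pl` for each `l`, division with remainder, which preserves invariance because it is unique, writes
every invariant of `F[y][z]` as a combination of the products `normPoly^i f_l`
(`mem_span_of_shift_eq`).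

Up to scalars such `f_l` are products of `f̂₁, h₂, h₃, N_M(z)`: at `x = 1` these have constant lead
coefficients and `z`-degrees `p, p², p³, p⁴`, so base `p` digits of `l` serve as exponents.
Homogenizing gives `x^K g = ∑ c x^k N_M(y)^i f_l` for a homogeneous invariant `g`
(`exists_X_pow_mul_eq`). The lead monomials of `f̂₁, h₂, h₃` are powers of `y` with exponents `p²`,
`p² + 2p`, `p³ + 1`; reading exponents modulo `p`, with `p` odd, shows that the terms of the sum
have distinct lead monomials (`exponent_injective`). Nothing cancels, so `LM(g)` is a product of
lead monomials of the basis, where `LM(N_M(y)) = LM(f̂₁^p)`. This is the SAGBI property; subduction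
then terminates at zero and gives generation.

That `h₂` and `h₃` are polynomials with these lead monomials is a computation with Frobenius. Write
`f̂₁ = y^(p²) + x^(p²-2p) g`. The formula for `g^p` in `tailG_pow_eq` exhibits `h₂`; combined with
the expression of `β₃h₂` through `f̂₁g` in `mul_h_eq`, it expands `h₂^p - f̂₁^(p+2)` modulo
`x^(2p²)` (`teteATete_eq`). After the prescribed subtractions a nonzero multiple of `γ₂₃₅₇ x^(2p²-1)
y^(p³+1)` remains.

For the relations, monomials in `X₀, …, X₄` are ordered by the lead monomial of the corresponding
power product, with ties broken by the exponents of `X₃` and `X₂`. The two relations then have lead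
monomials `X₂^p` and `X₃^p`. Lead monomials separate the power products in which `h₂, h₃` have
exponents below `p`, so division by the relations leaves no remainder on the kernel; coprimality of
`X₂^p` and `X₃^p` gives regularity (`ker_eq_span_and_isRegular`). -/

namespace RankFour

/-! ### The Frobenius identity behind `h₂` -/

section Identities

variable {A : Type*} [CommRing A]

/-- The polynomial `g` with `f̂₁ = y^(p^2) + x^(p^2-2p) g`. -/
def tailG (p : ℕ) (x y d b b₂ b₁ b₀ : A) : A :=
  b * d ^ p + b₂ * y ^ p * x ^ p + b₁ * d * x ^ (2 * p - 2) + b₀ * y * x ^ (2 * p - 1)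

/-- The polynomial `s` with `N_M(y) = y^(p^3) + x^(p^3-2p^2) s`. -/
def tailS (p : ℕ) (x y a₂ a₁ a₀ : A) : A :=
  a₂ * x ^ p ^ 2 * y ^ p ^ 2 + a₁ * x ^ (2 * p ^ 2 - p) * y ^ p + a₀ * x ^ (2 * p ^ 2 - 1) * y

/-- The coefficient of `x^(2p)` in `coreH`. -/
def tailW (p : ℕ) (x y z d b b₂ b₁ b₀ a₂ a₁ a₀ : A) : A :=
  b ^ p * z ^ p ^ 2 + a₂ * y ^ p ^ 2 + a₁ * y ^ p * x ^ (p ^ 2 - p) + a₀ * y * x ^ (p ^ 2 - 1)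
    - (b₂ ^ p * y ^ p ^ 2 + b₁ ^ p * d ^ p * x ^ (p ^ 2 - 2 * p) + b₀ ^ p * y ^ p * x ^ (p ^ 2 - p))

/-- The polynomial `2 β₃^(p+1) h₂`. -/
def coreH (p : ℕ) (x y z d b b₂ b₁ b₀ a₂ a₁ a₀ : A) : A :=
  b ^ p * (2 * y ^ p ^ 2 * tailG p x y d b b₂ b₁ b₀
      + x ^ (p ^ 2 - 2 * p) * tailG p x y d b b₂ b₁ b₀ ^ 2)
    + x ^ (2 * p) * tailW p x y z d b b₂ b₁ b₀ a₂ a₁ a₀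

variable (p : ℕ) [hpr : Fact p.Prime] [CharP A p]

/-- Frobenius is additive, and every term of `tailG` except `b d^p` is divisible by `x^p`. -/
theorem tailG_pow (hp : 3 ≤ p) (x y d b b₂ b₁ b₀ : A) :
    tailG p x y d b b₂ b₁ b₀ ^ p = b ^ p * d ^ p ^ 2 + x ^ p ^ 2 *
      (b₂ ^ p * y ^ p ^ 2 + b₁ ^ p * d ^ p * x ^ (p ^ 2 - 2 * p)
        + b₀ ^ p * y ^ p * x ^ (p ^ 2 - p)) := by
  obtain ⟨q, rfl⟩ : ∃ q, p = q + 3 := ⟨p - 3, by omega⟩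
  have e1 : (q + 3) ^ 2 - 2 * (q + 3) = q ^ 2 + 4 * q + 3 := by
    rw [Nat.sub_eq_iff_eq_add (by nlinarith)]; ring
  have e2 : (q + 3) ^ 2 - (q + 3) = q ^ 2 + 5 * q + 6 := by
    rw [Nat.sub_eq_iff_eq_add (by nlinarith)]; ring
  have e3 : 2 * (q + 3) - 2 = 2 * q + 4 := by omega
  have e4 : 2 * (q + 3) - 1 = 2 * q + 5 := by omega
  rw [tailG, add_pow_char, add_pow_char, add_pow_char, e1, e2, e3, e4]
  simp only [mul_pow, ← pow_mul]
  ring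

/-- In `tailG_pow` one has `d^(p²) = y^(2p²) - x^(p²) z^(p²)`. Replacing `y^(2p²)` by the square of
`f̂₁` leaves cross terms; these, the `z^(p²)` term and the remaining tails share the factor
`x^(p²-2p)`, and `coreH` is the cofactor. -/
theorem tailG_pow_eq (hp : 3 ≤ p) (x y z d b b₂ b₁ b₀ a₂ a₁ a₀ : A) (hd : d = y ^ 2 - x * z) :
    tailG p x y d b b₂ b₁ b₀ ^ p = tailS p x y a₂ a₁ a₀
      + b ^ p * (y ^ p ^ 2 + x ^ (p ^ 2 - 2 * p) * tailG p x y d b b₂ b₁ b₀) ^ 2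
      - x ^ (p ^ 2 - 2 * p) * coreH p x y z d b b₂ b₁ b₀ a₂ a₁ a₀ := by
  rw [tailG_pow p hp, coreH, tailS, tailW]
  have hdp : d ^ p ^ 2 = (y ^ p ^ 2) ^ 2 - x ^ p ^ 2 * z ^ p ^ 2 := by
    rw [hd, sub_pow_char_pow, mul_pow]
    ring
  rw [hdp]
  have hpp : 3 * p ≤ p ^ 2 := by nlinarith
  obtain ⟨k, hk⟩ : ∃ k, p ^ 2 = k + 2 * p := ⟨p ^ 2 - 2 * p, by omega⟩
  obtain ⟨q, hq⟩ : ∃ q, p = q + 1 := ⟨p - 1, by omega⟩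
  generalize tailG p x y d b b₂ b₁ b₀ = g
  rw [hk]
  have e1 : k + 2 * p - 2 * p = k := by omega
  have e2 : k + 2 * p - p = k + p := by omega
  have e3 : 2 * (k + 2 * p) - p = (k + 2 * p) + k + p := by omega
  have e4 : k + 2 * p - 1 = k + p + q := by omega
  have e5 : 2 * (k + 2 * p) - 1 = (k + 2 * p) + k + p + q := by omega
  rw [e1, e2, e3, e4, e5]
  ring

end Identities
end RankFour

namespace RankFour

/-! ### The tête-à-tête `(h₂^p, f̂₁^(p+2))` modulo `x^(2p²)` -/

section Identities

variable {A : Type*} [CommRing A] (p : ℕ)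

theorem inv_two_pow_char [Fact p.Prime] [CharP A p] {c : A} (hc : 2 * c = 1) : c ^ p = c := by
  have h2 : (2 : A) ^ p = 2 := by
    rw [← one_add_one_eq_two, add_pow_char, one_pow]
  calc c ^ p = c ^ p * (2 * c) := by rw [hc, mul_one]
    _ = (2 * c) ^ p * c := by rw [mul_pow, h2]; ring
    _ = c := by rw [hc, one_pow, one_mul]

variable {x y z d b b' c b₂ b₁ b₀ a₂ a₁ a₀ f h : A}

/-- `β₃ h₂` expressed by `f̂₁` and `g`. -/
theorem mul_h_eq (hb : b * b' = 1) (hc : 2 * c = 1)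
    (hf : f = y ^ p ^ 2 + x ^ (p ^ 2 - 2 * p) * tailG p x y d b b₂ b₁ b₀)
    (hh : 2 * b ^ (p + 1) * h = coreH p x y z d b b₂ b₁ b₀ a₂ a₁ a₀) :
    b * h = f * tailG p x y d b b₂ b₁ b₀
      - c * x ^ (p ^ 2 - 2 * p) * tailG p x y d b b₂ b₁ b₀ ^ 2
      + x ^ (2 * p) * (c * b' ^ p * tailW p x y z d b b₂ b₁ b₀ a₂ a₁ a₀) := by
  have hbp : b ^ p * b' ^ p = 1 := by rw [← mul_pow, hb, one_pow]
  have e : b * h = c * b' ^ p * coreH p x y z d b b₂ b₁ b₀ a₂ a₁ a₀ := by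
    rw [← hh]
    linear_combination (-b * h * 2 * c) * hbp - b * h * hc
  rw [e, coreH, hf]
  generalize tailG p x y d b b₂ b₁ b₀ = g
  generalize tailW p x y z d b b₂ b₁ b₀ a₂ a₁ a₀ = w
  linear_combination (c * (2 * y ^ p ^ 2 * g + x ^ (p ^ 2 - 2 * p) * g ^ 2)) * hbp
    + (y ^ p ^ 2 * g + x ^ (p ^ 2 - 2 * p) * g ^ 2) * hc

/-- The reduction of `h₂^p - f̂₁^(p+2)` modulo `x^(2p^2)`, before the last substitutions. -/
theorem teteATete_eq [Fact p.Prime] [CharP A p] (hp : 3 ≤ p) (hd : d = y ^ 2 - x * z) (hb : b * b' = 1) (hc : 2 * c = 1)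
    (hf : f = y ^ p ^ 2 + x ^ (p ^ 2 - 2 * p) * tailG p x y d b b₂ b₁ b₀)
    (hh : 2 * b ^ (p + 1) * h = coreH p x y z d b b₂ b₁ b₀ a₂ a₁ a₀) :
    ∃ t, b ^ p * (h ^ p - f ^ (p + 2) + 2 * b * f ^ p * h * x ^ (p ^ 2 - 2 * p))
      = a₂ * f ^ (p + 1) * x ^ p ^ 2 - a₂ * b * f ^ (p - 1) * h * x ^ (2 * p ^ 2 - 2 * p)
        - a₂ * c * x ^ (p ^ 2 + 2 * (p ^ 2 - 2 * p)) * f ^ (p - 1)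
            * tailG p x y d b b₂ b₁ b₀ ^ 2
        + a₁ * x ^ (2 * p ^ 2 - p) * (f ^ p * y ^ p)
        + a₀ * x ^ (2 * p ^ 2 - 1) * (f ^ p * y)
        - c * x ^ (p * (p ^ 2 - 2 * p)) * (tailG p x y d b b₂ b₁ b₀ ^ p) ^ 2
        + x ^ (2 * p ^ 2) * t := by
  have hG := tailG_pow_eq p hp x y z d b b₂ b₁ b₀ a₂ a₁ a₀ hd
  have hbh := mul_h_eq p hb hc hf hh
  rw [← hf, ← hh] at hG
  generalize tailW p x y z d b b₂ b₁ b₀ a₂ a₁ a₀ = w at *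
  generalize tailG p x y d b b₂ b₁ b₀ = g at *
  -- The `p`-th power of `mul_h_eq`, taken termwise by Frobenius; `c = 1/2` is fixed.
  have hbhp : b ^ p * h ^ p = f ^ p * g ^ p - c * x ^ (p * (p ^ 2 - 2 * p)) * (g ^ p) ^ 2
      + x ^ (2 * p ^ 2) * (c * b' ^ p * w) ^ p := by
    have := congrArg (· ^ p) hbh
    simp only [add_pow_char, sub_pow_char, mul_pow, inv_two_pow_char p hc] at this
    rw [this]
    simp only [mul_pow, ← pow_mul, inv_two_pow_char p hc]
    ring
  have hpp : 3 * p ≤ p ^ 2 := by nlinarith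
  obtain ⟨k, hk⟩ : ∃ k, p ^ 2 = k + 2 * p := ⟨p ^ 2 - 2 * p, by omega⟩
  have e1 : p ^ 2 - 2 * p = k := by omega
  have e2 : 2 * p ^ 2 - 2 * p = p ^ 2 + k := by omega
  have e6 : p * (p ^ 2 - 2 * p) = p * k := by rw [e1]
  have e7 : 2 * p ^ 2 = p ^ 2 + k + 2 * p := by omega
  -- The first summand is the last term of `hbhp`; the second is the error made when `f^p g` is
  -- rewritten by `h1` below.
  refine ⟨(c * b' ^ p * w) ^ p + a₂ * f ^ (p - 1) * (c * b' ^ p * w), ?_⟩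
  have hfp : f ^ p = f ^ (p - 1) * f := by rw [← pow_succ]; congr 1; omega
  -- The factor `y^(p²)` in the leading term of `tailS` is exchanged for `f - x^k g`, so that only
  -- the terms with `a₁` and `a₀` still contain `y`.
  have hS : tailS p x y a₂ a₁ a₀ = a₂ * x ^ p ^ 2 * (f - x ^ k * g)
      + a₁ * x ^ (2 * p ^ 2 - p) * y ^ p + a₀ * x ^ (2 * p ^ 2 - 1) * y := by
    rw [hf, e1, tailS]
    ring
  rw [hS] at hG
  rw [e6] at hbhp ⊢
  rw [e1] at hG hbh ⊢
  rw [e2]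
  have hx : x ^ (2 * p ^ 2) = x ^ p ^ 2 * x ^ k * x ^ (2 * p) := by rw [e7, pow_add, pow_add]
  have hx' : x ^ (p ^ 2 + 2 * k) = x ^ p ^ 2 * x ^ k * x ^ k := by
    rw [← pow_add, ← pow_add]; congr 1; ring
  rw [mul_add, mul_sub, hbhp, pow_add f p 2, pow_succ f p, pow_add x (p ^ 2) k, hx']
  generalize (c * b' ^ p * w) = w' at *
  -- One factor `f` is split off so that `hbh` can trade `f g` for `b h`.
  have h1 : f ^ p * g = f ^ (p - 1) * (b * h + c * x ^ k * g ^ 2 - x ^ (2 * p) * w') := by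
    rw [hbh, hfp]; ring
  generalize c * x ^ (p * k) * (g ^ p) ^ 2 = r
  generalize x ^ (2 * p ^ 2 - p) = x1 at *
  generalize x ^ (2 * p ^ 2 - 1) = x2 at *
  rw [mul_add (x ^ (2 * p ^ 2)), hx]
  generalize x ^ (2 * p) = x3 at *
  generalize x ^ p ^ 2 = x4 at *
  rw [pow_succ b p] at hG
  generalize x ^ k = x5 at *
  linear_combination f ^ p * hG - a₂ * x4 * x5 * h1

/-- Modulo `x^p` the tail `g` is `b y^(2p)`, and `b h` is `f g`. Precision `x^p`, rather than the
`x` that lead monomials need, is what the `a₁` term requires: its factor `x^(2p²-p)` lifts the error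
to `x^(2p²)`. -/
theorem dvd_sub_leading [Fact p.Prime] [CharP A p] (hp : 3 ≤ p) (hd : d = y ^ 2 - x * z) (hb : b * b' = 1) (hc : 2 * c = 1)
    (hf : f = y ^ p ^ 2 + x ^ (p ^ 2 - 2 * p) * tailG p x y d b b₂ b₁ b₀)
    (hh : 2 * b ^ (p + 1) * h = coreH p x y z d b b₂ b₁ b₀ a₂ a₁ a₀) :
    x ^ p ∣ f - y ^ p ^ 2 ∧ x ^ p ∣ h - y ^ (p ^ 2 + 2 * p) := by
  have hpp : 3 * p ≤ p ^ 2 := by nlinarith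
  have h1 : x ^ p ∣ x ^ (p ^ 2 - 2 * p) := pow_dvd_pow x (by omega)
  have h2 : x ^ p ∣ x ^ (2 * p) := pow_dvd_pow x (by omega)
  have h3 : x ^ p ∣ f - y ^ p ^ 2 := by
    rw [hf, add_sub_cancel_left]
    exact h1.mul_right _
  refine ⟨h3, ?_⟩
  have hbh := mul_h_eq p hb hc hf hh
  have h4 : x ^ p ∣ tailG p x y d b b₂ b₁ b₀ - b * y ^ (2 * p) := by
    have e : tailG p x y d b b₂ b₁ b₀ - b * y ^ (2 * p) = x ^ p * (-(b * z ^ p) + b₂ * y ^ p)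
        + b₁ * d * x ^ (2 * p - 2) + b₀ * y * x ^ (2 * p - 1) := by
      rw [tailG, hd, sub_pow_char]
      ring
    rw [e]
    exact dvd_add (dvd_add (dvd_mul_right _ _) ((pow_dvd_pow x (by omega)).mul_left _))
      ((pow_dvd_pow x (by omega)).mul_left _)
  generalize tailG p x y d b b₂ b₁ b₀ = g at *
  generalize c * b' ^ p * tailW p x y z d b b₂ b₁ b₀ a₂ a₁ a₀ = w at *
  have e : h - y ^ (p ^ 2 + 2 * p) = b' * ((f - y ^ p ^ 2) * g + y ^ p ^ 2 * (g - b * y ^ (2 * p))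
      + (x ^ (2 * p) * w - x ^ (p ^ 2 - 2 * p) * (c * g ^ 2))) := by
    linear_combination (-h + y ^ (p ^ 2 + 2 * p)) * hb + b' * hbh
  rw [e]
  exact (dvd_add (dvd_add (h3.mul_right _) (h4.mul_left _))
    (dvd_sub (h2.mul_right _) (h1.mul_right _))).mul_left _

theorem dvd_mul_sub_mul_pow {a a' e e' r : A} (h₁ : r ∣ a - a') (h₂ : r ∣ e - e') (m n : ℕ) :
    r ∣ a ^ m * e ^ n - a' ^ m * e' ^ n := by
  have e : a ^ m * e ^ n - a' ^ m * e' ^ n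
      = (a ^ m - a' ^ m) * e ^ n + a' ^ m * (e ^ n - e' ^ n) := by ring
  rw [e]
  exact dvd_add ((h₁.trans (sub_dvd_pow_sub_pow _ _ _)).mul_right _)
    ((h₂.trans (sub_dvd_pow_sub_pow _ _ _)).mul_left _)

/-- `h̃₃` up to a multiple of `x^(2p^2)`, for `p ≥ 5`. -/
theorem exists_h3tilde_eq_of_five_le [Fact p.Prime] [CharP A p] (hp : 5 ≤ p) (hodd : Odd p) (hd : d = y ^ 2 - x * z)
    (hb : b * b' = 1) (hc : 2 * c = 1)
    (hf : f = y ^ p ^ 2 + x ^ (p ^ 2 - 2 * p) * tailG p x y d b b₂ b₁ b₀)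
    (hh : 2 * b ^ (p + 1) * h = coreH p x y z d b b₂ b₁ b₀ a₂ a₁ a₀) :
    ∃ t, h ^ p - f ^ (p + 2) + 2 * b * f ^ p * h * x ^ (p ^ 2 - 2 * p)
      - b' ^ p * (a₂ * f ^ (p + 1) * x ^ p ^ 2
          - a₂ * b * f ^ (p - 1) * h * x ^ (2 * p ^ 2 - 2 * p)
          + a₁ * f ^ ((p - 3) / 2) * h ^ ((p + 1) / 2) * x ^ (2 * p ^ 2 - p))
      = x ^ (2 * p ^ 2 - 1) * (b' ^ p * a₀ * y ^ (p ^ 3 + 1) + x * t) := by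
  obtain ⟨t, ht⟩ := teteATete_eq p (by omega) hd hb hc hf hh
  obtain ⟨h1, h2⟩ := dvd_sub_leading p (by omega) hd hb hc hf hh
  have hbp : b ^ p * b' ^ p = 1 := by rw [← mul_pow, hb, one_pow]
  have hp5 : 5 * p ≤ p ^ 2 := by nlinarith
  obtain ⟨m, rfl⟩ : ∃ m, p = 2 * m + 3 := by
    obtain ⟨m, hm⟩ := hodd
    exact ⟨m - 1, by omega⟩
  have h7 := dvd_mul_sub_mul_pow h1 h2 m (m + 2)
  have h7' := h1.trans (sub_dvd_pow_sub_pow f (y ^ (2 * m + 3) ^ 2) (2 * m + 3))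
  generalize hq : 2 * m + 3 = q at *
  have e0 : (q - 3) / 2 = m := by omega
  have e1 : (q + 1) / 2 = m + 2 := by omega
  rw [e0, e1]
  have h8 : x ∣ f ^ q * y - y ^ (q ^ 3 + 1) := by
    have : x ∣ x ^ q := dvd_pow_self x (by omega)
    have e : f ^ q * y - y ^ (q ^ 3 + 1) = (f ^ q - (y ^ q ^ 2) ^ q) * y := by
      ring
    rw [e]
    exact (this.trans h7').mul_right _
  -- The power product is chosen to match exponents of `y`: with `q = 2m + 3`, `m q² + (m + 2)(q² +
  -- 2q) = q³ + q`.
  have h9 : x ^ q ∣ f ^ q * y ^ q - f ^ m * h ^ (m + 2) := by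
    have e : f ^ q * y ^ q - f ^ m * h ^ (m + 2)
        = (f ^ q - (y ^ q ^ 2) ^ q) * y ^ q
          - (f ^ m * h ^ (m + 2) - (y ^ q ^ 2) ^ m * (y ^ (q ^ 2 + 2 * q)) ^ (m + 2)) := by
      have : (y ^ q ^ 2) ^ m * (y ^ (q ^ 2 + 2 * q)) ^ (m + 2) = (y ^ q ^ 2) ^ q * y ^ q := by
        rw [← pow_mul, ← pow_mul, ← pow_mul, ← pow_add, ← pow_add, ← hq]
        congr 1
        ring
      rw [this]
      ring
    rw [e]
    exact dvd_sub (h7'.mul_right _) h7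
  obtain ⟨u, hu⟩ := h8
  obtain ⟨v, hv⟩ := h9
  generalize tailG q x y d b b₂ b₁ b₀ = g at *
  -- The two terms with `g²` and `(g^q)²` carry `x^(3q²-4q)` and `x^(q³-2q²)`. Both exponents are at
  -- least `2q²` exactly because `q ≥ 5`; for `p = 3` they are 15 and 9, below 18, which accounts
  -- for the extra terms there.
  have x1 : x ^ (q ^ 2 + 2 * (q ^ 2 - 2 * q)) = x ^ (2 * q ^ 2) * x ^ (q ^ 2 - 4 * q) := by
    rw [← pow_add]; congr 1; omega
  have x2 : x ^ (q * (q ^ 2 - 2 * q)) = x ^ (2 * q ^ 2) * x ^ (q * (q ^ 2 - 2 * q) - 2 * q ^ 2) := by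
    rw [← pow_add]; congr 1
    have : q ^ 2 * 2 ≤ q * (q ^ 2 - 2 * q) := by
      calc q ^ 2 * 2 ≤ q * (3 * q) := by nlinarith
        _ ≤ _ := Nat.mul_le_mul_left _ (by omega)
    omega
  have x3 : x ^ (2 * q ^ 2) = x ^ (2 * q ^ 2 - 1) * x := by
    rw [← pow_succ]; congr 1; omega
  have x4 : x ^ (2 * q ^ 2 - q) * x ^ q = x ^ (2 * q ^ 2 - 1) * x := by
    rw [← x3, ← pow_add]; congr 1; omega
  rw [x1, x2, x3] at ht
  have hq1 : f ^ q * y = y ^ (q ^ 3 + 1) + x * u := by linear_combination hu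
  have hq2 : f ^ q * y ^ q = f ^ m * h ^ (m + 2) + x ^ q * v := by linear_combination hv
  rw [hq1, hq2] at ht
  generalize hT : h ^ q - f ^ (q + 2) + 2 * b * f ^ q * h * x ^ (q ^ 2 - 2 * q) = T at *
  generalize x ^ (q * (q ^ 2 - 2 * q) - 2 * q ^ 2) = x5 at *
  generalize x ^ (q ^ 2 - 4 * q) = x6 at *
  generalize x ^ (2 * q ^ 2 - q) = x7 at *
  generalize x ^ (2 * q ^ 2 - 1) = x8 at *
  refine ⟨b' ^ q * (-(a₂ * c * x6 * f ^ (q - 1) * g ^ 2) + a₁ * v + a₀ * u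
    - c * x5 * (g ^ q) ^ 2 + t), ?_⟩
  linear_combination b' ^ q * ht - T * hbp + b' ^ q * a₁ * v * x4

/-- `h̃₃` up to a multiple of `x^18`, for `p = 3`. -/
theorem exists_h3tilde_eq_three [CharP A 3] (hd : d = y ^ 2 - x * z)
    (hb : b * b' = 1)
    (hf : f = y ^ 3 ^ 2 + x ^ (3 ^ 2 - 2 * 3) * tailG 3 x y d b b₂ b₁ b₀)
    (hh : 2 * b ^ (3 + 1) * h = coreH 3 x y z d b b₂ b₁ b₀ a₂ a₁ a₀) :
    ∃ t, h ^ 3 - f ^ 5 + 2 * b * f ^ 3 * h * x ^ 3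
      - (a₂ * b' ^ 3 + b ^ 3) * (f ^ 4 * x ^ 9 - b * f ^ 2 * h * x ^ 12)
      - (a₁ * b' ^ 3 + a₂ * b' + b ^ 5) * h ^ 2 * x ^ 15
      = x ^ 17 * (b' ^ 3 * a₀ * y ^ 28 + x * t) := by
  have h3 : (3 : A) = 0 := by exact_mod_cast CharP.cast_eq_zero A 3
  -- In characteristic 3 the inverse of 2 is `-1`.
  have hc : (2 : A) * (-1) = 1 := by linear_combination -h3
  have : Fact (Nat.Prime 3) := ⟨Nat.prime_three⟩
  obtain ⟨t, ht⟩ := teteATete_eq 3 le_rfl hd hb hc hf hh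
  obtain ⟨⟨u, hu⟩, ⟨v, hv⟩⟩ := dvd_sub_leading 3 le_rfl hd hb hc hf hh
  have hbh := mul_h_eq 3 hb hc hf hh
  have hG := tailG_pow_eq 3 le_rfl x y z d b b₂ b₁ b₀ a₂ a₁ a₀ hd
  rw [← hf, ← hh, tailS] at hG
  generalize tailG 3 x y d b b₂ b₁ b₀ = g at *
  generalize -1 * b' ^ 3 * tailW 3 x y z d b b₂ b₁ b₀ a₂ a₁ a₀ = w at *
  norm_num at ht hu hv hbh hG ⊢
  have hf3 : f ^ 3 = y ^ 27 + x ^ 9 * u ^ 3 := by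
    rw [show f = y ^ 9 + x ^ 3 * u by linear_combination hu, add_pow_char]
    ring
  have hb3 : b ^ 3 * b' ^ 3 = 1 := by rw [← mul_pow, hb, one_pow]
  have hb2 : b ^ 2 * b' ^ 2 = 1 := by rw [← mul_pow, hb, one_pow]
  have hy3 : f ^ 3 * y ^ 3 = h ^ 2 + x ^ 3 * (x ^ 6 * u ^ 3 * y ^ 3 - 2 * y ^ 15 * v - x ^ 3 * v ^ 2) := by
    rw [hf3, show h = y ^ 15 + x ^ 3 * v by linear_combination hv]
    ring
  have hy1 : f ^ 3 * y = y ^ 28 + x * (x ^ 8 * u ^ 3 * y) := by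
    rw [hf3]
    ring
  generalize x ^ 6 * u ^ 3 * y ^ 3 - 2 * y ^ 15 * v - x ^ 3 * v ^ 2 = v' at hy3
  generalize x ^ 8 * u ^ 3 * y = u' at hy1
  -- The `g²` term has only the factor `x^15`, so it must be known modulo `x^3`; it produces the
  -- coefficient `α₂ β₃⁻¹` of `h₂² x^15`.
  have hfg : f ^ 2 * g ^ 2 = b ^ 2 * h ^ 2 + x ^ 3 * (-2 * b * h * (g ^ 2 + x ^ 3 * w)
      + x ^ 3 * (g ^ 2 + x ^ 3 * w) ^ 2) := by
    have : f * g = b * h - x ^ 3 * (g ^ 2 + x ^ 3 * w) := by linear_combination -hbh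
    rw [← mul_pow, this]
    ring
  generalize -2 * b * h * (g ^ 2 + x ^ 3 * w) + x ^ 3 * (g ^ 2 + x ^ 3 * w) ^ 2 = r at hfg
  -- The term `(g^3)²` has the factor `x^9`, so it is needed modulo `x^9`. Multiplied by `β₃⁻³`, it
  -- gives the terms with `β₃^3`, `β₃^4` and `β₃^5` in `h̃₃`.
  have hG2 : ∃ s, (g ^ 3) ^ 2 = b ^ 6 * f ^ 4 - b ^ 7 * x ^ 3 * f ^ 2 * h
      + b ^ 8 * x ^ 6 * h ^ 2 + x ^ 9 * s := by
    have e : g ^ 3 = x ^ 9 * (a₂ * y ^ 9 + a₁ * x ^ 6 * y ^ 3 + a₀ * x ^ 8 * y)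
        + (b ^ 3 * f ^ 2 + b ^ 4 * x ^ 3 * h) := by
      linear_combination hG - b ^ 4 * x ^ 3 * h * h3
    generalize a₂ * y ^ 9 + a₁ * x ^ 6 * y ^ 3 + a₀ * x ^ 8 * y = s at e
    rw [e]
    exact ⟨x ^ 9 * s ^ 2 + 2 * s * (b ^ 3 * f ^ 2 + b ^ 4 * x ^ 3 * h),
      by linear_combination b ^ 7 * x ^ 3 * f ^ 2 * h * h3⟩
  obtain ⟨s, hs⟩ := hG2
  rw [← pow_mul] at hs
  norm_num at hs
  refine ⟨b' ^ 3 * (a₂ * r + a₁ * v' + a₀ * u' + s + t), ?_⟩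
  generalize hT : h ^ 3 - f ^ 5 + 2 * b * f ^ 3 * h * x ^ 3 = T at *
  linear_combination b' ^ 3 * ht - T * hb3 + b' ^ 3 * a₂ * x ^ 15 * hfg + b' ^ 3 * a₁ * x ^ 15 * hy3
    + b' ^ 3 * a₀ * x ^ 17 * hy1 + b' ^ 3 * x ^ 9 * hs
    + (b ^ 3 * (f ^ 4 * x ^ 9 - b * f ^ 2 * h * x ^ 12) + b ^ 5 * h ^ 2 * x ^ 15) * hb3
    + a₂ * b' * h ^ 2 * x ^ 15 * hb2

end Identities
end RankFour

namespace RankFour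

/-! ### The group of first coordinates and its additive polynomial -/

section Coordinates

variable {F : Type*} [Field F] (p : ℕ) (M : Matrix (Fin 2) (Fin 4) F)

/-- Laplace expansion along the last column of a 5×5 determinant in which that column is a
combination of the other four. -/
theorem cramer_four (A : Fin 5 → Fin 4 → F) (w : Fin 4 → F) :
    Matrix.det (Matrix.of ![A 0, A 1, A 2, A 3]) * (∑ j, w j * A 4 j)
      - Matrix.det (Matrix.of ![A 0, A 1, A 2, A 4]) * (∑ j, w j * A 3 j)
      + Matrix.det (Matrix.of ![A 0, A 1, A 3, A 4]) * (∑ j, w j * A 2 j)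
      - Matrix.det (Matrix.of ![A 0, A 2, A 3, A 4]) * (∑ j, w j * A 1 j)
      + Matrix.det (Matrix.of ![A 1, A 2, A 3, A 4]) * (∑ j, w j * A 0 j) = 0 := by
  simp [Matrix.det_succ_row_zero, Fin.sum_univ_succ, Fin.succAbove]
  ring

/-- Rows 1, 2, 3, 4, 5 yield the invariance of `f̄₁`, and rows 1, 2, 3, 5, 7 the equation satisfied
by the first coordinates. -/
theorem gam_relation (r₀ r₁ r₂ r₃ r₄ : ℕ) (e : Fin 4 → ZMod p) :
    gam p M r₀ r₁ r₂ r₃ * (∑ j, (ZMod.cast (e j) : F) * gammaRow p M r₄ j)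
      - gam p M r₀ r₁ r₂ r₄ * (∑ j, (ZMod.cast (e j) : F) * gammaRow p M r₃ j)
      + gam p M r₀ r₁ r₃ r₄ * (∑ j, (ZMod.cast (e j) : F) * gammaRow p M r₂ j)
      - gam p M r₀ r₂ r₃ r₄ * (∑ j, (ZMod.cast (e j) : F) * gammaRow p M r₁ j)
      + gam p M r₁ r₂ r₃ r₄ * (∑ j, (ZMod.cast (e j) : F) * gammaRow p M r₀ j) = 0 :=
  cramer_four ![gammaRow p M r₀, gammaRow p M r₁, gammaRow p M r₂, gammaRow p M r₃,
    gammaRow p M r₄] (fun j => ZMod.cast (e j))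

theorem gam_eq_zero {i j k l : ℕ} {w : Fin 4 → F} (hw : w ≠ 0)
    (hi : ∑ t, w t * gammaRow p M i t = 0) (hj : ∑ t, w t * gammaRow p M j t = 0)
    (hk : ∑ t, w t * gammaRow p M k t = 0) (hl : ∑ t, w t * gammaRow p M l t = 0) :
    gam p M i j k l = 0 := by
  rw [gam, ← Matrix.exists_mulVec_eq_zero_iff]
  refine ⟨w, hw, ?_⟩
  ext r
  simp only [Matrix.mulVec, dotProduct, Matrix.of_apply, Pi.zero_apply]
  simp only [mul_comm (w _)] at hi hj hk hl
  fin_cases r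
  · exact hi
  · exact hj
  · exact hk
  · exact hl

open Polynomial in
/-- The additive polynomial `Y^(p^3) + α₂ Y^(p^2) + α₁ Y^p + α₀ Y`. -/
noncomputable def normPoly (p : ℕ) (M : Matrix (Fin 2) (Fin 4) F) : F[X] :=
  X ^ p ^ 3 + C (alpha2 p M) * X ^ p ^ 2 + C (alpha1 p M) * X ^ p
    + C (gam p M 2 3 5 7 / gam p M 1 2 3 5) * X

open Polynomial in
variable {p M} in
theorem normPoly_natDegree_monic [Fact p.Prime] : (normPoly p M).natDegree = p ^ 3 ∧ (normPoly p M).Monic := by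
  have hp1 := (Fact.out : p.Prime).one_lt
  have h1 : p < p ^ 3 := lt_self_pow₀ hp1 (by norm_num)
  have h2 : p ^ 2 < p ^ 3 := Nat.pow_lt_pow_right hp1 (by norm_num)
  have hd : (C (alpha2 p M) * X ^ p ^ 2 + C (alpha1 p M) * X ^ p
    + C (gam p M 2 3 5 7 / gam p M 1 2 3 5) * X : F[X]).degree < (p ^ 3 : ℕ) := by
    refine (degree_add_le _ _).trans_lt (max_lt ((degree_add_le _ _).trans_lt (max_lt ?_ ?_)) ?_)
    · exact (degree_C_mul_X_pow_le _ _).trans_lt (by exact_mod_cast h2)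
    · exact (degree_C_mul_X_pow_le _ _).trans_lt (by exact_mod_cast h1)
    · exact (degree_C_mul_X_le _).trans_lt (by exact_mod_cast hp1.trans h1)
  have e : normPoly p M = X ^ p ^ 3 + (C (alpha2 p M) * X ^ p ^ 2 + C (alpha1 p M) * X ^ p
    + C (gam p M 2 3 5 7 / gam p M 1 2 3 5) * X) := by rw [normPoly]; ring
  rw [e]
  refine ⟨?_, monic_X_pow_add hd⟩
  rw [natDegree_add_eq_left_of_degree_lt (by rwa [degree_X_pow]), natDegree_X_pow]

variable [hpr : Fact p.Prime] [CharP F p]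

theorem cast_pow_pow (a : ZMod p) (k : ℕ) : (ZMod.cast a : F) ^ p ^ k = ZMod.cast a := by
  have h : ∀ b : ZMod p, (ZMod.cast b : F) = ZMod.castHom (dvd_refl p) F b := fun _ => rfl
  rw [h, ← map_pow, ZMod.pow_card_pow]

theorem coord_pow (i : Fin 2) (e : Fin 4 → ZMod p) (k : ℕ) :
    coord p M i e ^ p ^ k = ∑ j, (ZMod.cast (e j) : F) * M i j ^ p ^ k := by
  rw [coord, sum_pow_char_pow]
  exact Finset.sum_congr rfl fun j _ => by rw [mul_pow, cast_pow_pow]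

theorem coord_add (i : Fin 2) (e e' : Fin 4 → ZMod p) :
    coord p M i (e + e') = coord p M i e + coord p M i e' := by
  simp only [coord, ← Finset.sum_add_distrib]
  exact Finset.sum_congr rfl fun j _ => by
    rw [Pi.add_apply, ZMod.cast_add (dvd_refl p), add_mul]

/-- `coord` as a homomorphism. -/
def coordHom (i : Fin 2) : (Fin 4 → ZMod p) →+ F :=
  AddMonoidHom.mk' (coord p M i) (coord_add p M i)

theorem sum_cast_mul_gammaRow (e : Fin 4 → ZMod p) (r : ℕ) :
    ∑ j, (ZMod.cast (e j) : F) * gammaRow p M r j =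
      coord p M (if Odd r then 0 else 1) e ^ p ^ ((r - 1) / 2) := by
  rw [coord_pow]
  split_ifs with h <;> simp [gammaRow, h]

variable {p M}

/-- The entries of `e` lie in the prime field, so Frobenius carries the vanishing in rows 1 and 2 to
rows 3 and 4; a nonzero `e` would be a kernel vector of the matrix with determinant `γ₁₂₃₄`. -/
theorem eq_zero_of_coord_eq_zero (h1234 : gam p M 1 2 3 4 ≠ 0) {e : Fin 4 → ZMod p}
    (h0 : coord p M 0 e = 0) (h1 : coord p M 1 e = 0) : e = 0 := by
  by_contra he
  refine h1234 (gam_eq_zero p M (w := fun j => ZMod.cast (e j)) ?_ ?_ ?_ ?_ ?_)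
  · intro h
    refine he (funext fun j => ?_)
    have := congrFun h j
    exact (ZMod.castHom_injective (n := p) F) (this.trans (map_zero (ZMod.castHom (dvd_refl p) F)).symm)
  all_goals
    rw [sum_cast_mul_gammaRow]
    have hp0 := (Fact.out : p.Prime).pos
    simp [h0, h1, hp0.ne', show ¬ Odd 2 by decide, show ¬ Odd 4 by decide, show Odd 3 by decide]

theorem coord_pair_injective (h1234 : gam p M 1 2 3 4 ≠ 0) {e e' : Fin 4 → ZMod p}
    (h0 : coord p M 0 e = coord p M 0 e') (h1 : coord p M 1 e = coord p M 1 e') : e = e' := by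
  have h : ∀ i, coord p M i e = coord p M i e' → coord p M i (e - e') = 0 := fun i hi => by
    change coordHom p M i (e - e') = 0
    rw [map_sub]
    exact sub_eq_zero.2 hi
  exact sub_eq_zero.1 (eq_zero_of_coord_eq_zero h1234 (h 0 h0) (h 1 h1))

/-- A kernel with more than `p` elements contains `e, e'` independent over the prime field. Rows 1,
3, 5 kill both, and the combination `c₂(e') e - c₂(e) e'` over `F` is also killed by row 2, forcing
`γ₁₂₃₅ = 0`. -/
theorem card_ker_le (h1234 : gam p M 1 2 3 4 ≠ 0) (h1235 : gam p M 1 2 3 5 ≠ 0) :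
    Nat.card (coordHom p M 0).ker ≤ p := by
  have hp0 := (Fact.out : p.Prime).pos
  by_contra! hlt
  have hp1 := (Fact.out : p.Prime).one_lt
  obtain ⟨e, he⟩ : ∃ e : (coordHom p M 0).ker, e ≠ 0 := by
    by_contra! h
    have : Subsingleton (coordHom p M 0).ker := ⟨fun a b => by rw [h a, h b]⟩
    have := Finite.card_le_one_iff_subsingleton.2 this
    omega
  have he0 : coord p M 0 (e : Fin 4 → ZMod p) = 0 := e.2
  -- If every kernel element were a multiple of `e`, the kernel would inject into `ZMod p`.
  have hex : ∃ e' : (coordHom p M 0).ker, ∀ a : ZMod p, (e' : Fin 4 → ZMod p) ≠ a • e.1 := by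
    by_contra! h
    choose a ha using h
    have hinj : Function.Injective a := fun u v huv => by
      apply Subtype.ext
      rw [ha u, ha v, huv]
    have := Nat.card_le_card_of_injective a hinj
    rw [Nat.card_zmod] at this
    omega
  obtain ⟨e', he'⟩ := hex
  have he'0 : coord p M 0 (e' : Fin 4 → ZMod p) = 0 := e'.2
  have hc : coord p M 1 (e : Fin 4 → ZMod p) ≠ 0 := fun h =>
    he (Subtype.ext (eq_zero_of_coord_eq_zero h1234 he0 h))
  set c := coord p M 1 (e : Fin 4 → ZMod p)
  set c' := coord p M 1 (e' : Fin 4 → ZMod p)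
  -- If the combination were zero, the ratio `c' / c` would equal `e'_j / e_j` at a nonzero entry of
  -- `e`. This ratio lies in the prime field, so `e'` would be a multiple of `e`.
  have hw : (fun j => c' * (ZMod.cast (e.1 j) : F) - c * ZMod.cast (e'.1 j)) ≠ 0 := by
    intro h
    obtain ⟨j, hj⟩ : ∃ j, e.1 j ≠ 0 := by
      by_contra! h0
      exact he (Subtype.ext (funext h0))
    refine he' (e'.1 j / e.1 j) (funext fun i => ?_)
    have hi := congrFun h i
    have hj' := congrFun h j
    simp only [Pi.zero_apply] at hi hj'
    apply ZMod.castHom_injective (n := p) F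
    rw [Pi.smul_apply, smul_eq_mul, map_mul, map_div₀]
    have hne : ZMod.castHom (dvd_refl p) F (e.1 j) ≠ 0 := by
      rwa [Ne, map_eq_zero]
    field_simp
    simp only [ZMod.castHom_apply]
    refine mul_left_cancel₀ hc ?_
    linear_combination ZMod.cast (e.1 i) * hj' - ZMod.cast (e.1 j) * hi
  refine h1235 (gam_eq_zero p M hw ?_ ?_ ?_ ?_)
  all_goals
    simp only [sub_mul, mul_assoc, Finset.sum_sub_distrib, ← Finset.mul_sum]
    rw [sum_cast_mul_gammaRow, sum_cast_mul_gammaRow]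
    simp [he0, he'0, hp0.ne', show ¬ Odd 2 by decide, show Odd 5 by decide, show Odd 3 by decide, c,
      c']
  try ring

theorem card_range_mul_card_ker :
    Nat.card (coordHom p M 0).range * Nat.card (coordHom p M 0).ker = p ^ 4 := by
  have h1 := AddSubgroup.card_eq_card_quotient_mul_card_addSubgroup (coordHom p M 0).ker
  rw [Nat.card_congr (QuotientAddGroup.quotientKerEquivRange (coordHom p M 0)).toEquiv] at h1
  rw [← h1]
  simp

/-- The hypothesis `γ₁₃₅₇ = 0` removes the term of row 2 from the relation between rows 1, 2, 3, 5,
7; what remains involves only `p`-power iterates of the first coordinate. -/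
theorem eval_normPoly (h1235 : gam p M 1 2 3 5 ≠ 0) (h1357 : gam p M 1 3 5 7 = 0)
    (e : Fin 4 → ZMod p) : (normPoly p M).eval (coord p M 0 e) = 0 := by
  have h := gam_relation p M 1 2 3 5 7 e
  simp only [sum_cast_mul_gammaRow, h1357] at h
  simp [show Odd 7 by decide, show Odd 5 by decide, show Odd 3 by decide] at h
  simp only [normPoly, Polynomial.eval_add, Polynomial.eval_mul, Polynomial.eval_C,
    Polynomial.eval_X, Polynomial.eval_pow, alpha2, alpha1]
  field_simp
  linear_combination h

open Classical in
/-- The first coordinates of the elements of `E`. -/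
noncomputable def coordImage (p : ℕ) [Fact p.Prime] (M : Matrix (Fin 2) (Fin 4) F) : Finset F :=
  Finset.univ.image (coord p M 0)

theorem card_coordImage_eq : (coordImage p M).card = Nat.card (coordHom p M 0).range := by
  have h : ((coordHom p M 0).range : Set F) = coordImage p M := by
    ext c
    simp [coordImage, coordHom]
  rw [← SetLike.coe_sort_coe, h, Nat.card_coe_set_eq, Set.ncard_coe_finset]

/-- Kernel and image have orders with product `p⁴`; the kernel has at most `p` elements, and the
image at most `deg normPoly = p³`, so both bounds are attained. -/
theorem card_ker (h1234 : gam p M 1 2 3 4 ≠ 0) (h1235 : gam p M 1 2 3 5 ≠ 0)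
    (h1357 : gam p M 1 3 5 7 = 0) :
    Nat.card (coordHom p M 0).ker = p ∧ (coordImage p M).card = p ^ 3 := by
  have hp0 := (Fact.out : p.Prime).pos
  have h1 := card_ker_le h1234 h1235
  have h2 := card_range_mul_card_ker (p := p) (M := M)
  rw [← card_coordImage_eq] at h2
  have h3 : (coordImage p M).card ≤ p ^ 3 := by
    rw [← (normPoly_natDegree_monic (p := p) (M := M)).1]
    refine Polynomial.card_le_degree_of_subset_roots fun c hc => ?_
    simp only [coordImage, Finset.image_val, Multiset.mem_dedup, Multiset.mem_map] at hc
    obtain ⟨e, -, rfl⟩ := hc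
    rw [Polynomial.mem_roots (normPoly_natDegree_monic (p := p) (M := M)).2.ne_zero]
    exact eval_normPoly h1235 h1357 e
  have h4 : (p ^ 3) * p = p ^ 4 := by ring
  constructor
  · nlinarith [pow_pos hp0 3]
  · nlinarith [pow_pos hp0 3]

open Polynomial in
theorem normPoly_eq_prod (h1234 : gam p M 1 2 3 4 ≠ 0) (h1235 : gam p M 1 2 3 5 ≠ 0)
    (h1357 : gam p M 1 3 5 7 = 0) : normPoly p M = ∏ c ∈ coordImage p M, (X - C c) := by
  obtain ⟨hd, hm⟩ := normPoly_natDegree_monic (p := p) (M := M)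
  have hm' : (∏ c ∈ coordImage p M, (X - C c)).Monic := monic_prod_X_sub_C _ _
  refine eq_of_monic_of_dvd_of_natDegree_le hm' hm ?_ ?_
  · refine Finset.prod_dvd_of_coprime (s := fun c : F => X - C c)
      (fun a _ b _ hab => pairwise_coprime_X_sub_C (s := fun c : F => c) Function.injective_id hab)
      fun c hc => ?_
    simp only [coordImage, Finset.mem_image] at hc
    obtain ⟨e, -, rfl⟩ := hc
    exact dvd_iff_isRoot.2 (eval_normPoly h1235 h1357 e)
  · rw [hd, natDegree_prod_of_monic _ _ fun c _ => monic_X_sub_C c]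
    simp [(card_ker h1234 h1235 h1357).2]

theorem zero_mem_coordImage : (0 : F) ∈ coordImage p M := by
  simp only [coordImage, Finset.mem_image]
  exact ⟨0, Finset.mem_univ _, map_zero (coordHom p M 0)⟩

open Polynomial in
-- `normPoly` is a product of distinct linear factors, so its root 0 is simple and its linear
-- coefficient cannot vanish.
theorem gam2357_ne_zero (h1234 : gam p M 1 2 3 4 ≠ 0) (h1235 : gam p M 1 2 3 5 ≠ 0)
    (h1357 : gam p M 1 3 5 7 = 0) : gam p M 2 3 5 7 ≠ 0 := by
  classical
  intro h
  have hp1 := (Fact.out : p.Prime).one_lt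
  have h1 := normPoly_eq_prod h1234 h1235 h1357
  rw [← Finset.mul_prod_erase _ _ (zero_mem_coordImage (p := p) (M := M)), normPoly, h] at h1
  obtain ⟨q, rfl⟩ : ∃ q, p = q + 2 := ⟨p - 2, by omega⟩
  have h2 : (X : F[X]) * (X ^ ((q + 2) ^ 3 - 1) + C (alpha2 (q + 2) M) * X ^ ((q + 2) ^ 2 - 1)
      + C (alpha1 (q + 2) M) * X ^ (q + 1)) =
      X * ∏ c ∈ (coordImage (q + 2) M).erase 0, (X - C c) := by
    rw [map_zero, sub_zero] at h1
    rw [← h1, mul_add, mul_add, mul_left_comm, mul_left_comm X, ← pow_succ', ← pow_succ',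
      ← pow_succ', Nat.sub_add_cancel (Nat.one_le_pow _ _ (by omega)),
      Nat.sub_add_cancel (Nat.one_le_pow _ _ (by omega))]
    simp
  -- With the linear term gone, every exponent left after cancelling `X` is positive, so a product
  -- of nonzero roots would be zero.
  have h3 := congrArg (eval 0) (mul_left_cancel₀ X_ne_zero h2)
  have h5 : 1 < (q + 2) ^ 3 := Nat.one_lt_pow (by norm_num) hp1
  have h6 : 1 < (q + 2) ^ 2 := Nat.one_lt_pow (by norm_num) hp1
  rw [eval_prod] at h3
  simp only [eval_add, eval_mul, eval_pow, eval_X, eval_C, eval_sub] at h3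
  rw [zero_pow (by omega), zero_pow (by omega), zero_pow (by omega)] at h3
  simp only [mul_zero, add_zero] at h3
  obtain ⟨c, hc, hc0⟩ := Finset.prod_eq_zero_iff.1 h3.symm
  exact (Finset.mem_erase.1 hc).1 (by simpa using hc0)

end Coordinates
end RankFour

namespace RankFour

section Dehomogenization

/-! ### Invariants after setting `x = 1` -/

open Polynomial

variable {F : Type*} [Field F]

/-- Dehomogenization `x ↦ 1`, with values in `F[y][z]`. -/
noncomputable def dehom (F : Type*) [Field F] : MvPolynomial (Fin 3) F →ₐ[F] F[X][X] :=
  MvPolynomial.aeval ![1, C X, X]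

theorem dehom_X0 : dehom F (MvPolynomial.X 0) = 1 := by simp [dehom]

theorem dehom_X1 : dehom F (MvPolynomial.X 1) = C X := by simp [dehom]

theorem dehom_X2 : dehom F (MvPolynomial.X 2) = X := by simp [dehom]

theorem dehom_C (a : F) : dehom F (MvPolynomial.C a) = C (C a) := by
  rw [← MvPolynomial.algebraMap_eq, AlgHom.commutes]
  rfl

theorem coeff_coeff_dehom (f : MvPolynomial (Fin 3) F) (j k : ℕ) :
    ((dehom F f).coeff k).coeff j =
      ∑ a ∈ f.support, if k = a 2 ∧ j = a 1 then f.coeff a else 0 := by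
  conv_lhs => rw [f.as_sum, map_sum, finsetSum_coeff, finsetSum_coeff]
  refine Finset.sum_congr rfl fun a _ => ?_
  have h : dehom F (MvPolynomial.monomial a (f.coeff a)) =
      C (C (f.coeff a) * X ^ a 1) * X ^ a 2 := by
    rw [MvPolynomial.monomial_eq, map_mul, dehom_C, Finsupp.prod_fintype _ _ (by simp)]
    simp only [Fin.prod_univ_three, map_mul, map_pow, dehom_X0, dehom_X1, dehom_X2]
    ring
  rw [h, coeff_C_mul, coeff_X_pow]
  split_ifs with h1 h2 h2
  · rw [mul_one, coeff_C_mul, coeff_X_pow, if_pos h2.2, mul_one]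
  · have h3 : ¬ j = a 1 := fun h => h2 ⟨h1, h⟩
    rw [mul_one, coeff_C_mul, coeff_X_pow, if_neg h3, mul_zero]
  · exact absurd h2.1 h1
  · rw [mul_zero, coeff_zero]

/-- For fixed total degree, the exponents of `y` and `z` determine that of `x`, so no two monomials
merge. Identities between homogeneous polynomials can therefore be checked at `x = 1`. -/
theorem eq_zero_of_dehom_eq_zero {f : MvPolynomial (Fin 3) F} {d : ℕ} (hf : f.IsHomogeneous d)
    (h : dehom F f = 0) : f = 0 := by
  have hdeg : ∀ a ∈ f.support, a 0 + a 1 + a 2 = d := fun a ha => by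
    have := hf (MvPolynomial.mem_support_iff.1 ha)
    rw [Finsupp.weight_apply, Finsupp.sum_fintype _ _ (by simp), Fin.sum_univ_three] at this
    simpa using this
  by_contra hne
  obtain ⟨a, ha⟩ := MvPolynomial.support_nonempty.2 hne
  have h1 := coeff_coeff_dehom f (a 1) (a 2)
  rw [h, coeff_zero, coeff_zero, Finset.sum_eq_single a] at h1
  · rw [if_pos ⟨rfl, rfl⟩] at h1
    exact MvPolynomial.mem_support_iff.1 ha h1.symm
  · intro b hb hba
    rw [if_neg]
    rintro ⟨h2, h3⟩
    refine hba (Finsupp.ext fun i => ?_)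
    have h4 := hdeg a ha
    have h5 := hdeg b hb
    fin_cases i
    · show b 0 = a 0
      omega
    · exact h3.symm
    · exact h2.symm
  · exact fun h => absurd ha h

theorem natDegree_lt_of_degree_lt {R : Type*} [Semiring R] {r f : R[X]} (h : r.degree < f.degree)
    (hf : 0 < f.natDegree) : r.natDegree < f.natDegree := by
  rcases eq_or_ne r 0 with rfl | hr
  · rwa [natDegree_zero]
  · exact natDegree_lt_natDegree hr h

/-- The action of an element with coordinates `c₁, c₂` on `F[y][z]`. -/
noncomputable def shift (c₁ c₂ : F) : F[X][X] →+* F[X][X] :=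
  (compRingHom (X + C (C (2 * c₁) * X + C (c₁ ^ 2 + c₂)))).comp
    (mapRingHom (compRingHom (X + C c₁)))

theorem shift_C (c₁ c₂ : F) (f : F[X]) : shift c₁ c₂ (C f) = C (f.comp (X + C c₁)) := by
  simp [shift]

theorem shift_degree_le (c₁ c₂ : F) (f : F[X][X]) : (shift c₁ c₂ f).degree ≤ f.degree := by
  rcases eq_or_ne f 0 with rfl | hf
  · rw [map_zero]
  · rw [degree_eq_natDegree hf]
    refine degree_le_of_natDegree_le ?_
    simp only [shift, RingHom.comp_apply, coe_mapRingHom, coe_compRingHom_apply]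
    rw [natDegree_comp, natDegree_X_add_C, mul_one]
    exact natDegree_map_le

theorem shift_zero_apply (c : F) (f : F[X][X]) : shift 0 c f = f.comp (X + C (C c)) := by
  have h : compRingHom (X + C (0 : F)) = RingHom.id F[X] := by
    ext <;> simp
  simp only [shift, RingHom.comp_apply, h, coe_mapRingHom, coe_compRingHom_apply, map_id]
  simp

theorem dehom_act (p : ℕ) (M : Matrix (Fin 2) (Fin 4) F) (e : Fin 4 → ZMod p)
    (f : MvPolynomial (Fin 3) F) :
    dehom F (act p M e f) = shift (coord p M 0 e) (coord p M 1 e) (dehom F f) := by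
  have h : ((dehom F).comp (act p M e)).toRingHom =
      (shift (coord p M 0 e) (coord p M 1 e)).comp (dehom F).toRingHom := by
    refine MvPolynomial.ringHom_ext (fun a => ?_) fun i => ?_
    · show dehom F (act p M e (MvPolynomial.C a)) = shift _ _ (dehom F (MvPolynomial.C a))
      rw [dehom_C, shift_C, ← MvPolynomial.algebraMap_eq, AlgHom.commutes,
        MvPolynomial.algebraMap_eq, dehom_C, C_comp]
    · show dehom F (act p M e (MvPolynomial.X i)) = shift _ _ (dehom F (MvPolynomial.X i))
      fin_cases i
      · show dehom F (act p M e (MvPolynomial.X 0)) = shift _ _ (dehom F (MvPolynomial.X 0))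
        rw [act_x, dehom_X0, map_one]
      · show dehom F (act p M e (MvPolynomial.X 1)) = shift _ _ (dehom F (MvPolynomial.X 1))
        rw [act_y, map_add, map_mul, dehom_X0, dehom_X1, dehom_C, shift_C]
        simp
      · show dehom F (act p M e (MvPolynomial.X 2)) = shift _ _ (dehom F (MvPolynomial.X 2))
        rw [act_z]
        simp only [map_add (dehom F), map_mul (dehom F), dehom_X0, dehom_X1, dehom_X2, dehom_C]
        simp [shift]
        ring
  exact RingHom.congr_fun h f

variable {p : ℕ} [hpr : Fact p.Prime] [CharP F p] {M : Matrix (Fin 2) (Fin 4) F}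

/-- The polynomial is additive and the translation is by one of its roots. -/
theorem normPoly_comp (h1235 : gam p M 1 2 3 5 ≠ 0) (h1357 : gam p M 1 3 5 7 = 0)
    (e : Fin 4 → ZMod p) :
    (normPoly p M).comp (X + C (coord p M 0 e)) = normPoly p M := by
  have h := congrArg C (eval_normPoly h1235 h1357 e)
  generalize coord p M 0 e = c at *
  simp only [normPoly, eval_add, eval_mul, eval_pow, eval_X, eval_C, map_add, map_mul, map_pow,
    map_zero] at h
  simp only [normPoly, add_comp, mul_comp, X_pow_comp, C_comp, X_comp, add_pow_char_pow,
    add_pow_char]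
  linear_combination h

/-- Division by `normPoly` is unique and commutes with the translations, so quotient and remainder
are again invariant; the remainder is constant and induction applies to the quotient. -/
theorem mem_span_normPoly_pow (h1234 : gam p M 1 2 3 4 ≠ 0) (h1235 : gam p M 1 2 3 5 ≠ 0)
    (h1357 : gam p M 1 3 5 7 = 0) (q : F[X])
    (hq : ∀ e, q.comp (X + C (coord p M 0 e)) = q) :
    q ∈ Submodule.span F (Set.range fun i : ℕ => normPoly p M ^ i) := by
  obtain ⟨hd, hm⟩ := normPoly_natDegree_monic (p := p) (M := M)
  have hp3 : 0 < p ^ 3 := pow_pos (Fact.out : p.Prime).pos 3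
  induction hn : q.natDegree using Nat.strong_induction_on generalizing q with
  | _ n ih =>
  subst hn
  have hdiv := modByMonic_add_div q (normPoly p M)
  set r := q %ₘ normPoly p M
  set t := q /ₘ normPoly p M with ht
  have hr : r.degree < (normPoly p M).degree := degree_modByMonic_lt _ hm
  have hu : ∀ e, t.comp (X + C (coord p M 0 e)) = t ∧ r.comp (X + C (coord p M 0 e)) = r := by
    intro e
    have h1 := congrArg (fun u => u.comp (X + C (coord p M 0 e))) hdiv
    simp only [add_comp, mul_comp, normPoly_comp h1235 h1357, hq] at h1
    have h2 := div_modByMonic_unique _ _ hm ⟨h1, ?_⟩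
    · exact ⟨h2.1.symm, h2.2.symm⟩
    · refine lt_of_le_of_lt ?_ hr
      rcases eq_or_ne r 0 with h0 | h0
      · rw [h0, zero_comp]
      · rw [degree_eq_natDegree h0]
        refine degree_le_of_natDegree_le ?_
        rw [natDegree_comp, natDegree_X_add_C, mul_one]
  have hrn : r.natDegree < p ^ 3 := by
    rw [← hd]
    exact natDegree_lt_of_degree_lt hr (by omega)
  -- An invariant takes its value at 0 on all `p³` first coordinates, more points than the degree of
  -- `r`.
  have hrC : r = C (r.eval 0) := by
    rw [← sub_eq_zero]
    refine eq_zero_of_natDegree_lt_card_of_eval_eq_zero' _ (coordImage p M) (fun c hc => ?_) ?_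
    · simp only [coordImage, Finset.mem_image] at hc
      obtain ⟨e, -, rfl⟩ := hc
      have := congrArg (eval 0) (hu e).2
      rw [eval_comp] at this
      simpa [sub_eq_zero] using this
    · rw [natDegree_sub_C, (card_ker h1234 h1235 h1357).2]
      exact hrn
  rw [← hdiv]
  refine add_mem ?_ ?_
  · rw [hrC]
    have : C (r.eval 0) = r.eval 0 • normPoly p M ^ 0 := by
      rw [pow_zero, smul_eq_C_mul, mul_one]
    rw [this]
    exact Submodule.smul_mem _ _ (Submodule.subset_span ⟨0, rfl⟩)
  · rcases eq_or_ne t 0 with h0 | h0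
    · rw [h0, mul_zero]
      exact zero_mem _
    · have hlt : t.natDegree < q.natDegree := by
        rw [ht, natDegree_divByMonic _ hm, hd]
        have : p ^ 3 ≤ q.natDegree := by
          by_contra! hlt
          refine h0 ((divByMonic_eq_zero_iff hm).2 ?_)
          exact degree_lt_degree (by omega)
        omega
      have h2 := ih _ hlt t (fun e => (hu e).1) rfl
      have h3 : normPoly p M * t = LinearMap.mulLeft F (normPoly p M) t := rfl
      rw [h3]
      refine Submodule.span_le (p := (Submodule.span F
        (Set.range fun i : ℕ => normPoly p M ^ i)).comap (LinearMap.mulLeft F (normPoly p M)))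
        |>.2 ?_ h2
      rintro _ ⟨i, rfl⟩
      exact Submodule.subset_span ⟨i + 1, by simp [pow_succ']⟩

/-- Elements of the kernel of the first coordinate translate `z` by `p` distinct scalars, so `q -
q(0)` has `p` roots in `z` and degree below `p`. -/
theorem eq_C_of_shift_eq (h1234 : gam p M 1 2 3 4 ≠ 0) (h1235 : gam p M 1 2 3 5 ≠ 0)
    (h1357 : gam p M 1 3 5 7 = 0) (q : F[X][X]) (hdeg : q.natDegree < p)
    (hq : ∀ e, shift (coord p M 0 e) (coord p M 1 e) q = q) : q = C (q.eval 0) := by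
  rw [← sub_eq_zero]
  have : Fintype (coordHom p M 0).ker := Fintype.ofFinite _
  refine eq_zero_of_natDegree_lt_card_of_eval_eq_zero _
    (f := fun e : (coordHom p M 0).ker => (C (coord p M 1 e.1) : F[X])) ?_ (fun e => ?_) ?_
  · intro e e' h
    refine Subtype.ext (coord_pair_injective h1234 ?_ (C_injective h))
    have h1 : coord p M 0 (e : Fin 4 → ZMod p) = 0 := e.2
    have h2 : coord p M 0 (e' : Fin 4 → ZMod p) = 0 := e'.2
    rw [h1, h2]
  · have h1 : coord p M 0 (e : Fin 4 → ZMod p) = 0 := e.2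
    have h2 := hq e
    rw [h1, shift_zero_apply] at h2
    have h3 := congrArg (eval 0) h2
    rw [eval_comp] at h3
    simpa [sub_eq_zero] using h3
  · rw [natDegree_sub_C, ← Nat.card_eq_fintype_card, (card_ker h1234 h1235 h1357).1]
    exact hdeg

/-- Repeated division by invariants whose `z`-degrees run through the multiples of `p`. -/
theorem mem_span_of_shift_eq (h1234 : gam p M 1 2 3 4 ≠ 0) (h1235 : gam p M 1 2 3 5 ≠ 0)
    (h1357 : gam p M 1 3 5 7 = 0) (f : ℕ → F[X][X]) (hm : ∀ l, (f l).Monic)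
    (hd : ∀ l, (f l).natDegree = p * l)
    (hf : ∀ l e, shift (coord p M 0 e) (coord p M 1 e) (f l) = f l) (g : F[X][X])
    (hg : ∀ e, shift (coord p M 0 e) (coord p M 1 e) g = g) :
    g ∈ Submodule.span F (Set.range fun i : ℕ × ℕ => C (normPoly p M) ^ i.1 * f i.2) := by
  have hp0 := (Fact.out : p.Prime).pos
  induction hn : g.natDegree using Nat.strong_induction_on generalizing g with
  | _ n ih =>
  subst hn
  -- The divisor is the `f l` of largest `z`-degree not exceeding that of `g`; the quotient then has
  -- `z`-degree below `p` and `eq_C_of_shift_eq` applies.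
  set l := g.natDegree / p with hl
  have hl1 : p * l ≤ g.natDegree := Nat.mul_div_le _ _
  have hl2 : g.natDegree < p * l + p := by
    rw [hl]
    have := Nat.mod_lt g.natDegree hp0
    have := Nat.div_add_mod g.natDegree p
    omega
  have hdiv := modByMonic_add_div g (f l)
  set r := g %ₘ f l with hrdef
  set t := g /ₘ f l with ht
  have hr : r.degree < (f l).degree := degree_modByMonic_lt _ (hm l)
  -- The action does not raise the `z`-degree, so uniqueness of division makes both parts invariant.
  have hu : ∀ e, shift (coord p M 0 e) (coord p M 1 e) t = t ∧
      shift (coord p M 0 e) (coord p M 1 e) r = r := by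
    intro e
    have h1 := congrArg (shift (coord p M 0 e) (coord p M 1 e)) hdiv
    simp only [map_add, map_mul, hf, hg] at h1
    have h2 := div_modByMonic_unique _ _ (hm l) ⟨h1, (shift_degree_le _ _ _).trans_lt hr⟩
    exact ⟨h2.1.symm, h2.2.symm⟩
  rw [← hdiv]
  refine add_mem ?_ ?_
  -- For `l = 0` the divisor is 1 and the remainder is 0; otherwise its degree drops below `p * l`.
  · rcases Nat.eq_zero_or_pos l with h0 | h0
    · have h1 : f l = 1 := by
        have := hd l
        rw [h0, mul_zero] at this
        rw [h0]
        exact eq_one_of_monic_natDegree_zero (hm 0) this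
      have h2 : r = 0 := by rw [hrdef, h1, modByMonic_one]
      rw [h2]
      exact zero_mem _
    · refine ih _ ?_ r (fun e => (hu e).2) rfl
      have := natDegree_lt_of_degree_lt hr (by rw [hd]; positivity)
      rw [hd] at this
      omega
  · have htd : t.natDegree < p := by
      rw [ht, natDegree_divByMonic _ (hm l), hd]
      omega
    have htC := eq_C_of_shift_eq h1234 h1235 h1357 t htd (fun e => (hu e).1)
    have hinv : ∀ e, (t.eval 0).comp (X + C (coord p M 0 e)) = t.eval 0 := by
      intro e
      have := (hu e).1
      rw [htC, shift_C] at this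
      exact C_injective this
    have h2 := mem_span_normPoly_pow h1234 h1235 h1357 _ hinv
    rw [htC]
    let φ : F[X] →ₗ[F] F[X][X] :=
      (LinearMap.mulLeft F (f l)).comp (IsScalarTower.toAlgHom F F[X] F[X][X]).toLinearMap
    have h3 : f l * C (t.eval 0) = φ (t.eval 0) := rfl
    rw [h3]
    refine Submodule.span_le (p := (Submodule.span F
        (Set.range fun i : ℕ × ℕ => C (normPoly p M) ^ i.1 * f i.2)).comap φ) |>.2 ?_ h2
    rintro _ ⟨i, rfl⟩
    refine Submodule.subset_span ⟨(i, l), ?_⟩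
    show _ = f l * C (normPoly p M ^ i)
    rw [map_pow, mul_comm]

end Dehomogenization
end RankFour

namespace RankFour

/-! ### Lead monomials of homogeneous polynomials in grevlex -/

section GrevlexAndHomogeneity

open MvPolynomial

variable {F : Type*} [Field F]

theorem sum_eq_of_isHomogeneous {f : MvPolynomial (Fin 3) F} {d : ℕ} (hf : f.IsHomogeneous d)
    {a : Fin 3 →₀ ℕ} (ha : f.coeff a ≠ 0) : a 0 + a 1 + a 2 = d := by
  have := hf ha
  rw [Finsupp.weight_apply, Finsupp.sum_fintype _ _ (by simp), Fin.sum_univ_three] at this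
  simpa using this

theorem degree_eq_of_forall {σ : Type*} (m : MonomialOrder σ) {f : MvPolynomial σ F} {a : σ →₀ ℕ}
    (ha : f.coeff a ≠ 0) (h : ∀ b, f.coeff b ≠ 0 → b ≠ a → m.toSyn b < m.toSyn a) :
    m.degree f = a := by
  apply m.toSyn.injective
  refine le_antisymm (m.degree_le_iff.2 fun b hb => ?_) (m.le_degree (mem_support_iff.2 ha))
  rcases eq_or_ne b a with rfl | hba
  · exact le_rfl
  · exact (h b (mem_support_iff.1 hb) hba).le

/-- Since `x` is the smallest variable, within one degree any monomial free of `x` beats every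
multiple of `x`; the lead monomial can be read modulo `x`. -/
theorem grevlex_degree_eq_single {f t : MvPolynomial (Fin 3) F} {d : ℕ} (hf : f.IsHomogeneous d)
    {a : F} (ha : a ≠ 0) (h : f = C a * X 1 ^ d + X 0 * t) :
    grevlex.degree f = Finsupp.single 1 d := by
  have hc : ∀ b : Fin 3 →₀ ℕ, b 0 = 0 →
      f.coeff b = if Finsupp.single 1 d = b then a else 0 := by
    intro b hb
    rw [h, coeff_add, coeff_X_mul', if_neg (by simpa using hb), add_zero, coeff_C_mul,
      X_pow_eq_monomial, coeff_monomial]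
    simp
  refine degree_eq_of_forall _ ?_ fun b hb hne => ?_
  · rw [hc _ (by simp), if_pos rfl]
    exact ha
  · refine (grevlex_lt_iff _ _).2 (Or.inr ⟨?_, Or.inl ?_⟩)
    · rw [sum_eq_of_isHomogeneous hf hb]
      simp
    · have : b 0 ≠ 0 := fun h0 => by
        rw [hc b h0, if_neg (Ne.symm hne)] at hb
        exact hb rfl
      simpa using Nat.pos_of_ne_zero this

theorem isHomogeneous_of_eq {f : MvPolynomial (Fin 3) F} {m n : ℕ} (hf : f.IsHomogeneous m)
    (h : m = n) : f.IsHomogeneous n := h ▸ hf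

theorem isHomogeneous_of_X_pow_mul {q : MvPolynomial (Fin 3) F} {m d : ℕ}
    (h : (X 0 ^ m * q).IsHomogeneous (m + d)) : q.IsHomogeneous d := by
  intro a ha
  have h1 : (X 0 ^ m * q).coeff (Finsupp.single 0 m + a) ≠ 0 := by
    rw [X_pow_eq_monomial, coeff_monomial_mul, one_mul]
    exact ha
  have h2 := h h1
  rw [map_add, Finsupp.weight_single] at h2
  simpa using h2

theorem X_pow_mul_divMonomial (m : ℕ) (q : MvPolynomial (Fin 3) F) :
    (X 0 ^ m * q).divMonomial (Finsupp.single 0 m) = q := by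
  rw [X_pow_eq_monomial, divMonomial_monomial_mul]

end GrevlexAndHomogeneity

/-! ### The action of `E` and the invariance of `f̂₁` -/

section Action

open MvPolynomial

variable {F : Type*} [Field F] (p : ℕ) (M : Matrix (Fin 2) (Fin 4) F)

theorem act_act [Fact p.Prime] [CharP F p] (e e' : Fin 4 → ZMod p) (f : MvPolynomial (Fin 3) F) :
    act p M e (act p M e' f) = act p M (e + e') f := by
  have h : (act p M e).comp (act p M e') = act p M (e + e') := by
    refine algHom_ext fun i => ?_
    rw [AlgHom.comp_apply]
    fin_cases i
    · show act p M e (act p M e' (X 0)) = act p M (e + e') (X 0)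
      simp only [act_x]
    · show act p M e (act p M e' (X 1)) = act p M (e + e') (X 1)
      simp only [act_y, map_add, map_mul, act_x, algHom_C, coord_add, algebraMap_eq]
      ring
    · show act p M e (act p M e' (X 2)) = act p M (e + e') (X 2)
      have h2 : (C (2 : F) : MvPolynomial (Fin 3) F) = 2 := map_ofNat C 2
      simp only [act_z, act_y, map_add, map_mul, act_x, algHom_C, coord_add, map_pow,
        algebraMap_eq, h2, map_ofNat]
      ring
  exact AlgHom.congr_fun h f

theorem act_zero [Fact p.Prime] [CharP F p] (f : MvPolynomial (Fin 3) F) : act p M 0 f = f := by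
  have h : act p M 0 = AlgHom.id F _ := by
    have h0 : ∀ i, coord p M i 0 = 0 := fun i => map_zero (coordHom p M i)
    refine algHom_ext fun i => ?_
    fin_cases i
    · show act p M 0 (X 0) = X 0
      simp only [act_x]
    · show act p M 0 (X 1) = X 1
      simp [act_y, h0]
    · show act p M 0 (X 2) = X 2
      simp [act_z, h0]
  rw [h]
  rfl

theorem act_injective [Fact p.Prime] [CharP F p] (e : Fin 4 → ZMod p) : Function.Injective (act p M e) := by
  refine Function.LeftInverse.injective (g := act p M (-e)) fun f => ?_
  rw [act_act, neg_add_cancel, act_zero]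

theorem orbitNorm_mem [Fact p.Prime] [CharP F p] (f : MvPolynomial (Fin 3) F) : orbitNorm p M f ∈ invariants p M := by
  classical
  rw [mem_invariants]
  intro e
  rw [orbitNorm, map_prod]
  rw [← Finset.prod_image (f := fun g => g) (g := act p M e) fun _ _ _ _ h => act_injective p M e h]
  congr 1
  ext g
  simp only [Finset.mem_image, Finset.mem_univ, true_and, exists_exists_eq_and, act_act]
  constructor
  · rintro ⟨a, rfl⟩
    exact ⟨e + a, rfl⟩
  · rintro ⟨a, rfl⟩
    exact ⟨a - e, by rw [add_sub_cancel]⟩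

theorem act_isHomogeneous (e : Fin 4 → ZMod p) {f : MvPolynomial (Fin 3) F} {d : ℕ}
    (hf : f.IsHomogeneous d) : (act p M e f).IsHomogeneous d := by
  have := hf.aeval (fun i => ∑ j, C (sigma (coord p M 0 e) (coord p M 1 e) (Fin.rev i) (Fin.rev j))
    * X j) (n := 1) (fun i => IsHomogeneous.sum _ _ _ fun j _ => ?_)
  · rwa [one_mul] at this
  · exact (isHomogeneous_X F j).C_mul _

/-- The squares of the first coordinate cancel: `-δ/x²` is translated by `c₂(e)` just as `y/x` is by
`c₁(e)`. -/
theorem act_delta (e : Fin 4 → ZMod p) :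
    act p M e (delta F) = delta F - C (coord p M 1 e) * X 0 ^ 2 := by
  simp only [delta, map_sub, map_mul, map_pow, act_x, act_y, act_z, map_add]
  have : (C (2 : F) : MvPolynomial (Fin 3) F) = 2 := map_ofNat C 2
  rw [this]
  ring

theorem delta_isHomogeneous : (delta F).IsHomogeneous 2 :=
  (isHomogeneous_X_pow 1 2).sub (by simpa using (isHomogeneous_X F 0).mul (isHomogeneous_X F 2))

variable {p M}

theorem mem_invariants_of_X_pow_mul {m : ℕ} {q : MvPolynomial (Fin 3) F}
    (h : X 0 ^ m * q ∈ invariants p M) : q ∈ invariants p M := by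
  rw [mem_invariants] at h ⊢
  intro e
  have := h e
  rw [map_mul, map_pow, act_x] at this
  exact mul_left_cancel₀ (pow_ne_zero _ (X_ne_zero 0)) this

theorem X0_mem : (X 0 : MvPolynomial (Fin 3) F) ∈ invariants p M :=
  (mem_invariants _ _ _).2 fun e => act_x p M e

theorem C_mem (a : F) : (C a : MvPolynomial (Fin 3) F) ∈ invariants p M :=
  (invariants p M).algebraMap_mem a

/-- Under `e` the augmented column changes by a combination of the other columns with coefficients
in the prime field, which leaves the determinant fixed; after expansion this is `gam_relation` for
rows 1 to 5. -/
theorem f1bar_mem [Fact p.Prime] [CharP F p] (hp : p ≠ 2) : f1bar p M ∈ invariants p M := by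
  have hodd := (Fact.out : p.Prime).odd_of_ne_two hp
  have hp2 := (Fact.out : p.Prime).two_le
  have hpp : 2 * p ≤ p ^ 2 := by nlinarith
  rw [mem_invariants]
  intro e
  have h := congrArg (C : F → MvPolynomial (Fin 3) F) (gam_relation p M 1 2 3 4 5 e)
  simp only [sum_cast_mul_gammaRow] at h
  simp [show Odd 3 by decide, show Odd 5 by decide, show ¬ Odd 2 by decide,
    show ¬ Odd 4 by decide] at h
  rw [f1bar_eq p hodd]
  simp only [map_add, map_mul, map_pow, act_x, act_y, act_delta, algHom_C, algebraMap_eq,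
    add_pow_char_pow, add_pow_char, sub_pow_char, mul_pow]
  generalize C (coord p M 0 e) = c at *
  generalize C (coord p M 1 e) = c' at *
  have e1 : (X 0 : MvPolynomial (Fin 3) F) ^ p ^ 2 = X 0 ^ (p ^ 2 - 2 * p) * (X 0 ^ 2) ^ p := by
    rw [← pow_mul, ← pow_add]; congr 1; omega
  have e2 : (X 0 : MvPolynomial (Fin 3) F) ^ p ^ 2 = X 0 ^ (p ^ 2 - p) * X 0 ^ p := by
    rw [← pow_add]; congr 1; omega
  have e3 : (X 0 : MvPolynomial (Fin 3) F) ^ p ^ 2 = X 0 ^ (p ^ 2 - 2) * X 0 ^ 2 := by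
    rw [← pow_add]; congr 1; omega
  have e4 : (X 0 : MvPolynomial (Fin 3) F) ^ p ^ 2 = X 0 ^ (p ^ 2 - 1) * X 0 := by
    rw [← pow_succ]; congr 1; omega
  linear_combination X 0 ^ p ^ 2 * h + C (gam p M 1 2 3 5) * c' ^ p * e1
    - C (gam p M 1 2 4 5) * c ^ p * e2 + C (gam p M 1 3 4 5) * c' * e3 - C (gam p M 2 3 4 5) * c * e4

theorem f1hat_mem [Fact p.Prime] [CharP F p] (hp : p ≠ 2) : f1hat p M ∈ invariants p M :=
  mul_mem (C_mem _) (f1bar_mem hp)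

end Action

/-! ### The generators: invariance, degrees and lead monomials -/

section Generators

open MvPolynomial

variable {F : Type*} [Field F] {p : ℕ} {M : Matrix (Fin 2) (Fin 4) F}

/-- `tailG` with the coefficients of `f̂₁`. -/
noncomputable def f1tail (p : ℕ) (M : Matrix (Fin 2) (Fin 4) F) : MvPolynomial (Fin 3) F :=
  tailG p (X 0) (X 1) (delta F) (C (beta3 p M)) (C (gam p M 1 2 4 5 / gam p M 1 2 3 4))
    (C (gam p M 1 3 4 5 / gam p M 1 2 3 4)) (C (gam p M 2 3 4 5 / gam p M 1 2 3 4))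

/-- `coreH` with the coefficients of `f̂₁` and `N_M(y)`. -/
noncomputable def h2core (p : ℕ) (M : Matrix (Fin 2) (Fin 4) F) : MvPolynomial (Fin 3) F :=
  coreH p (X 0) (X 1) (X 2) (delta F) (C (beta3 p M)) (C (gam p M 1 2 4 5 / gam p M 1 2 3 4))
    (C (gam p M 1 3 4 5 / gam p M 1 2 3 4)) (C (gam p M 2 3 4 5 / gam p M 1 2 3 4))
    (C (alpha2 p M)) (C (alpha1 p M)) (C (gam p M 2 3 5 7 / gam p M 1 2 3 5))

theorem beta3_ne_zero (h1234 : gam p M 1 2 3 4 ≠ 0) (h1235 : gam p M 1 2 3 5 ≠ 0) :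
    beta3 p M ≠ 0 := div_ne_zero h1235 h1234

theorem act_X2_degree (e : Fin 4 → ZMod p) :
    grevlex.degree (act p M e (X 2)) = Finsupp.single 2 1 := by
  classical
  refine degree_eq_of_forall _ ?_ fun b hb hne => (grevlex_lt_iff _ _).2 ?_
  · simp only [act_z, coeff_add, coeff_C_mul, coeff_X]
    simp [Finsupp.single_left_inj]
  · have hs := sum_eq_of_isHomogeneous (act_isHomogeneous p M e (isHomogeneous_X F 2)) hb
    simp only [Finsupp.single_apply]
    have : b 2 ≠ 1 := fun h => hne (Finsupp.ext fun i => by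
      fin_cases i <;> simp <;> omega)
    right
    constructor
    · simpa using hs
    · simp
      omega

variable [hpr : Fact p.Prime]

theorem three_le (hp : p ≠ 2) : 3 ≤ p := by
  have := (Fact.out : p.Prime).two_le
  omega

theorem f1hat_eq (hp : p ≠ 2) (h1234 : gam p M 1 2 3 4 ≠ 0) :
    f1hat p M = X 1 ^ p ^ 2 + X 0 ^ (p ^ 2 - 2 * p) * f1tail p M := by
  have hodd := (Fact.out : p.Prime).odd_of_ne_two hp
  have hp3 := three_le hp
  have hpp : 2 * p ≤ p ^ 2 := by nlinarith
  rw [f1hat, f1bar_eq p hodd, f1tail, tailG, beta3]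
  have hC : ∀ a, (C (a / gam p M 1 2 3 4) : MvPolynomial (Fin 3) F) =
      C (gam p M 1 2 3 4)⁻¹ * C a := fun a => by
    rw [← C_mul, div_eq_inv_mul]
  have hone : (C (gam p M 1 2 3 4)⁻¹ * C (gam p M 1 2 3 4) : MvPolynomial (Fin 3) F) = 1 := by
    rw [← C_mul, inv_mul_cancel₀ h1234, C_1]
  simp only [hC]
  have e1 : p ^ 2 - p = (p ^ 2 - 2 * p) + p := by omega
  have e2 : p ^ 2 - 2 = (p ^ 2 - 2 * p) + (2 * p - 2) := by omega
  have e3 : p ^ 2 - 1 = (p ^ 2 - 2 * p) + (2 * p - 1) := by omega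
  rw [e1, e2, e3, pow_add, pow_add, pow_add]
  linear_combination X 1 ^ p ^ 2 * hone

theorem f1hat_isHomogeneous (hp : p ≠ 2) : (f1hat p M).IsHomogeneous (p ^ 2) := by
  have hodd := (Fact.out : p.Prime).odd_of_ne_two hp
  have hp3 := three_le hp
  have hpp : 2 * p ≤ p ^ 2 := by nlinarith
  have hx : ∀ (i : Fin 3) n, ((X i : MvPolynomial (Fin 3) F) ^ n).IsHomogeneous n :=
    fun i n => isHomogeneous_X_pow i n
  rw [f1hat, f1bar_eq p hodd]
  refine IsHomogeneous.C_mul (((((hx 1 _).C_mul _).add ?_).add ?_).add ?_ |>.add ?_) _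
  · refine isHomogeneous_of_eq ((((delta_isHomogeneous (F := F)).pow p).C_mul (gam p M 1 2 3 5)).mul
      (hx 0 (p ^ 2 - 2 * p))) ?_
    omega
  · refine isHomogeneous_of_eq (((hx 1 p).C_mul (gam p M 1 2 4 5)).mul (hx 0 (p ^ 2 - p))) ?_
    omega
  · refine isHomogeneous_of_eq (((delta_isHomogeneous (F := F)).C_mul (gam p M 1 3 4 5)).mul
      (hx 0 (p ^ 2 - 2))) ?_
    omega
  · refine isHomogeneous_of_eq (((isHomogeneous_X F 1).C_mul (gam p M 2 3 4 5)).mul (hx 0 (p ^ 2 - 1))) ?_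
    omega

theorem f1hat_degree (hp : p ≠ 2) (h1234 : gam p M 1 2 3 4 ≠ 0) :
    grevlex.degree (f1hat p M) = Finsupp.single 1 (p ^ 2) := by
  have hp3 := three_le hp
  have hpp : 3 * p ≤ p ^ 2 := by nlinarith
  refine grevlex_degree_eq_single (f1hat_isHomogeneous hp) one_ne_zero
    (t := X 0 ^ (p ^ 2 - 2 * p - 1) * f1tail p M) ?_
  rw [f1hat_eq hp h1234, C_1, one_mul, ← mul_assoc, ← pow_succ']
  congr 3
  omega

open Classical in
theorem orbitNorm_X1_eq_prod :
    orbitNorm p M (X 1) = ∏ c ∈ coordImage p M, (X 1 + C c * X 0) := by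
  have h : Finset.univ.image (fun e : Fin 4 → ZMod p => act p M e (X 1)) =
      (coordImage p M).image (fun c => X 1 + C c * X 0) := by
    rw [coordImage, Finset.image_image]
    congr 1
    funext e
    exact act_y p M e
  rw [orbitNorm, h, Finset.prod_image]
  intro c _ c' _ h
  have := mul_right_cancel₀ (X_ne_zero (R := F) (0 : Fin 3)) (add_left_cancel h)
  exact C_injective _ _ this

variable [CharP F p]

theorem two_ne_zero_of_ne (hp : p ≠ 2) : (2 : F) ≠ 0 := by
  have := (CharP.cast_eq_zero_iff F p 2)
  intro h
  have h2 := this.1 (by exact_mod_cast h)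
  exact hp ((Nat.prime_dvd_prime_iff_eq (Fact.out : p.Prime) Nat.prime_two).1 h2)

theorem two_mul_C_inv_two (hp : p ≠ 2) : (2 * C 2⁻¹ : MvPolynomial (Fin 3) F) = 1 := by
  rw [← map_ofNat (C : F →+* MvPolynomial (Fin 3) F) 2, ← C_mul,
    mul_inv_cancel₀ (two_ne_zero_of_ne hp), C_1]

theorem orbitNorm_X1_isHomogeneous (h1234 : gam p M 1 2 3 4 ≠ 0) (h1235 : gam p M 1 2 3 5 ≠ 0)
    (h1357 : gam p M 1 3 5 7 = 0) : (orbitNorm p M (X 1)).IsHomogeneous (p ^ 3) := by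
  rw [orbitNorm_X1_eq_prod]
  have := IsHomogeneous.prod (coordImage p M) (fun c => X 1 + C c * X 0) (fun _ => 1)
    fun c _ => (isHomogeneous_X F (1 : Fin 3)).add ((isHomogeneous_X F 0).C_mul c)
  rwa [Finset.sum_const, (card_ker h1234 h1235 h1357).2, smul_eq_mul, mul_one] at this

theorem dehom_orbitNorm_X1 (h1234 : gam p M 1 2 3 4 ≠ 0) (h1235 : gam p M 1 2 3 5 ≠ 0)
    (h1357 : gam p M 1 3 5 7 = 0) :
    dehom F (orbitNorm p M (X 1)) = Polynomial.C (normPoly p M) := by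
  rw [orbitNorm_X1_eq_prod, normPoly_eq_prod h1234 h1235 h1357, map_prod, map_prod]
  -- The linear factors are `y + c` on one side and `y - c` on the other; the set of first
  -- coordinates is closed under negation.
  refine Finset.prod_nbij' (fun c => -c) (fun c => -c) ?_ ?_ (by simp) (by simp) ?_
  · intro c hc
    simp only [coordImage, Finset.mem_image] at hc ⊢
    obtain ⟨e, -, rfl⟩ := hc
    exact ⟨-e, Finset.mem_univ _, map_neg (coordHom p M 0) e⟩
  · intro c hc
    simp only [coordImage, Finset.mem_image] at hc ⊢
    obtain ⟨e, -, rfl⟩ := hc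
    exact ⟨-e, Finset.mem_univ _, map_neg (coordHom p M 0) e⟩
  · intro c _
    rw [map_add, map_mul, dehom_X0, dehom_X1, dehom_C, mul_one]
    simp

theorem orbitNorm_X1_eq (hp : p ≠ 2) (h1234 : gam p M 1 2 3 4 ≠ 0) (h1235 : gam p M 1 2 3 5 ≠ 0)
    (h1357 : gam p M 1 3 5 7 = 0) :
    orbitNorm p M (X 1) = X 1 ^ p ^ 3 + X 0 ^ (p ^ 3 - 2 * p ^ 2) * tailS p (X 0) (X 1)
      (C (alpha2 p M)) (C (alpha1 p M)) (C (gam p M 2 3 5 7 / gam p M 1 2 3 5)) := by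
  have hp3 := three_le hp
  have hpp : 3 * p ≤ p ^ 2 := by nlinarith
  have hpp3 : 3 * p ^ 2 ≤ p ^ 3 := by nlinarith
  have hx : ∀ (i : Fin 3) n, ((X i : MvPolynomial (Fin 3) F) ^ n).IsHomogeneous n :=
    fun i n => isHomogeneous_X_pow i n
  have hS : (tailS p (X 0) (X 1) (C (alpha2 p M)) (C (alpha1 p M))
      (C (gam p M 2 3 5 7 / gam p M 1 2 3 5)) : MvPolynomial (Fin 3) F).IsHomogeneous (2 * p ^ 2) := by
    rw [tailS]
    refine (IsHomogeneous.add ?_ ?_).add ?_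
    · refine isHomogeneous_of_eq (((hx 0 (p ^ 2)).C_mul _).mul (hx 1 (p ^ 2))) ?_
      omega
    · refine isHomogeneous_of_eq (((hx 0 (2 * p ^ 2 - p)).C_mul _).mul (hx 1 p)) ?_
      omega
    · refine isHomogeneous_of_eq (((hx 0 (2 * p ^ 2 - 1)).C_mul _).mul (isHomogeneous_X F 1)) ?_
      omega
  rw [← sub_eq_zero]
  refine eq_zero_of_dehom_eq_zero (d := p ^ 3)
    ((orbitNorm_X1_isHomogeneous h1234 h1235 h1357).sub ((hx 1 _).add ?_)) ?_
  · refine isHomogeneous_of_eq ((hx 0 (p ^ 3 - 2 * p ^ 2)).mul hS) ?_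
    omega
  · rw [map_sub, dehom_orbitNorm_X1 h1234 h1235 h1357]
    simp only [tailS, normPoly, map_add, map_mul, map_pow, dehom_X0, dehom_X1, dehom_C]
    ring

/-- Since `p (p² - 2p) = p³ - 2p²`, the tails of `f̂₁^p` and of `N_M(y)` start at the same power of
`x`, and the difference is governed by `tailG_pow_eq`. -/
theorem h2tilde_eq (hp : p ≠ 2) (h1234 : gam p M 1 2 3 4 ≠ 0) (h1235 : gam p M 1 2 3 5 ≠ 0)
    (h1357 : gam p M 1 3 5 7 = 0) :
    h2tilde p M = X 0 ^ (p ^ 3 - p ^ 2 - 2 * p) * h2core p M := by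
  have hp3 := three_le hp
  have hpp : 3 * p ≤ p ^ 2 := by nlinarith
  have hpp3 : 3 * p ^ 2 ≤ p ^ 3 := by nlinarith
  have e1 : p ^ 3 - p ^ 2 - 2 * p = (p ^ 3 - 2 * p ^ 2) + (p ^ 2 - 2 * p) := by omega
  have e2 : (p ^ 2 - 2 * p) * p = p ^ 3 - 2 * p ^ 2 := by
    rw [Nat.sub_mul]
    ring_nf
  have hf : f1hat p M ^ p = X 1 ^ p ^ 3 + X 0 ^ (p ^ 3 - 2 * p ^ 2) * f1tail p M ^ p := by
    rw [f1hat_eq hp h1234, add_pow_char, mul_pow, ← pow_mul, ← pow_mul, e2]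
    ring
  have hG := tailG_pow_eq p hp3 (X 0) (X 1) (X 2) (delta F) (C (beta3 p M))
    (C (gam p M 1 2 4 5 / gam p M 1 2 3 4)) (C (gam p M 1 3 4 5 / gam p M 1 2 3 4))
    (C (gam p M 2 3 4 5 / gam p M 1 2 3 4)) (C (alpha2 p M)) (C (alpha1 p M))
    (C (gam p M 2 3 5 7 / gam p M 1 2 3 5)) rfl
  have hf' := f1hat_eq hp h1234
  rw [f1tail] at hf hf'
  rw [← hf', ← C_pow] at hG
  rw [h2tilde, orbitNorm_X1_eq hp h1234 h1235 h1357, hf, hG, e1, pow_add, h2core]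
  ring

theorem h2_eq (hp : p ≠ 2) (h1234 : gam p M 1 2 3 4 ≠ 0) (h1235 : gam p M 1 2 3 5 ≠ 0)
    (h1357 : gam p M 1 3 5 7 = 0) :
    h2 p M = C (2 * beta3 p M ^ (p + 1))⁻¹ * h2core p M := by
  rw [h2, h2tilde_eq hp h1234 h1235 h1357, X_pow_mul_divMonomial, beta3]
  congr 2
  rw [div_pow]
  field_simp

theorem two_mul_h2 (hp : p ≠ 2) (h1234 : gam p M 1 2 3 4 ≠ 0) (h1235 : gam p M 1 2 3 5 ≠ 0)
    (h1357 : gam p M 1 3 5 7 = 0) :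
    2 * C (beta3 p M) ^ (p + 1) * h2 p M = h2core p M := by
  have h : (2 : MvPolynomial (Fin 3) F) = C 2 := (map_ofNat C 2).symm
  rw [h2_eq hp h1234 h1235 h1357, h, ← C_pow, ← C_mul, ← mul_assoc, ← C_mul, mul_inv_cancel₀,
    C_1, one_mul]
  exact mul_ne_zero (two_ne_zero_of_ne hp) (pow_ne_zero _ (beta3_ne_zero h1234 h1235))

theorem h2_mem (hp : p ≠ 2) (h1234 : gam p M 1 2 3 4 ≠ 0) (h1235 : gam p M 1 2 3 5 ≠ 0)
    (h1357 : gam p M 1 3 5 7 = 0) : h2 p M ∈ invariants p M := by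
  rw [h2_eq hp h1234 h1235 h1357]
  refine mul_mem (C_mem _) (mem_invariants_of_X_pow_mul (m := p ^ 3 - p ^ 2 - 2 * p) ?_)
  rw [← h2tilde_eq hp h1234 h1235 h1357, h2tilde]
  exact add_mem (sub_mem (orbitNorm_mem _ _ _) (pow_mem (f1hat_mem hp) _))
    (mul_mem (mul_mem (C_mem _) (pow_mem X0_mem _)) (pow_mem (f1hat_mem hp) _))

theorem h2_isHomogeneous (hp : p ≠ 2) (h1234 : gam p M 1 2 3 4 ≠ 0) (h1235 : gam p M 1 2 3 5 ≠ 0)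
    (h1357 : gam p M 1 3 5 7 = 0) : (h2 p M).IsHomogeneous (p ^ 2 + 2 * p) := by
  have hp3 := three_le hp
  have hpp : 3 * p ≤ p ^ 2 := by nlinarith
  have hpp3 : 3 * p ^ 2 ≤ p ^ 3 := by nlinarith
  rw [h2_eq hp h1234 h1235 h1357]
  refine IsHomogeneous.C_mul (isHomogeneous_of_X_pow_mul (m := p ^ 3 - p ^ 2 - 2 * p) ?_) _
  have e : p ^ 3 - p ^ 2 - 2 * p + (p ^ 2 + 2 * p) = p ^ 3 := by omega
  rw [← h2tilde_eq hp h1234 h1235 h1357, h2tilde, e]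
  refine ((orbitNorm_X1_isHomogeneous h1234 h1235 h1357).sub ?_).add ?_
  · refine isHomogeneous_of_eq ((f1hat_isHomogeneous (M := M) hp).pow p) ?_
    ring
  · refine isHomogeneous_of_eq (((isHomogeneous_X_pow (R := F) (0 : Fin 3) (p ^ 3 - 2 * p ^ 2)).C_mul _).mul
      ((f1hat_isHomogeneous (M := M) hp).pow 2)) ?_
    omega

theorem dvd_h2_sub (hp : p ≠ 2) (h1234 : gam p M 1 2 3 4 ≠ 0) (h1235 : gam p M 1 2 3 5 ≠ 0)
    (h1357 : gam p M 1 3 5 7 = 0) : X 0 ^ p ∣ h2 p M - X 1 ^ (p ^ 2 + 2 * p) := by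
  have hb := beta3_ne_zero h1234 h1235
  refine (dvd_sub_leading p (three_le hp) (d := delta F) (b := C (beta3 p M))
    (b' := C (beta3 p M)⁻¹) rfl ?_ (two_mul_C_inv_two hp) (f1hat_eq hp h1234)
    (two_mul_h2 hp h1234 h1235 h1357)).2
  rw [← C_mul, mul_inv_cancel₀ hb, C_1]

theorem h2_degree (hp : p ≠ 2) (h1234 : gam p M 1 2 3 4 ≠ 0) (h1235 : gam p M 1 2 3 5 ≠ 0)
    (h1357 : gam p M 1 3 5 7 = 0) :
    grevlex.degree (h2 p M) = Finsupp.single 1 (p ^ 2 + 2 * p) := by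
  have h := (dvd_pow_self (X 0 : MvPolynomial (Fin 3) F) (Fact.out : p.Prime).ne_zero).trans
    (dvd_h2_sub hp h1234 h1235 h1357)
  obtain ⟨t, ht⟩ := h
  refine grevlex_degree_eq_single (h2_isHomogeneous hp h1234 h1235 h1357) one_ne_zero (t := t) ?_
  rw [C_1, one_mul, ← ht]
  ring

theorem h3tilde_eq (hp : p ≠ 2) (h1234 : gam p M 1 2 3 4 ≠ 0) (h1235 : gam p M 1 2 3 5 ≠ 0)
    (h1357 : gam p M 1 3 5 7 = 0) :
    ∃ t, h3tilde p M = X 0 ^ (2 * p ^ 2 - 1) *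
      (C ((beta3 p M)⁻¹ ^ p * (gam p M 2 3 5 7 / gam p M 1 2 3 5)) * X 1 ^ (p ^ 3 + 1)
        + X 0 * t) := by
  have hb := beta3_ne_zero h1234 h1235
  have hbb : (C (beta3 p M) * C (beta3 p M)⁻¹ : MvPolynomial (Fin 3) F) = 1 := by
    rw [← C_mul, mul_inv_cancel₀ hb, C_1]
  have hodd := (Fact.out : p.Prime).odd_of_ne_two hp
  have hC2 : (C 2 : MvPolynomial (Fin 3) F) = 2 := map_ofNat C 2
  rw [h3tilde]
  split_ifs with h3
  · subst h3
    obtain ⟨t, ht⟩ := exists_h3tilde_eq_three rfl hbb (f1hat_eq hp h1234)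
      (two_mul_h2 hp h1234 h1235 h1357)
    refine ⟨t, ?_⟩
    simp only [C_mul, C_pow, C_add, ← inv_pow, hC2]
    exact ht
  · have hp5 : 5 ≤ p := by
      have := three_le hp
      have : p ≠ 4 := by
        rintro rfl
        exact absurd (Fact.out : Nat.Prime 4) (by norm_num)
      omega
    obtain ⟨t, ht⟩ := exists_h3tilde_eq_of_five_le p hp5 hodd (d := delta F) rfl hbb
      (two_mul_C_inv_two hp) (f1hat_eq hp h1234) (two_mul_h2 hp h1234 h1235 h1357)
    refine ⟨t, ?_⟩
    simp only [C_mul, C_pow, ← inv_pow, hC2]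
    exact ht

theorem h3tilde_isHomogeneous (hp : p ≠ 2) (h1234 : gam p M 1 2 3 4 ≠ 0)
    (h1235 : gam p M 1 2 3 5 ≠ 0) (h1357 : gam p M 1 3 5 7 = 0) :
    (h3tilde p M).IsHomogeneous (p ^ 3 + 2 * p ^ 2) := by
  have hF := f1hat_isHomogeneous (M := M) hp
  have hH := h2_isHomogeneous hp h1234 h1235 h1357
  have hx : ∀ n, ((X 0 : MvPolynomial (Fin 3) F) ^ n).IsHomogeneous n :=
    fun n => isHomogeneous_X_pow 0 n
  have hodd := (Fact.out : p.Prime).odd_of_ne_two hp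
  rw [h3tilde]
  split_ifs with h3
  · subst h3
    refine ((IsHomogeneous.sub ?_ ?_).add ?_ |>.sub (IsHomogeneous.C_mul (.sub ?_ ?_) _)).sub ?_
    · exact hH.pow 3
    · exact hF.pow 5
    · exact (((hF.pow 3).C_mul _).mul hH).mul (hx 3)
    · exact (hF.pow 4).mul (hx 9)
    · exact (((hF.pow 2).C_mul _).mul hH).mul (hx 12)
    · exact ((hH.pow 2).C_mul _).mul (hx 15)
  · obtain ⟨m, hm⟩ := hodd
    have hp3 := three_le hp
    obtain ⟨n, rfl⟩ : ∃ n, p = 2 * n + 3 := ⟨m - 1, by omega⟩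
    have e0 : (2 * n + 3 - 3) / 2 = n := by omega
    have e1 : (2 * n + 3 + 1) / 2 = n + 2 := by omega
    have e2 : 2 * n + 3 - 1 = 2 * n + 2 := by omega
    have e3 : (2 * n + 3) ^ 2 - 2 * (2 * n + 3) = 4 * n ^ 2 + 8 * n + 3 := by
      rw [Nat.sub_eq_iff_eq_add (by nlinarith)]; ring
    have e4 : 2 * (2 * n + 3) ^ 2 - 2 * (2 * n + 3) = 8 * n ^ 2 + 20 * n + 12 := by
      rw [Nat.sub_eq_iff_eq_add (by nlinarith)]; ring
    have e5 : 2 * (2 * n + 3) ^ 2 - (2 * n + 3) = 8 * n ^ 2 + 22 * n + 15 := by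
      rw [Nat.sub_eq_iff_eq_add (by nlinarith)]; ring
    rw [e0, e1, e2, e3, e4, e5]
    refine ((IsHomogeneous.sub ?_ ?_).add ?_).sub
      (IsHomogeneous.C_mul ((IsHomogeneous.sub ?_ ?_).add ?_) _)
    · refine isHomogeneous_of_eq (hH.pow (2 * n + 3)) ?_
      ring
    · refine isHomogeneous_of_eq (hF.pow (2 * n + 3 + 2)) ?_
      ring
    · refine isHomogeneous_of_eq ((((hF.pow (2 * n + 3)).C_mul _).mul hH).mul (hx _)) ?_
      ring
    · refine isHomogeneous_of_eq (((hF.pow (2 * n + 3 + 1)).C_mul _).mul (hx _)) ?_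
      ring
    · refine isHomogeneous_of_eq ((((hF.pow (2 * n + 2)).C_mul _).mul hH).mul (hx _)) ?_
      ring
    · refine isHomogeneous_of_eq ((((hF.pow n).C_mul _).mul (hH.pow (n + 2))).mul (hx _)) ?_
      ring

theorem h3_eq (hp : p ≠ 2) (h1234 : gam p M 1 2 3 4 ≠ 0) (h1235 : gam p M 1 2 3 5 ≠ 0)
    (h1357 : gam p M 1 3 5 7 = 0) :
    ∃ t, h3 p M = X 1 ^ (p ^ 3 + 1) + X 0 * t := by
  have h2357 := gam2357_ne_zero h1234 h1235 h1357
  obtain ⟨t, ht⟩ := h3tilde_eq hp h1234 h1235 h1357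
  rw [h3, ht, X_pow_mul_divMonomial, mul_add, ← mul_assoc, ← C_mul]
  refine ⟨C (gam p M 1 2 3 5 ^ (p + 1) / (gam p M 2 3 5 7 * gam p M 1 2 3 4 ^ p)) * t, ?_⟩
  -- The normalization of `h₃` is exactly the inverse of the coefficient of `y^(p³+1)` found in
  -- `h3tilde_eq`.
  have : gam p M 1 2 3 5 ^ (p + 1) / (gam p M 2 3 5 7 * gam p M 1 2 3 4 ^ p) *
      ((beta3 p M)⁻¹ ^ p * (gam p M 2 3 5 7 / gam p M 1 2 3 5)) = 1 := by
    rw [beta3, inv_div, div_pow]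
    field_simp
    ring
  rw [this, C_1]
  ring

theorem X_pow_mul_h3 (hp : p ≠ 2) (h1234 : gam p M 1 2 3 4 ≠ 0) (h1235 : gam p M 1 2 3 5 ≠ 0)
    (h1357 : gam p M 1 3 5 7 = 0) : X 0 ^ (2 * p ^ 2 - 1) * h3 p M =
      C (gam p M 1 2 3 5 ^ (p + 1) / (gam p M 2 3 5 7 * gam p M 1 2 3 4 ^ p)) * h3tilde p M := by
  obtain ⟨t, ht⟩ := h3tilde_eq hp h1234 h1235 h1357
  rw [h3, ht, X_pow_mul_divMonomial]
  ring

theorem h3_isHomogeneous (hp : p ≠ 2) (h1234 : gam p M 1 2 3 4 ≠ 0) (h1235 : gam p M 1 2 3 5 ≠ 0)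
    (h1357 : gam p M 1 3 5 7 = 0) : (h3 p M).IsHomogeneous (p ^ 3 + 1) := by
  refine isHomogeneous_of_X_pow_mul (m := 2 * p ^ 2 - 1) ?_
  have hp0 : 0 < p ^ 2 := pow_pos (Fact.out : p.Prime).pos 2
  rw [X_pow_mul_h3 hp h1234 h1235 h1357]
  refine isHomogeneous_of_eq ((h3tilde_isHomogeneous hp h1234 h1235 h1357).C_mul _) ?_
  omega

theorem h3tilde_mem (hp : p ≠ 2) (h1234 : gam p M 1 2 3 4 ≠ 0) (h1235 : gam p M 1 2 3 5 ≠ 0)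
    (h1357 : gam p M 1 3 5 7 = 0) : h3tilde p M ∈ invariants p M := by
  have hf := f1hat_mem (M := M) hp
  have hh := h2_mem hp h1234 h1235 h1357
  have hx := X0_mem (p := p) (M := M)
  have hc := C_mem (p := p) (M := M)
  rw [h3tilde]
  split_ifs
  · exact sub_mem (sub_mem (add_mem (sub_mem (pow_mem hh _) (pow_mem hf _))
      (mul_mem (mul_mem (mul_mem (hc _) (pow_mem hf _)) hh) (pow_mem hx _)))
      (mul_mem (hc _) (sub_mem (mul_mem (pow_mem hf _) (pow_mem hx _))
        (mul_mem (mul_mem (mul_mem (hc _) (pow_mem hf _)) hh) (pow_mem hx _)))))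
      (mul_mem (mul_mem (hc _) (pow_mem hh _)) (pow_mem hx _))
  · exact sub_mem (add_mem (sub_mem (pow_mem hh _) (pow_mem hf _))
      (mul_mem (mul_mem (mul_mem (hc _) (pow_mem hf _)) hh) (pow_mem hx _)))
      (mul_mem (hc _) (add_mem (sub_mem
        (mul_mem (mul_mem (hc _) (pow_mem hf _)) (pow_mem hx _))
        (mul_mem (mul_mem (mul_mem (hc _) (pow_mem hf _)) hh) (pow_mem hx _)))
        (mul_mem (mul_mem (mul_mem (hc _) (pow_mem hf _)) (pow_mem hh _)) (pow_mem hx _))))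

theorem h3_mem (hp : p ≠ 2) (h1234 : gam p M 1 2 3 4 ≠ 0) (h1235 : gam p M 1 2 3 5 ≠ 0)
    (h1357 : gam p M 1 3 5 7 = 0) : h3 p M ∈ invariants p M := by
  refine mem_invariants_of_X_pow_mul (m := 2 * p ^ 2 - 1) ?_
  rw [X_pow_mul_h3 hp h1234 h1235 h1357]
  exact mul_mem (C_mem _) (h3tilde_mem hp h1234 h1235 h1357)

theorem h3_degree (hp : p ≠ 2) (h1234 : gam p M 1 2 3 4 ≠ 0) (h1235 : gam p M 1 2 3 5 ≠ 0)
    (h1357 : gam p M 1 3 5 7 = 0) :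
    grevlex.degree (h3 p M) = Finsupp.single 1 (p ^ 3 + 1) := by
  obtain ⟨t, ht⟩ := h3_eq hp h1234 h1235 h1357
  exact grevlex_degree_eq_single (h3_isHomogeneous hp h1234 h1235 h1357) one_ne_zero (t := t)
    (by rw [C_1, one_mul, ← ht])

/-- The orbit of `z` has full length: the coefficient `2c₁` of `y` recovers `c₁` as `p` is odd, and
then the coefficient of `x` recovers `c₂`. -/
theorem orbitNorm_X2_eq_prod (hp : p ≠ 2) (h1234 : gam p M 1 2 3 4 ≠ 0) :
    orbitNorm p M (X 2) = ∏ e : Fin 4 → ZMod p, act p M e (X 2) := by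
  classical
  rw [orbitNorm, Finset.prod_image]
  intro e _ e' _ h
  have h1 := congrArg (coeff (Finsupp.single 1 1)) h
  have h2 := congrArg (coeff (Finsupp.single 0 1)) h
  simp only [act_z, coeff_add, coeff_C_mul, coeff_X] at h1 h2
  simp [Finsupp.single_left_inj, two_ne_zero_of_ne hp] at h1 h2
  refine coord_pair_injective h1234 h1 ?_
  rw [h1] at h2
  exact add_left_cancel h2

theorem orbitNorm_X2_isHomogeneous (hp : p ≠ 2) (h1234 : gam p M 1 2 3 4 ≠ 0) :
    (orbitNorm p M (X 2)).IsHomogeneous (p ^ 4) := by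
  rw [orbitNorm_X2_eq_prod hp h1234]
  have := IsHomogeneous.prod Finset.univ (fun e => act p M e (X 2)) (fun _ => 1)
    fun e _ => act_isHomogeneous p M e (isHomogeneous_X F 2)
  simpa using this

theorem orbitNorm_X2_degree (hp : p ≠ 2) (h1234 : gam p M 1 2 3 4 ≠ 0) :
    grevlex.degree (orbitNorm p M (X 2)) = Finsupp.single 2 (p ^ 4) := by
  rw [orbitNorm_X2_eq_prod hp h1234, MonomialOrder.degree_prod]
  · simp [act_X2_degree]
  · intro e _ h
    have := act_X2_degree (p := p) (M := M) e
    rw [h, MonomialOrder.degree_zero] at this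
    have := DFunLike.congr_fun this 2
    simp at this

end Generators
end RankFour

namespace RankFour

/-! ### Degrees in `z` after setting `x = 1` -/

section ZDegree

open MvPolynomial

variable {F : Type*} [Field F]

/-- The `z`-degree of `f(1, y, z)`. -/
noncomputable def zDegree (f : MvPolynomial (Fin 3) F) : ℕ := (dehom F f).natDegree

/-- `f(1, y, z)` has `z`-degree `n`, and a constant lead coefficient. -/
def HasZLead (f : MvPolynomial (Fin 3) F) (n : ℕ) : Prop :=
  zDegree f = n ∧ ∃ u : F, u ≠ 0 ∧ (dehom F f).leadingCoeff = Polynomial.C u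

variable {f g : MvPolynomial (Fin 3) F} {m n : ℕ}

theorem zDegree_add_le (hf : zDegree f ≤ n) (hg : zDegree g ≤ n) : zDegree (f + g) ≤ n := by
  rw [zDegree, map_add]
  exact Polynomial.natDegree_add_le_of_degree_le hf hg

theorem zDegree_sub_le (hf : zDegree f ≤ n) (hg : zDegree g ≤ n) : zDegree (f - g) ≤ n := by
  rw [zDegree, map_sub]
  exact (Polynomial.natDegree_sub_le _ _).trans (max_le hf hg)

theorem zDegree_mul_le : zDegree (f * g) ≤ zDegree f + zDegree g := by
  rw [zDegree, map_mul]
  exact Polynomial.natDegree_mul_le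

theorem zDegree_pow_le : zDegree (f ^ n) ≤ n * zDegree f := by
  rw [zDegree, map_pow]
  exact Polynomial.natDegree_pow_le

theorem zDegree_C (a : F) : zDegree (C a : MvPolynomial (Fin 3) F) = 0 := by
  rw [zDegree, dehom_C, Polynomial.natDegree_C]

theorem zDegree_C_mul_le (a : F) : zDegree (C a * f) ≤ zDegree f :=
  zDegree_mul_le.trans (by rw [zDegree_C, zero_add])

theorem zDegree_X0_pow : zDegree (X 0 ^ m : MvPolynomial (Fin 3) F) = 0 := by
  rw [zDegree, map_pow, dehom_X0, one_pow, Polynomial.natDegree_one]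

theorem zDegree_X1_pow : zDegree (X 1 ^ m : MvPolynomial (Fin 3) F) = 0 := by
  rw [zDegree, map_pow, dehom_X1, ← map_pow, Polynomial.natDegree_C]

theorem zDegree_X0_pow_mul : zDegree (X 0 ^ m * f) = zDegree f := by
  rw [zDegree, map_mul, map_pow, dehom_X0, one_pow, one_mul, zDegree]

theorem zDegree_mul_X0_pow : zDegree (f * X 0 ^ m) = zDegree f := by
  rw [mul_comm, zDegree_X0_pow_mul]

theorem HasZLead.mul (hf : HasZLead f m) (hg : HasZLead g n) : HasZLead (f * g) (m + n) := by
  obtain ⟨h1, u, hu, hu'⟩ := hf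
  obtain ⟨h2, v, hv, hv'⟩ := hg
  have hne : ∀ {h : MvPolynomial (Fin 3) F} {w : F}, w ≠ 0 →
      (dehom F h).leadingCoeff = Polynomial.C w → dehom F h ≠ 0 := fun {h w} hw hl h0 => by
    rw [h0, Polynomial.leadingCoeff_zero] at hl
    exact hw (Polynomial.C_eq_zero.1 hl.symm)
  refine ⟨?_, u * v, mul_ne_zero hu hv, ?_⟩
  · rw [zDegree, map_mul, Polynomial.natDegree_mul (hne hu hu') (hne hv hv')]
    exact congrArg₂ _ h1 h2
  · rw [map_mul, Polynomial.leadingCoeff_mul, hu', hv', Polynomial.C_mul]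

theorem hasZLead_C {a : F} (ha : a ≠ 0) : HasZLead (C a : MvPolynomial (Fin 3) F) 0 :=
  ⟨zDegree_C a, a, ha, by rw [dehom_C, Polynomial.leadingCoeff_C]⟩

theorem HasZLead.C_mul (hf : HasZLead f m) {a : F} (ha : a ≠ 0) : HasZLead (C a * f) m := by
  have := (hasZLead_C ha).mul hf
  rwa [zero_add] at this

theorem HasZLead.pow (hf : HasZLead f m) (n : ℕ) : HasZLead (f ^ n) (n * m) := by
  induction n with
  | zero => simpa using hasZLead_C (F := F) one_ne_zero
  | succ n ih =>
    rw [pow_succ, add_mul, one_mul]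
    exact ih.mul hf

theorem hasZLead_X2 : HasZLead (X 2 : MvPolynomial (Fin 3) F) 1 :=
  ⟨by rw [zDegree, dehom_X2, Polynomial.natDegree_X], 1, one_ne_zero,
    by rw [dehom_X2, Polynomial.leadingCoeff_X, map_one]⟩

theorem hasZLead_X0_pow_mul : HasZLead (X 0 ^ m * f) n ↔ HasZLead f n := by
  rw [HasZLead, zDegree_X0_pow_mul, map_mul, map_pow, dehom_X0, one_pow, one_mul, HasZLead]

theorem HasZLead.add (hf : HasZLead f n) (hg : zDegree g < n) : HasZLead (f + g) n := by
  obtain ⟨h1, u, hu, hu'⟩ := hf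
  have h : (dehom F g).natDegree < (dehom F f).natDegree := by
    rw [zDegree] at h1 hg
    rwa [h1]
  refine ⟨?_, u, hu, ?_⟩
  · rw [zDegree, map_add, Polynomial.natDegree_add_eq_left_of_natDegree_lt h]
    exact h1
  · rw [map_add, Polynomial.leadingCoeff_add_of_degree_lt' (Polynomial.degree_lt_degree h), hu']

theorem hasZLead_delta : HasZLead (delta F) 1 := by
  have h : delta F = C (-1) * (X 0 ^ 1 * X 2) + X 1 ^ 2 := by
    rw [delta, C_neg, C_1]
    ring
  rw [h]
  refine ((hasZLead_X0_pow_mul.2 hasZLead_X2).C_mul (by simp)).add ?_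
  rw [zDegree_X1_pow]
  exact one_pos

variable {p : ℕ} {M : Matrix (Fin 2) (Fin 4) F} [hpr : Fact p.Prime]

theorem hasZLead_f1tail (hp : p ≠ 2) (h1234 : gam p M 1 2 3 4 ≠ 0) (h1235 : gam p M 1 2 3 5 ≠ 0) :
    HasZLead (f1tail p M) p := by
  have hp3 := three_le hp
  rw [f1tail, tailG, add_assoc, add_assoc]
  have h := ((hasZLead_delta (F := F)).pow p).C_mul (beta3_ne_zero h1234 h1235)
  rw [mul_one] at h
  refine h.add (lt_of_le_of_lt (zDegree_add_le (n := 1) ?_ (zDegree_add_le ?_ ?_)) (by omega))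
  · rw [zDegree_mul_X0_pow]
    exact (zDegree_C_mul_le _).trans (by rw [zDegree_X1_pow]; exact zero_le_one)
  · rw [zDegree_mul_X0_pow]
    exact (zDegree_C_mul_le _).trans hasZLead_delta.1.le
  · rw [zDegree_mul_X0_pow]
    refine (zDegree_C_mul_le _).trans ?_
    rw [← pow_one (X 1), zDegree_X1_pow]
    exact zero_le_one

theorem hasZLead_f1hat (hp : p ≠ 2) (h1234 : gam p M 1 2 3 4 ≠ 0) (h1235 : gam p M 1 2 3 5 ≠ 0) :
    HasZLead (f1hat p M) p := by
  rw [f1hat_eq hp h1234, add_comm]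
  refine (hasZLead_X0_pow_mul.2 (hasZLead_f1tail hp h1234 h1235)).add ?_
  rw [zDegree_X1_pow]
  exact (Fact.out : p.Prime).pos

variable [CharP F p]

/-- The term `z^(p²)` of `tailW` dominates: `g` has `z`-degree `p`, so the other terms have
`z`-degree at most `2p < p²`. -/
theorem hasZLead_h2 (hp : p ≠ 2) (h1234 : gam p M 1 2 3 4 ≠ 0) (h1235 : gam p M 1 2 3 5 ≠ 0)
    (h1357 : gam p M 1 3 5 7 = 0) : HasZLead (h2 p M) (p ^ 2) := by
  have hp3 := three_le hp
  have hpp : 3 * p ≤ p ^ 2 := by nlinarith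
  have hb := beta3_ne_zero h1234 h1235
  have hg := (hasZLead_f1tail hp h1234 h1235).1
  rw [h2_eq hp h1234 h1235 h1357]
  refine HasZLead.C_mul ?_ (inv_ne_zero (mul_ne_zero (two_ne_zero_of_ne hp) (pow_ne_zero _ hb)))
  have e : h2core p M = X 0 ^ (2 * p) * (C (beta3 p M ^ p) * X 2 ^ p ^ 2 +
      (C (alpha2 p M) * X 1 ^ p ^ 2 + C (alpha1 p M) * X 1 ^ p * X 0 ^ (p ^ 2 - p)
        + C (gam p M 2 3 5 7 / gam p M 1 2 3 5) * X 1 ^ 1 * X 0 ^ (p ^ 2 - 1)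
        - (C ((gam p M 1 2 4 5 / gam p M 1 2 3 4) ^ p) * X 1 ^ p ^ 2
          + C ((gam p M 1 3 4 5 / gam p M 1 2 3 4) ^ p) * delta F ^ p * X 0 ^ (p ^ 2 - 2 * p)
          + C ((gam p M 2 3 4 5 / gam p M 1 2 3 4) ^ p) * X 1 ^ p * X 0 ^ (p ^ 2 - p))))
      + C (beta3 p M ^ p) * (C 2 * X 1 ^ p ^ 2 * f1tail p M
          + X 0 ^ (p ^ 2 - 2 * p) * f1tail p M ^ 2) := by
    rw [h2core, coreH, tailW, f1tail, C_pow, C_pow, C_pow, C_pow, map_ofNat C 2]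
    ring
  rw [e]
  have hz := (hasZLead_X2 (F := F)).pow (p ^ 2)
  rw [mul_one] at hz
  have hy : ∀ (a : F) (m n : ℕ), zDegree (C a * X 1 ^ m * X 0 ^ n) ≤ p := fun a m n => by
    rw [zDegree_mul_X0_pow]
    exact (zDegree_C_mul_le _).trans (by rw [zDegree_X1_pow]; exact Nat.zero_le _)
  have hy' : ∀ (a : F) (m : ℕ), zDegree (C a * X 1 ^ m) ≤ p := fun a m =>
    (zDegree_C_mul_le _).trans (by rw [zDegree_X1_pow]; exact Nat.zero_le _)
  refine (hasZLead_X0_pow_mul.2 ((hz.C_mul (pow_ne_zero _ hb)).add ?_)).add ?_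
  · refine lt_of_le_of_lt (zDegree_sub_le (n := p) (zDegree_add_le (zDegree_add_le (hy' _ _)
      (hy _ _ _)) (hy _ _ _)) (zDegree_add_le (zDegree_add_le (hy' _ _) ?_) (hy _ _ _))) (by omega)
    rw [zDegree_mul_X0_pow]
    refine (zDegree_C_mul_le _).trans (zDegree_pow_le.trans ?_)
    rw [hasZLead_delta.1, mul_one]
  · refine lt_of_le_of_lt ((zDegree_C_mul_le _).trans (zDegree_add_le (n := 2 * p) ?_ ?_))
      (by omega)
    · rw [mul_assoc]
      refine (zDegree_C_mul_le _).trans (zDegree_mul_le.trans ?_)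
      rw [zDegree_X1_pow, hg]
      omega
    · rw [zDegree_X0_pow_mul]
      exact zDegree_pow_le.trans (by rw [hg])

/-- Only `h₂^p` reaches `z`-degree `p³`; each other product stays below it, by the `z`-degrees `p`
and `p²` of `f̂₁` and `h₂`. -/
theorem hasZLead_h3tilde (hp : p ≠ 2) (h1234 : gam p M 1 2 3 4 ≠ 0)
    (h1235 : gam p M 1 2 3 5 ≠ 0) (h1357 : gam p M 1 3 5 7 = 0) :
    HasZLead (h3tilde p M) (p ^ 3) := by
  have hp3 := three_le hp
  have hf := (hasZLead_f1hat hp h1234 h1235).1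
  have hh := hasZLead_h2 hp h1234 h1235 h1357
  have hpow : HasZLead (h2 p M ^ p) (p ^ 3) := by
    have := hh.pow p
    rwa [show p * p ^ 2 = p ^ 3 by ring] at this
  have hfp : ∀ n, zDegree (f1hat p M ^ n) ≤ n * p := fun n => zDegree_pow_le.trans (by rw [hf])
  have hhp : ∀ n, zDegree (h2 p M ^ n) ≤ n * p ^ 2 := fun n =>
    zDegree_pow_le.trans (by rw [hh.1])
  have hfh : ∀ m n, zDegree (f1hat p M ^ m * h2 p M ^ n) ≤ m * p + n * p ^ 2 := fun m n =>
    zDegree_mul_le.trans (add_le_add (hfp m) (hhp n))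
  have hsplit : ∀ r : MvPolynomial (Fin 3) F, zDegree r ≤ p ^ 3 - 1 →
      HasZLead (h2 p M ^ p + r) (p ^ 3) := fun r hr =>
    hpow.add (lt_of_le_of_lt hr (Nat.sub_lt (pow_pos (by omega) 3) one_pos))
  rw [h3tilde]
  split_ifs with h3
  · subst h3
    have e : ∀ (a b c d : F) (f h : MvPolynomial (Fin 3) F), h ^ 3 - f ^ 5 + C a * f ^ 3 * h * X 0 ^ 3
        - C b * (f ^ 4 * X 0 ^ 9 - C c * f ^ 2 * h * X 0 ^ 12) - C d * h ^ 2 * X 0 ^ 15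
        = h ^ 3 + (C (-1) * (f ^ 5 * h ^ 0) + C a * (f ^ 3 * h ^ 1) * X 0 ^ 3
          - C b * (f ^ 4 * h ^ 0 * X 0 ^ 9 - C c * (f ^ 2 * h ^ 1) * X 0 ^ 12)
          - C d * (f ^ 0 * h ^ 2) * X 0 ^ 15) := fun a b c d f h => by
      rw [C_neg, C_1]
      ring
    rw [e]
    refine hsplit _ (zDegree_sub_le (zDegree_sub_le (zDegree_add_le ?_ ?_)
      ((zDegree_C_mul_le _).trans (zDegree_sub_le ?_ ?_))) ?_)
    · exact (zDegree_C_mul_le _).trans ((hfh 5 0).trans (by norm_num))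
    · rw [zDegree_mul_X0_pow]
      exact (zDegree_C_mul_le _).trans ((hfh 3 1).trans (by norm_num))
    · rw [zDegree_mul_X0_pow]
      exact (hfh 4 0).trans (by norm_num)
    · rw [zDegree_mul_X0_pow]
      exact (zDegree_C_mul_le _).trans ((hfh 2 1).trans (by norm_num))
    · rw [zDegree_mul_X0_pow]
      exact (zDegree_C_mul_le _).trans ((hfh 0 2).trans (by norm_num))
  · have hodd := (Fact.out : p.Prime).odd_of_ne_two hp
    obtain ⟨m, hm⟩ := hodd
    obtain ⟨n, hn⟩ : ∃ n, p = 2 * n + 3 := ⟨m - 1, by omega⟩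
    have e0 : (p - 3) / 2 = n := by omega
    have e1 : (p + 1) / 2 = n + 2 := by omega
    have e2 : p - 1 = 2 * n + 2 := by omega
    have hpc : p ^ 3 - 1 = (2 * n + 3) ^ 3 - 1 := by rw [hn]
    have e : ∀ (a b c d e : F) (i j k l m x₁ x₂ x₃ x₄ : ℕ) (f h : MvPolynomial (Fin 3) F),
        h ^ p - f ^ i + C a * f ^ j * h * X 0 ^ x₁
        - C b * (C c * f ^ k * X 0 ^ x₂ - C d * f ^ l * h * X 0 ^ x₃
          + C e * f ^ m * h ^ (n + 2) * X 0 ^ x₄)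
        = h ^ p + (C (-1) * (f ^ i * h ^ 0) + C a * (f ^ j * h ^ 1) * X 0 ^ x₁
          - C b * (C c * (f ^ k * h ^ 0) * X 0 ^ x₂ - C d * (f ^ l * h ^ 1) * X 0 ^ x₃
            + C e * (f ^ m * h ^ (n + 2)) * X 0 ^ x₄)) := fun _ _ _ _ _ _ _ _ _ _ _ _ _ _ _ _ => by
      rw [C_neg, C_1]
      ring
    rw [e0, e1, e2, e]
    refine hsplit _ (zDegree_sub_le (zDegree_add_le ?_ ?_)
      ((zDegree_C_mul_le _).trans (zDegree_add_le (zDegree_sub_le ?_ ?_) ?_)))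
    all_goals
      try rw [zDegree_mul_X0_pow]
      refine (zDegree_C_mul_le _).trans ((hfh _ _).trans ?_)
      rw [hpc, hn]
      refine Nat.le_sub_one_of_lt ?_
      nlinarith [Nat.zero_le n, Nat.zero_le (n ^ 2), Nat.zero_le (n ^ 3)]

theorem hasZLead_h3 (hp : p ≠ 2) (h1234 : gam p M 1 2 3 4 ≠ 0) (h1235 : gam p M 1 2 3 5 ≠ 0)
    (h1357 : gam p M 1 3 5 7 = 0) : HasZLead (h3 p M) (p ^ 3) := by
  rw [← hasZLead_X0_pow_mul (m := 2 * p ^ 2 - 1), X_pow_mul_h3 hp h1234 h1235 h1357]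
  refine (hasZLead_h3tilde hp h1234 h1235 h1357).C_mul (div_ne_zero (pow_ne_zero _ h1235)
    (mul_ne_zero (gam2357_ne_zero h1234 h1235 h1357) (pow_ne_zero _ h1234)))

theorem hasZLead_orbitNorm_X2 (hp : p ≠ 2) (h1234 : gam p M 1 2 3 4 ≠ 0) :
    HasZLead (orbitNorm p M (X 2)) (p ^ 4) := by
  have h : ∀ s : Finset (Fin 4 → ZMod p), HasZLead (∏ e ∈ s, act p M e (X 2)) s.card := by
    classical
    intro s
    induction s using Finset.induction with
    | empty => simpa using hasZLead_C (F := F) one_ne_zero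
    | insert e s he ih =>
      rw [Finset.prod_insert he, Finset.card_insert_of_notMem he, add_comm]
      refine HasZLead.mul ?_ ih
      rw [act_z, add_assoc]
      refine hasZLead_X2.add (lt_of_le_of_lt (zDegree_add_le (n := 0) ?_ ?_) one_pos)
      · refine (zDegree_C_mul_le _).trans ?_
        rw [← pow_one (X 1), zDegree_X1_pow]
      · refine (zDegree_C_mul_le _).trans ?_
        rw [← pow_one (X 0), zDegree_X0_pow]
  rw [orbitNorm_X2_eq_prod hp h1234]
  simpa using h Finset.univ

end ZDegree
end RankFour

namespace RankFour

/-! ### Lead monomials of all invariants -/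

section LeadMonomials

open MvPolynomial

variable {F : Type*} [Field F]

theorem degree_sum_of_injOn {σ ι : Type*} (m : MonomialOrder σ) (f : ι → MvPolynomial σ F)
    (s : Finset ι) (hs : s.Nonempty) (hne : ∀ i ∈ s, f i ≠ 0)
    (hinj : Set.InjOn (fun i => m.degree (f i)) s) :
    ∑ i ∈ s, f i ≠ 0 ∧ ∃ i ∈ s, m.degree (∑ i ∈ s, f i) = m.degree (f i) := by
  classical
  induction hs using Finset.Nonempty.cons_induction with
  | singleton a =>
    rw [Finset.sum_singleton]
    exact ⟨hne a (Finset.mem_singleton_self a), a, Finset.mem_singleton_self a, rfl⟩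
  | cons a s ha hs ih =>
    obtain ⟨h1, i, hi, h2⟩ := ih (fun i hi => hne i (Finset.mem_cons_of_mem hi))
      (hinj.mono fun i hi => Finset.mem_cons_of_mem hi)
    rw [Finset.sum_cons]
    have h3 : m.degree (f a) ≠ m.degree (∑ i ∈ s, f i) := by
      rw [h2]
      intro h
      have := hinj (Finset.mem_cons_self a s) (Finset.mem_cons_of_mem hi) h
      exact ha (this ▸ hi)
    constructor
    · intro h
      rw [eq_neg_of_add_eq_zero_left h, MonomialOrder.degree_neg] at h3
      exact h3 rfl
    · have h4 := m.degree_add_of_ne h3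
      rcases max_choice (m.toSyn (m.degree (f a))) (m.toSyn (m.degree (∑ i ∈ s, f i)))
        with h5 | h5
      · exact ⟨a, Finset.mem_cons_self a s, m.toSyn.injective (h4.trans h5)⟩
      · exact ⟨i, Finset.mem_cons_of_mem hi, (m.toSyn.injective (h4.trans h5)).trans h2⟩

/-- Modulo `p` the sum is `c`. After removing `c` and dividing by `p`, it is `2b` modulo `p`, which
gives `b` because `p` is odd; then `a` follows. -/
theorem exponent_injective {p : ℕ} (hp : p.Prime) (hp2 : p ≠ 2) {a b c a' b' c' : ℕ} (hb : b < p)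
    (hc : c < p) (hb' : b' < p) (hc' : c' < p)
    (h : p ^ 2 * a + (p ^ 2 + 2 * p) * b + (p ^ 3 + 1) * c =
      p ^ 2 * a' + (p ^ 2 + 2 * p) * b' + (p ^ 3 + 1) * c') : a = a' ∧ b = b' ∧ c = c' := by
  have hp0 := hp.pos
  have e : ∀ a b c : ℕ, p ^ 2 * a + (p ^ 2 + 2 * p) * b + (p ^ 3 + 1) * c =
      c + p * (p * a + (p + 2) * b + p ^ 2 * c) := fun a b c => by ring
  have h1 : c = c' := by
    have := congrArg (· % p) h
    simp only [e, Nat.add_mul_mod_self_left] at this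
    rwa [Nat.mod_eq_of_lt hc, Nat.mod_eq_of_lt hc'] at this
  subst h1
  rw [e, e] at h
  have h2 := Nat.eq_of_mul_eq_mul_left hp0 (Nat.add_left_cancel h)
  have h3 : 2 * b + p * (a + b) = 2 * b' + p * (a' + b') := by linarith
  have h4 : b = b' := by
    have h5 : 2 * b ≡ 2 * b' [MOD p] := by
      have h5 := congrArg (· % p) h3
      simp only [Nat.add_mul_mod_self_left] at h5
      exact h5
    have h6 : p.gcd 2 = 1 := (Nat.coprime_primes hp Nat.prime_two).2 hp2
    exact (Nat.ModEq.cancel_left_of_coprime h6 h5).eq_of_lt_of_lt hb hb'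
  subst h4
  exact ⟨Nat.add_right_cancel (Nat.eq_of_mul_eq_mul_left hp0 (Nat.add_left_cancel h3)), rfl, rfl⟩

theorem act_homogeneousComponent (p : ℕ) (M : Matrix (Fin 2) (Fin 4) F) (e : Fin 4 → ZMod p)
    (n : ℕ) (g : MvPolynomial (Fin 3) F) :
    act p M e (homogeneousComponent n g) = homogeneousComponent n (act p M e g) := by
  conv_rhs => rw [← sum_homogeneousComponent g, map_sum, map_sum]
  have h : ∀ i, homogeneousComponent n (act p M e (homogeneousComponent i g)) =
      if i = n then act p M e (homogeneousComponent i g) else 0 := fun i => by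
    rw [homogeneousComponent_of_mem
      (act_isHomogeneous p M e (homogeneousComponent_isHomogeneous i g))]
    simp only [eq_comm]
  simp only [h, Finset.sum_ite_eq', Finset.mem_range]
  split_ifs with hn
  · rfl
  · rw [homogeneousComponent_eq_zero _ _ (by omega), map_zero]

/-- Grevlex compares total degrees first, so the top homogeneous component carries the lead
monomial. -/
theorem grevlex_degree_homogeneousComponent {g : MvPolynomial (Fin 3) F} (hg : g ≠ 0) :
    homogeneousComponent g.totalDegree g ≠ 0 ∧
      grevlex.degree (homogeneousComponent g.totalDegree g) = grevlex.degree g := by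
  have hsum : ∀ a : Fin 3 →₀ ℕ, a.degree = a 0 + a 1 + a 2 := fun a => by
    rw [Finsupp.degree_eq_sum, Fin.sum_univ_three]
  have hmax : (grevlex.degree g).degree = g.totalDegree := by
    refine le_antisymm ?_ ?_
    · exact le_totalDegree (grevlex.degree_mem_support hg)
    · refine Finset.sup_le fun b hb => ?_
      have h1 : b.sum (fun _ e => e) = b.degree := rfl
      rw [h1, hsum, hsum]
      have h2 := grevlex.le_degree hb
      by_contra! h3
      exact absurd ((grevlex_lt_iff _ _).2 (Or.inl h3)) (not_lt.2 h2)
  have hc : (homogeneousComponent g.totalDegree g).coeff (grevlex.degree g) ≠ 0 := by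
    rw [coeff_homogeneousComponent, if_pos hmax]
    exact grevlex.coeff_degree_ne_zero_iff.2 hg
  refine ⟨fun h => hc (by rw [h, coeff_zero]), degree_eq_of_forall _ hc fun b hb hne => ?_⟩
  refine lt_of_le_of_ne (grevlex.le_degree (mem_support_iff.2 fun h => hb ?_))
    (grevlex.toSyn.injective.ne hne)
  rw [coeff_homogeneousComponent, h, ite_self]

/-- The exponent of the lead monomial of `x^I₀ f̂₁^I₁ h₂^I₂ h₃^I₃ N_M(z)^I₄`. -/
noncomputable def gensWeight (p : ℕ) (I : Fin 5 →₀ ℕ) : Fin 3 →₀ ℕ :=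
  Finsupp.single 0 (I 0)
    + Finsupp.single 1 (p ^ 2 * I 1 + (p ^ 2 + 2 * p) * I 2 + (p ^ 3 + 1) * I 3)
    + Finsupp.single 2 (p ^ 4 * I 4)

theorem gensWeight_apply (p : ℕ) (I : Fin 5 →₀ ℕ) : gensWeight p I 0 = I 0 ∧
    gensWeight p I 1 = p ^ 2 * I 1 + (p ^ 2 + 2 * p) * I 2 + (p ^ 3 + 1) * I 3 ∧
    gensWeight p I 2 = p ^ 4 * I 4 := by
  simp [gensWeight]

variable {p : ℕ} {M : Matrix (Fin 2) (Fin 4) F} [hpr : Fact p.Prime] [CharP F p]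

section

variable (hp : p ≠ 2) (h1234 : gam p M 1 2 3 4 ≠ 0) (h1235 : gam p M 1 2 3 5 ≠ 0)
  (h1357 : gam p M 1 3 5 7 = 0)

theorem ne_zero_of_grevlex_degree {f : MvPolynomial (Fin 3) F} {i : Fin 3} {n : ℕ} (hn : n ≠ 0)
    (h : grevlex.degree f = Finsupp.single i n) : f ≠ 0 :=
  grevlex.ne_zero_of_degree_ne_zero (by rw [h]; simpa using hn)

include hp h1234 h1235 h1357 in
theorem gens_ne_zero (i : Fin 5) : gens p M i ≠ 0 := by
  have hp0 := (Fact.out : p.Prime).pos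
  fin_cases i
  · exact X_ne_zero 0
  · exact ne_zero_of_grevlex_degree (by positivity) (f1hat_degree hp h1234)
  · exact ne_zero_of_grevlex_degree (by positivity) (h2_degree hp h1234 h1235 h1357)
  · exact ne_zero_of_grevlex_degree (by positivity) (h3_degree hp h1234 h1235 h1357)
  · exact ne_zero_of_grevlex_degree (by positivity) (orbitNorm_X2_degree hp h1234)

include hp h1234 h1235 h1357 in
theorem gens_isHomogeneous (i : Fin 5) : (gens p M i).IsHomogeneous
    (![1, p ^ 2, p ^ 2 + 2 * p, p ^ 3 + 1, p ^ 4] i) := by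
  fin_cases i
  · exact isHomogeneous_X F 0
  · exact f1hat_isHomogeneous hp
  · exact h2_isHomogeneous hp h1234 h1235 h1357
  · exact h3_isHomogeneous hp h1234 h1235 h1357
  · exact orbitNorm_X2_isHomogeneous hp h1234

include hp h1234 h1235 h1357 in
theorem gens_mem (i : Fin 5) : gens p M i ∈ invariants p M := by
  fin_cases i
  · exact X0_mem
  · exact f1hat_mem hp
  · exact h2_mem hp h1234 h1235 h1357
  · exact h3_mem hp h1234 h1235 h1357
  · exact orbitNorm_mem p M _

include hp h1234 h1235 h1357 in
theorem powerProduct_ne_zero (I : Fin 5 →₀ ℕ) : powerProduct (gens p M) I ≠ 0 :=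
  Finset.prod_ne_zero_iff.2 fun i _ => pow_ne_zero _ (gens_ne_zero hp h1234 h1235 h1357 i)

include hp h1234 h1235 h1357 in
theorem powerProduct_degree (I : Fin 5 →₀ ℕ) :
    grevlex.degree (powerProduct (gens p M) I) = gensWeight p I := by
  have h0 : grevlex.degree (gens p M 0) = Finsupp.single 0 1 := MonomialOrder.degree_X
  have h1 : grevlex.degree (gens p M 1) = Finsupp.single 1 (p ^ 2) := f1hat_degree hp h1234
  have h2 : grevlex.degree (gens p M 2) = _ := h2_degree hp h1234 h1235 h1357
  have h3 : grevlex.degree (gens p M 3) = _ := h3_degree hp h1234 h1235 h1357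
  have h4 : grevlex.degree (gens p M 4) = _ := orbitNorm_X2_degree hp h1234
  rw [powerProduct, MonomialOrder.degree_prod
    fun i _ => pow_ne_zero _ (gens_ne_zero hp h1234 h1235 h1357 i)]
  simp only [MonomialOrder.degree_pow, Fin.sum_univ_five, h0, h1, h2, h3, h4]
  ext i
  fin_cases i <;> simp [gensWeight] <;> ring

end

/-- The products of the powers of `f̂₁`, `h₂`, `h₃` with exponents below `p` and of the powers of
`N_M(z)`, enumerated by their `z`-degree divided by `p`. -/
noncomputable def normalProduct (p : ℕ) [Fact p.Prime] (M : Matrix (Fin 2) (Fin 4) F) (l : ℕ) :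
    MvPolynomial (Fin 3) F :=
  f1hat p M ^ (l % p) * h2 p M ^ (l / p % p) * h3 p M ^ (l / p ^ 2 % p) *
    orbitNorm p M (X 2) ^ (l / p ^ 3)

theorem digits_eq (p l : ℕ) :
    l % p + p * (l / p % p) + p ^ 2 * (l / p ^ 2 % p) + p ^ 3 * (l / p ^ 3) = l := by
  have h1 := Nat.mod_add_div l p
  have h2 := Nat.mod_add_div (l / p) p
  have h3 := Nat.mod_add_div (l / p ^ 2) p
  rw [Nat.div_div_eq_div_mul, ← pow_two] at h2
  rw [Nat.div_div_eq_div_mul, ← pow_succ] at h3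
  generalize l / p ^ 3 = c at *
  generalize l / p ^ 2 = b at *
  generalize l / p = a at *
  generalize l % p = r at *
  rw [← h1, ← h2, ← h3]
  have h4 : (b % p + p * c) % p = b % p := by
    rw [Nat.add_mul_mod_self_left, Nat.mod_mod]
  have h5 : (a % p + p * (b % p + p * c)) % p = a % p := by
    rw [Nat.add_mul_mod_self_left, Nat.mod_mod]
  rw [h4, h5]
  ring

variable (hp : p ≠ 2) (h1234 : gam p M 1 2 3 4 ≠ 0) (h1235 : gam p M 1 2 3 5 ≠ 0)
  (h1357 : gam p M 1 3 5 7 = 0)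

include hp h1234 h1235 h1357

/-- The exponents are the base `p` digits of `l` and the `z`-degrees of the factors are `p` times
the place values. -/
theorem hasZLead_normalProduct (l : ℕ) : HasZLead (normalProduct p M l) (p * l) := by
  have h := ((((hasZLead_f1hat hp h1234 h1235).pow (l % p)).mul
    ((hasZLead_h2 hp h1234 h1235 h1357).pow (l / p % p))).mul
    ((hasZLead_h3 hp h1234 h1235 h1357).pow (l / p ^ 2 % p))).mul
    ((hasZLead_orbitNorm_X2 hp h1234).pow (l / p ^ 3))
  have e : p * l = l % p * p + l / p % p * p ^ 2 + l / p ^ 2 % p * p ^ 3 + l / p ^ 3 * p ^ 4 := by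
    conv_lhs => rw [← digits_eq p l]
    ring
  rw [e]
  exact h

theorem normalProduct_mem (l : ℕ) : normalProduct p M l ∈ invariants p M :=
  mul_mem (mul_mem (mul_mem (pow_mem (f1hat_mem hp) _)
    (pow_mem (h2_mem hp h1234 h1235 h1357) _)) (pow_mem (h3_mem hp h1234 h1235 h1357) _))
    (pow_mem (orbitNorm_mem _ _ _) _)

theorem normalProduct_isHomogeneous (l : ℕ) : ∃ D, (normalProduct p M l).IsHomogeneous D :=
  ⟨_, ((((f1hat_isHomogeneous hp).pow _).mul ((h2_isHomogeneous hp h1234 h1235 h1357).pow _)).mul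
    ((h3_isHomogeneous hp h1234 h1235 h1357).pow _)).mul
    ((orbitNorm_X2_isHomogeneous hp h1234).pow _)⟩

theorem orbitNorm_X1_degree :
    grevlex.degree (orbitNorm p M (X 1)) = Finsupp.single 1 (p ^ 3) := by
  have hp3 := three_le hp
  have hpp3 : 3 * p ^ 2 ≤ p ^ 3 := by nlinarith
  have hp0 : 0 < p ^ 2 := by positivity
  have hd : X 0 ∣ orbitNorm p M (X 1) - X 1 ^ p ^ 3 := by
    rw [orbitNorm_X1_eq hp h1234 h1235 h1357, add_sub_cancel_left]
    exact (dvd_pow_self _ (by omega)).mul_right _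
  obtain ⟨t, ht⟩ := hd
  refine grevlex_degree_eq_single (orbitNorm_X1_isHomogeneous h1234 h1235 h1357) one_ne_zero
    (t := t) ?_
  rw [C_1, one_mul, ← ht, add_sub_cancel]

/-- The exponent vector with the lead monomial of `x^k N_M(y)^i` times a normal product. -/
theorem degree_mul_normalProduct (k i l : ℕ) :
    X 0 ^ k * (orbitNorm p M (X 1) ^ i * normalProduct p M l) ≠ 0 ∧
    grevlex.degree (X 0 ^ k * (orbitNorm p M (X 1) ^ i * normalProduct p M l)) =
      Finsupp.single 0 k + Finsupp.single 1 (p ^ 2 * (p * i + l % p)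
        + (p ^ 2 + 2 * p) * (l / p % p) + (p ^ 3 + 1) * (l / p ^ 2 % p))
        + Finsupp.single 2 (p ^ 4 * (l / p ^ 3)) := by
  have hp0 := (Fact.out : p.Prime).pos
  have hx : (X 0 ^ k : MvPolynomial (Fin 3) F) ≠ 0 := pow_ne_zero _ (X_ne_zero 0)
  have hy : orbitNorm p M (X 1) ^ i ≠ 0 := pow_ne_zero _ (ne_zero_of_grevlex_degree
    (by positivity) (orbitNorm_X1_degree hp h1234 h1235 h1357))
  have h1 : f1hat p M ^ (l % p) ≠ 0 := pow_ne_zero _ (gens_ne_zero hp h1234 h1235 h1357 1)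
  have h2 : h2 p M ^ (l / p % p) ≠ 0 := pow_ne_zero _ (gens_ne_zero hp h1234 h1235 h1357 2)
  have h3 : h3 p M ^ (l / p ^ 2 % p) ≠ 0 := pow_ne_zero _ (gens_ne_zero hp h1234 h1235 h1357 3)
  have h4 : orbitNorm p M (X 2) ^ (l / p ^ 3) ≠ 0 :=
    pow_ne_zero _ (gens_ne_zero hp h1234 h1235 h1357 4)
  have hn : normalProduct p M l ≠ 0 := mul_ne_zero (mul_ne_zero (mul_ne_zero h1 h2) h3) h4
  refine ⟨mul_ne_zero hx (mul_ne_zero hy hn), ?_⟩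
  rw [MonomialOrder.degree_mul hx (mul_ne_zero hy hn), MonomialOrder.degree_mul hy hn,
    normalProduct, MonomialOrder.degree_mul (mul_ne_zero (mul_ne_zero h1 h2) h3) h4,
    MonomialOrder.degree_mul (mul_ne_zero h1 h2) h3, MonomialOrder.degree_mul h1 h2]
  simp only [MonomialOrder.degree_pow, MonomialOrder.degree_X, f1hat_degree hp h1234,
    h2_degree hp h1234 h1235 h1357, h3_degree hp h1234 h1235 h1357,
    orbitNorm_X2_degree hp h1234, orbitNorm_X1_degree hp h1234 h1235 h1357]
  ext j
  fin_cases j <;> simp <;> ring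

/-- A power of `x` times a homogeneous invariant is a combination of normal terms. -/
theorem exists_X_pow_mul_eq {g : MvPolynomial (Fin 3) F} {d : ℕ} (hg : g ∈ invariants p M)
    (hd : g.IsHomogeneous d) : ∃ (K : ℕ) (s : Finset (ℕ × ℕ)) (c : ℕ × ℕ → F) (k : ℕ × ℕ → ℕ),
      (∀ t ∈ s, c t ≠ 0) ∧ X 0 ^ K * g = ∑ t ∈ s, C (c t) *
        (X 0 ^ k t * (orbitNorm p M (X 1) ^ t.1 * normalProduct p M t.2)) := by
  choose hz u hu hlead using hasZLead_normalProduct hp h1234 h1235 h1357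
  choose D hD using normalProduct_isHomogeneous hp h1234 h1235 h1357
  have hinv : ∀ {f}, f ∈ invariants p M → ∀ e,
      shift (coord p M 0 e) (coord p M 1 e) (dehom F f) = dehom F f := fun {f} hf e => by
    rw [← dehom_act, (mem_invariants _ _ _).1 hf]
  have hspan := mem_span_of_shift_eq h1234 h1235 h1357
    (fun l => dehom F (C (u l)⁻¹ * normalProduct p M l)) (fun l => ?_) (fun l => ?_)
    (fun l => hinv (mul_mem (C_mem _) (normalProduct_mem hp h1234 h1235 h1357 l))) _ (hinv hg)
  · obtain ⟨c, hc⟩ := Finsupp.mem_span_range_iff_exists_finsupp.1 hspan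
    -- Any `K` bounding all the degrees works; it keeps the subtraction in the exponent `K + d - (p³
    -- t.1 + D t.2)` of `x` from being truncated.
    set K := ∑ t ∈ c.support, (p ^ 3 * t.1 + D t.2)
    have hK : ∀ t ∈ c.support, p ^ 3 * t.1 + D t.2 ≤ K := fun t ht =>
      Finset.single_le_sum (f := fun t : ℕ × ℕ => p ^ 3 * t.1 + D t.2) (fun _ _ => Nat.zero_le _) ht
    refine ⟨K, c.support, fun t => c t * (u t.2)⁻¹, fun t => K + d - (p ^ 3 * t.1 + D t.2),
      fun t ht => mul_ne_zero (Finsupp.mem_support_iff.1 ht) (inv_ne_zero (hu _)), ?_⟩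
    rw [← sub_eq_zero]
    refine eq_zero_of_dehom_eq_zero (d := K + d) (.sub ((isHomogeneous_X_pow 0 K).mul hd)
      (.sum _ _ _ fun t ht => .C_mul (isHomogeneous_of_eq ((isHomogeneous_X_pow 0 _).mul
        (((orbitNorm_X1_isHomogeneous h1234 h1235 h1357).pow t.1).mul (hD t.2))) ?_) _)) ?_
    · have := hK t ht
      beta_reduce
      omega
    · rw [map_sub, map_mul, map_pow, dehom_X0, one_pow, one_mul, ← hc, sub_eq_zero, map_sum,
        Finsupp.sum]
      refine Finset.sum_congr rfl fun t _ => ?_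
      simp only [map_mul, map_pow, dehom_X0, dehom_C, dehom_orbitNorm_X1 h1234 h1235 h1357,
        Algebra.smul_def, one_pow, one_mul, Polynomial.algebraMap_apply, Polynomial.algebraMap_eq]
      ring
  · rw [Polynomial.Monic, map_mul, Polynomial.leadingCoeff_mul, hlead, dehom_C,
      Polynomial.leadingCoeff_C, ← Polynomial.C_mul, inv_mul_cancel₀ (hu l), Polynomial.C_1]
  · rw [map_mul, dehom_C, Polynomial.natDegree_C_mul]
    · exact hz l
    · simpa using hu l

/-- The lead monomials of the invariants are the lead monomials of the power products. -/
theorem exists_degree_eq_gensWeight {g : MvPolynomial (Fin 3) F} (hg : g ∈ invariants p M)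
    (hg0 : g ≠ 0) : ∃ I, grevlex.degree g = gensWeight p I := by
  obtain ⟨h1, h2⟩ := grevlex_degree_homogeneousComponent hg0
  rw [← h2]
  have hmem : homogeneousComponent g.totalDegree g ∈ invariants p M := by
    rw [mem_invariants] at hg ⊢
    intro e
    rw [act_homogeneousComponent, hg]
  have hhom := homogeneousComponent_isHomogeneous g.totalDegree g
  generalize homogeneousComponent g.totalDegree g = f at *
  obtain ⟨K, s, c, k, hc, hsum⟩ := exists_X_pow_mul_eq hp h1234 h1235 h1357 hmem hhom
  have hX : (X 0 ^ K : MvPolynomial (Fin 3) F) ≠ 0 := pow_ne_zero _ (X_ne_zero 0)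
  have hs : s.Nonempty := by
    by_contra hs
    rw [Finset.not_nonempty_iff_eq_empty.1 hs, Finset.sum_empty] at hsum
    exact mul_ne_zero hX h1 hsum
  have hdeg : ∀ t ∈ s, C (c t) * (X 0 ^ k t * (orbitNorm p M (X 1) ^ t.1 *
      normalProduct p M t.2)) ≠ 0 ∧ grevlex.degree (C (c t) * (X 0 ^ k t *
        (orbitNorm p M (X 1) ^ t.1 * normalProduct p M t.2))) = _ := fun t ht => by
    obtain ⟨h3, h4⟩ := degree_mul_normalProduct hp h1234 h1235 h1357 (k t) t.1 t.2
    have h5 : (C (c t) : MvPolynomial (Fin 3) F) ≠ 0 := C_ne_zero.2 (hc t ht)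
    refine ⟨mul_ne_zero h5 h3, ?_⟩
    rw [MonomialOrder.degree_mul h5 h3, MonomialOrder.degree_C, zero_add, h4]
  have hp' : p.Prime := Fact.out
  obtain ⟨-, t, ht, h3⟩ := degree_sum_of_injOn grevlex _ s hs (fun t ht => (hdeg t ht).1) (by
    intro t ht t' ht' h
    simp only [(hdeg t ht).2, (hdeg t' ht').2] at h
    have e1 := DFunLike.congr_fun h 1
    have e2 := DFunLike.congr_fun h 2
    simp only [Finsupp.add_apply, Finsupp.single_apply] at e1 e2
    simp [hp'.ne_zero] at e1 e2
    obtain ⟨e3, e4, e5⟩ := exponent_injective hp' hp (Nat.mod_lt _ hp'.pos)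
      (Nat.mod_lt _ hp'.pos) (Nat.mod_lt _ hp'.pos) (Nat.mod_lt _ hp'.pos) e1
    -- The exponent of `f̂₁` and `p` times that of `N_M(y)` are added in `e3`; the former is below
    -- `p`, so reduction modulo `p` separates them.
    have e6 : t.2 % p = t'.2 % p := by
      have := congrArg (· % p) e3
      simpa using this
    rw [e6] at e3
    have e7 : t.1 = t'.1 := Nat.eq_of_mul_eq_mul_left hp'.pos (Nat.add_right_cancel e3)
    refine Prod.ext e7 ?_
    rw [← digits_eq p t.2, ← digits_eq p t'.2, e6, e4, e5, e2])
  rw [← hsum, (hdeg t ht).2, MonomialOrder.degree_mul hX h1, MonomialOrder.degree_pow,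
    MonomialOrder.degree_X] at h3
  -- `N_M(y)^i` has the lead monomial of `f̂₁^(p i)`, whence the entry `p * t.1 + t.2 % p`. The
  -- exponent of `x` is that of `f` itself, the factor `x^K` having been cancelled.
  refine ⟨Finsupp.equivFunOnFinite.symm ![grevlex.degree f 0, p * t.1 + t.2 % p, t.2 / p % p,
    t.2 / p ^ 2 % p, t.2 / p ^ 3], ?_⟩
  ext j
  have h4 := DFunLike.congr_fun h3 j
  fin_cases j
  · simp [gensWeight]
  · simpa [gensWeight] using h4
  · simpa [gensWeight] using h4

end LeadMonomials
end RankFour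

namespace RankFour

/-! ### Subduction, generation and the SAGBI property -/

section Subduction

open MvPolynomial

variable {F : Type*} [Field F]

theorem degree_sub_lt_of_leadingTerm_eq {σ : Type*} (m : MonomialOrder σ) {f g : MvPolynomial σ F}
    (h : m.leadingTerm f = m.leadingTerm g) (hne : f - g ≠ 0) :
    m.toSyn (m.degree (f - g)) < m.toSyn (m.degree f) := by
  obtain ⟨h1, h2⟩ := m.leadingTerm_eq_leadingTerm_iff.1 h
  refine lt_of_le_of_ne ?_ fun h3 => ?_
  · have := m.degree_sub_le (f := f) (g := g)
    rwa [h2, sup_idem, ← h2] at this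
  · have h4 : (f - g).coeff (m.degree f) = 0 := by
      rw [coeff_sub, sub_eq_zero]
      conv_rhs => rw [h2]
      exact h1
    rw [← m.toSyn.injective h3] at h4
    exact m.coeff_degree_ne_zero_iff.2 hne h4

variable {n : ℕ} {h : Fin n → MvPolynomial (Fin 3) F}

theorem aeval_monomial_eq_powerProduct (I : Fin n →₀ ℕ) (c : F) :
    aeval h (monomial I c) = C c * powerProduct h I := by
  rw [aeval_monomial, algebraMap_eq, powerProduct, Finsupp.prod_fintype _ _ (by simp)]

theorem Subducts.aeval_eq {f : MvPolynomial (Fin 3) F} {P : MvPolynomial (Fin n) F}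
    (hs : Subducts h f P) : aeval h P = f := by
  induction hs with
  | zero => rw [map_zero]
  | step f c I P _ _ _ ih =>
    rw [map_add, ih, aeval_monomial_eq_powerProduct, add_sub_cancel]

/-- Lead monomials decrease along a subduction. This keeps the monomials contributed by `P` below
the leading pair of a tête-à-tête relation. -/
theorem Subducts.degree_le {f : MvPolynomial (Fin 3) F} {P : MvPolynomial (Fin n) F}
    (hs : Subducts h f P) {I : Fin n →₀ ℕ} (hI : I ∈ P.support) : f ≠ 0 ∧
      grevlex.toSyn (grevlex.degree (powerProduct h I)) ≤ grevlex.toSyn (grevlex.degree f) := by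
  classical
  induction hs with
  | zero => simp at hI
  | step f c J P hf hlt _ ih =>
    refine ⟨hf, ?_⟩
    have hdeg := (grevlex.leadingTerm_eq_leadingTerm_iff.1 hlt).2
    have hc : c ≠ 0 := by
      rintro rfl
      rw [C_0, zero_mul, grevlex.leadingTerm_zero, grevlex.leadingTerm_eq_zero_iff] at hlt
      exact hf hlt
    rcases Finset.mem_union.1 (support_add hI) with h1 | h1
    · rw [Finset.mem_singleton.1 (support_monomial_subset h1), hdeg]
      by_cases h0 : powerProduct h J = 0
      · rw [h0, mul_zero]
      · rw [MonomialOrder.degree_mul (C_ne_zero.2 hc) h0, MonomialOrder.degree_C, zero_add]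
    · obtain ⟨h2, h3⟩ := ih h1
      exact h3.trans (degree_sub_lt_of_leadingTerm_eq grevlex hlt h2).le

/-- Each step cancels the lead term, and grevlex is a well-order, so the process stops, necessarily
at zero. -/
theorem exists_subducts {A : Subalgebra F (MvPolynomial (Fin 3) F)} (hh : ∀ i, h i ∈ A)
    (hlead : ∀ f ∈ A, f ≠ 0 → ∃ I, powerProduct h I ≠ 0 ∧
      grevlex.degree f = grevlex.degree (powerProduct h I))
    (f : MvPolynomial (Fin 3) F) (hf : f ∈ A) : ∃ P, Subducts h f P := by
  induction hd : grevlex.toSyn (grevlex.degree f) using WellFoundedLT.induction generalizing f with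
  | _ d ih =>
  subst hd
  by_cases hf0 : f = 0
  · exact ⟨0, hf0 ▸ Subducts.zero⟩
  obtain ⟨I, hI0, hI⟩ := hlead f hf hf0
  set c := grevlex.leadingCoeff f / grevlex.leadingCoeff (powerProduct h I)
  have hl0 := grevlex.leadingCoeff_ne_zero_iff.2 hI0
  have hc : c ≠ 0 := div_ne_zero (grevlex.leadingCoeff_ne_zero_iff.2 hf0) hl0
  have hlt : grevlex.leadingTerm f = grevlex.leadingTerm (C c * powerProduct h I) := by
    rw [grevlex.leadingTerm_eq_leadingTerm_iff, MonomialOrder.leadingCoeff_mul,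
      MonomialOrder.leadingCoeff_C, MonomialOrder.degree_mul (C_ne_zero.2 hc) hI0,
      MonomialOrder.degree_C, zero_add]
    exact ⟨(div_mul_cancel₀ _ hl0).symm, hI⟩
  have hmem : f - C c * powerProduct h I ∈ A :=
    sub_mem hf (mul_mem (A.algebraMap_mem c) (prod_mem fun i _ => pow_mem (hh i) _))
  by_cases h0 : f - C c * powerProduct h I = 0
  · exact ⟨_, Subducts.step f c I 0 hf0 hlt (h0 ▸ Subducts.zero)⟩
  · obtain ⟨P, hP⟩ := ih _ (degree_sub_lt_of_leadingTerm_eq grevlex hlt h0) _ hmem rfl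
    exact ⟨_, Subducts.step f c I P hf0 hlt hP⟩

theorem exists_isTeteATeteRelation {A : Subalgebra F (MvPolynomial (Fin 3) F)}
    (hh : ∀ i, h i ∈ A) (hlead : ∀ f ∈ A, f ≠ 0 → ∃ I, powerProduct h I ≠ 0 ∧
      grevlex.degree f = grevlex.degree (powerProduct h I)) {I J : Fin n →₀ ℕ}
    (hI : powerProduct h I ≠ 0) (hJ : powerProduct h J ≠ 0)
    (hIJ : grevlex.degree (powerProduct h I) = grevlex.degree (powerProduct h J)) :
    ∃ r, IsTeteATeteRelation h I J r := by
  have hl0 := grevlex.leadingCoeff_ne_zero_iff.2 hJ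
  have hc := div_ne_zero (grevlex.leadingCoeff_ne_zero_iff.2 hI) hl0
  have hp : ∀ K, powerProduct h K ∈ A := fun K => prod_mem fun i _ => pow_mem (hh i) _
  obtain ⟨P, hP⟩ := exists_subducts hh hlead
    (powerProduct h I - C (grevlex.leadingCoeff (powerProduct h I) /
      grevlex.leadingCoeff (powerProduct h J)) * powerProduct h J)
    (sub_mem (hp I) (mul_mem (A.algebraMap_mem _) (hp J)))
  refine ⟨_, _, P, ?_, hP, rfl⟩
  rw [grevlex.leadingTerm_eq_leadingTerm_iff, MonomialOrder.leadingCoeff_mul,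
    MonomialOrder.leadingCoeff_C, MonomialOrder.degree_mul (C_ne_zero.2 hc) hJ,
    MonomialOrder.degree_C, zero_add]
  exact ⟨(div_mul_cancel₀ _ hl0).symm, hIJ⟩

theorem isSagbiBasis_range {A : Subalgebra F (MvPolynomial (Fin 3) F)}
    (hh : ∀ i, h i ∈ A) (hlead : ∀ f ∈ A, f ≠ 0 → ∃ I, powerProduct h I ≠ 0 ∧
      grevlex.degree f = grevlex.degree (powerProduct h I)) (h0 : ∀ i, h i ≠ 0) :
    IsSagbiBasis (Set.range h) A := by
  have hsub : Set.range h ⊆ A := by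
    rintro _ ⟨i, rfl⟩
    exact hh i
  refine ⟨hsub, le_antisymm (Algebra.adjoin_mono ?_) (Algebra.adjoin_le ?_)⟩
  · rintro m ⟨f, hf, hm⟩
    exact ⟨f, hsub hf, hm⟩
  · rintro m ⟨f, hf, hf0, rfl⟩
    obtain ⟨I, -, hI⟩ := hlead f hf hf0
    rw [hI, powerProduct, MonomialOrder.degree_prod fun i _ => pow_ne_zero _ (h0 i),
      monomial_sum_one]
    refine prod_mem fun i _ => ?_
    rw [MonomialOrder.degree_pow, ← one_pow (I i), ← monomial_pow]
    refine pow_mem (Algebra.subset_adjoin ?_) _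
    exact ⟨h i, ⟨i, rfl⟩, h0 i, rfl⟩

theorem adjoin_range_eq {A : Subalgebra F (MvPolynomial (Fin 3) F)}
    (hh : ∀ i, h i ∈ A) (hlead : ∀ f ∈ A, f ≠ 0 → ∃ I, powerProduct h I ≠ 0 ∧
      grevlex.degree f = grevlex.degree (powerProduct h I)) :
    Algebra.adjoin F (Set.range h) = A := by
  refine le_antisymm (Algebra.adjoin_le ?_) fun f hf => ?_
  · rintro _ ⟨i, rfl⟩
    exact hh i
  · obtain ⟨P, hP⟩ := exists_subducts hh hlead f hf
    rw [Algebra.adjoin_range_eq_range_aeval]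
    exact ⟨P, hP.aeval_eq⟩

end Subduction

/-! ### A monomial order adapted to the relations -/

section RelationOrder

/-- Exponent vectors of monomials in `X₀, …, X₄`. -/
def GensExponent (_p : ℕ) : Type := Fin 5 →₀ ℕ

noncomputable instance (p : ℕ) : AddCommMonoid (GensExponent p) :=
  inferInstanceAs (AddCommMonoid (Fin 5 →₀ ℕ))

/-- First compare the lead monomials of the power products, then the exponents of `X₃`, `X₂`. -/
noncomputable def gensKey (p : ℕ) (I : Fin 5 →₀ ℕ) : (ℕ ×ₗ ℕ ×ₗ ℕ) ×ₗ (ℕ ×ₗ ℕ) :=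
  toLex (grevKey (gensWeight p I), toLex (I 3, I 2))

theorem gensWeight_add (p : ℕ) (I J : Fin 5 →₀ ℕ) :
    gensWeight p (I + J) = gensWeight p I + gensWeight p J := by
  ext i
  fin_cases i <;> simp [gensWeight] <;> ring

theorem gensKey_add (p : ℕ) (I J : Fin 5 →₀ ℕ) :
    gensKey p (I + J) = gensKey p I + gensKey p J := by
  rw [gensKey, gensWeight_add, grevKey_add]
  rfl

/-- The weight determines the exponents of `X₀` and `X₄`, and that of `X₁` once those of `X₂` and
`X₃` are known; hence two tie-breakers suffice. -/
theorem gensKey_injective (p : ℕ) [hp : Fact p.Prime] : Function.Injective (gensKey p) := by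
  intro I J h
  simp only [gensKey, EmbeddingLike.apply_eq_iff_eq, Prod.mk.injEq] at h
  obtain ⟨h1, h3, h2⟩ := h
  have hw := grevKey_injective h1
  have hp0 := hp.out.pos
  have e0 := DFunLike.congr_fun hw 0
  have e1 := DFunLike.congr_fun hw 1
  have e2 := DFunLike.congr_fun hw 2
  rw [(gensWeight_apply p I).1, (gensWeight_apply p J).1] at e0
  rw [(gensWeight_apply p I).2.1, (gensWeight_apply p J).2.1, h2, h3] at e1
  rw [(gensWeight_apply p I).2.2, (gensWeight_apply p J).2.2] at e2
  refine Finsupp.ext fun i => ?_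
  fin_cases i
  · exact e0
  · exact Nat.eq_of_mul_eq_mul_left (pow_pos hp0 2)
      (Nat.add_right_cancel (Nat.add_right_cancel e1))
  · exact h2
  · exact h3
  · exact Nat.eq_of_mul_eq_mul_left (pow_pos hp0 4) e2

noncomputable instance (p : ℕ) [Fact p.Prime] : LinearOrder (GensExponent p) :=
  LinearOrder.lift' (fun I : GensExponent p => gensKey p I) (gensKey_injective p)

instance (p : ℕ) [Fact p.Prime] : IsOrderedAddMonoid (GensExponent p) where
  add_le_add_left a b hab c := by
    show gensKey p _ ≤ gensKey p _
    have h : ∀ u v : GensExponent p, gensKey p (u + v) = gensKey p u + gensKey p v := gensKey_add p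
    rw [h, h]
    exact add_le_add_left (show gensKey p a ≤ gensKey p b from hab) _

instance (p : ℕ) [Fact p.Prime] : WellFoundedLT (GensExponent p) :=
  ⟨InvImage.wf (fun I : GensExponent p => gensKey p I)
    (wellFounded_lt (α := (ℕ ×ₗ ℕ ×ₗ ℕ) ×ₗ (ℕ ×ₗ ℕ)))⟩

/-- The monomial order on `F[X₀, …, X₄]` which compares the lead monomials of the power products. -/
noncomputable def gensOrder (p : ℕ) [Fact p.Prime] : MonomialOrder (Fin 5) where
  syn := GensExponent p
  toSyn := { toEquiv := Equiv.refl (Fin 5 →₀ ℕ), map_add' := fun _ _ => rfl }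
  toSyn_monotone := by
    intro I J h
    have h0 : ∀ K, gensKey p 0 ≤ gensKey p K := fun K => by
      have e : gensKey p 0 = toLex (toLex (0, toLex (0, 0)), toLex (0, 0)) := by
        simp [gensKey, grevKey, gensWeight]
      rw [e]
      exact Prod.Lex.toLex_mono (Prod.mk_le_mk.2 ⟨Prod.Lex.toLex_mono (Prod.mk_le_mk.2
        ⟨Nat.zero_le _, Prod.Lex.toLex_mono (Prod.mk_le_mk.2 ⟨Nat.zero_le _, Nat.zero_le _⟩)⟩),
        Prod.Lex.toLex_mono (Prod.mk_le_mk.2 ⟨Nat.zero_le _, Nat.zero_le _⟩)⟩)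
    show gensKey p I ≤ gensKey p J
    obtain ⟨K, rfl⟩ := exists_add_of_le h
    rw [gensKey_add]
    have h1 := add_le_add_right (h0 K) (gensKey p I)
    rwa [← gensKey_add, add_zero] at h1

theorem gensOrder_lt_iff (p : ℕ) [Fact p.Prime] (I J : Fin 5 →₀ ℕ) :
    (gensOrder p).toSyn I < (gensOrder p).toSyn J ↔
      grevlex.toSyn (gensWeight p I) < grevlex.toSyn (gensWeight p J) ∨
        (gensWeight p I = gensWeight p J ∧ (I 3 < J 3 ∨ (I 3 = J 3 ∧ I 2 < J 2))) := by
  have h : (gensOrder p).toSyn I < (gensOrder p).toSyn J ↔ gensKey p I < gensKey p J := Iff.rfl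
  have h' : grevlex.toSyn (gensWeight p I) < grevlex.toSyn (gensWeight p J) ↔
    grevKey (gensWeight p I) < grevKey (gensWeight p J) := Iff.rfl
  rw [h, h', gensKey, gensKey, Prod.Lex.toLex_lt_toLex, Prod.Lex.toLex_lt_toLex]
  simp only [grevKey_injective.eq_iff]

end RelationOrder
end RankFour

namespace RankFour

/-! ### The ideal of relations and the complete intersection property -/

section Relations

open MvPolynomial

variable {F : Type*} [Field F] {p : ℕ} {M : Matrix (Fin 2) (Fin 4) F} [hpr : Fact p.Prime]
  [CharP F p]

theorem IsTeteATeteRelation.aeval_eq_zero {n : ℕ} {h : Fin n → MvPolynomial (Fin 3) F}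
    {I J : Fin n →₀ ℕ} {r : MvPolynomial (Fin n) F} (hr : IsTeteATeteRelation h I J r) :
    aeval h r = 0 := by
  obtain ⟨c, P, -, hs, rfl⟩ := hr
  rw [map_sub, map_sub, hs.aeval_eq, aeval_monomial_eq_powerProduct,
    aeval_monomial_eq_powerProduct, C_1, one_mul, sub_self]

variable (hp : p ≠ 2) (h1234 : gam p M 1 2 3 4 ≠ 0) (h1235 : gam p M 1 2 3 5 ≠ 0)
  (h1357 : gam p M 1 3 5 7 = 0)

include hp h1234 h1235 h1357

/-- The lead terms cancel in the subducted difference, so every monomial of `P` has strictly smaller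
weight than `I`; the order decides between `I` and `J`. -/
theorem degree_teteATeteRelation {I J : Fin 5 →₀ ℕ} {r : MvPolynomial (Fin 5) F}
    (hr : IsTeteATeteRelation (gens p M) I J r)
    (hJI : (gensOrder p).toSyn J < (gensOrder p).toSyn I) :
    (gensOrder p).degree r = I ∧ (gensOrder p).leadingCoeff r = 1 := by
  classical
  obtain ⟨c, P, hlt, hs, rfl⟩ := hr
  have hP : ∀ b, P.coeff b ≠ 0 → grevlex.toSyn (gensWeight p b) < grevlex.toSyn (gensWeight p I) := by
    intro b hb
    obtain ⟨h1, h2⟩ := hs.degree_le (mem_support_iff.2 hb)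
    rw [← powerProduct_degree hp h1234 h1235 h1357 (M := M),
      ← powerProduct_degree hp h1234 h1235 h1357 (M := M)]
    exact h2.trans_lt (degree_sub_lt_of_leadingTerm_eq grevlex hlt h1)
  have hPI : P.coeff I = 0 := by
    by_contra h
    exact lt_irrefl _ (hP I h)
  have hne : J ≠ I := fun h => by
    rw [h] at hJI
    exact lt_irrefl _ hJI
  have hcoeff : (monomial I 1 - monomial J c - P).coeff I = 1 := by
    rw [coeff_sub, coeff_sub, coeff_monomial, coeff_monomial, if_pos rfl, if_neg hne, hPI]
    simp
  have hdeg : (gensOrder p).degree (monomial I 1 - monomial J c - P) = I := by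
    refine degree_eq_of_forall _ (by rw [hcoeff]; exact one_ne_zero) fun b hb hbI => ?_
    by_cases hbP : P.coeff b = 0
    · rw [coeff_sub, coeff_sub, coeff_monomial, coeff_monomial, if_neg (Ne.symm hbI), hbP] at hb
      have : J = b := by
        by_contra h
        rw [if_neg h] at hb
        simp at hb
      rwa [← this]
    · exact (gensOrder_lt_iff p b I).2 (Or.inl (hP b hbP))
  refine ⟨hdeg, ?_⟩
  rw [MonomialOrder.leadingCoeff, hdeg, hcoeff]

/-- By `exponent_injective` the power products that occur have distinct lead monomials, so they are
linearly independent. -/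
theorem eq_zero_of_aeval_eq_zero {q : MvPolynomial (Fin 5) F}
    (hq : ∀ I ∈ q.support, I 2 < p ∧ I 3 < p) (h0 : aeval (gens p M) q = 0) : q = 0 := by
  by_contra hne
  rw [q.as_sum, map_sum] at h0
  simp only [aeval_monomial_eq_powerProduct] at h0
  have hpp := powerProduct_ne_zero hp h1234 h1235 h1357 (M := M)
  have hdeg : ∀ I ∈ q.support,
      grevlex.degree (C (q.coeff I) * powerProduct (gens p M) I) = gensWeight p I := by
    intro I hI
    rw [MonomialOrder.degree_mul (C_ne_zero.2 (mem_support_iff.1 hI)) (hpp I),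
      MonomialOrder.degree_C, zero_add, powerProduct_degree hp h1234 h1235 h1357]
  refine (degree_sum_of_injOn grevlex (fun I => C (q.coeff I) * powerProduct (gens p M) I)
    q.support (support_nonempty.2 hne)
    (fun I hI => mul_ne_zero (C_ne_zero.2 (mem_support_iff.1 hI)) (hpp I)) ?_).1 h0
  intro I hI J hJ h
  simp only [hdeg I hI, hdeg J hJ] at h
  have hp' : p.Prime := Fact.out
  have e0 := DFunLike.congr_fun h 0
  have e1 := DFunLike.congr_fun h 1
  have e2 := DFunLike.congr_fun h 2
  rw [(gensWeight_apply p I).1, (gensWeight_apply p J).1] at e0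
  rw [(gensWeight_apply p I).2.1, (gensWeight_apply p J).2.1] at e1
  rw [(gensWeight_apply p I).2.2, (gensWeight_apply p J).2.2] at e2
  obtain ⟨e3, e4, e5⟩ := exponent_injective hp' hp (hq I hI).1 (hq I hI).2 (hq J hJ).1 (hq J hJ).2 e1
  refine Finsupp.ext fun i => ?_
  fin_cases i
  · exact e0
  · exact e3
  · exact e4
  · exact e5
  · exact Nat.eq_of_mul_eq_mul_left (pow_pos hp'.pos 4) e2

theorem gensWeight_relations :
    gensWeight p (Finsupp.single 1 (p + 2)) = gensWeight p (Finsupp.single 2 p) ∧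
    gensWeight p (Finsupp.single 1 ((p ^ 2 - 2 * p - 1) / 2) + Finsupp.single 2 ((p ^ 2 + 1) / 2)) =
      gensWeight p (Finsupp.single 3 p) := by
  constructor
  · ext i
    fin_cases i <;> simp [gensWeight]
    ring
  · have hp3 := three_le hp
    obtain ⟨m, hm⟩ := (Fact.out : p.Prime).odd_of_ne_two hp
    obtain ⟨n, rfl⟩ : ∃ n, p = 2 * n + 3 := ⟨m - 1, by omega⟩
    have e1 : ((2 * n + 3) ^ 2 - 2 * (2 * n + 3) - 1) / 2 = 2 * n ^ 2 + 4 * n + 1 := by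
      have : (2 * n + 3) ^ 2 = 2 * (2 * n ^ 2 + 4 * n + 1) + (2 * (2 * n + 3) + 1) := by ring
      omega
    have e2 : ((2 * n + 3) ^ 2 + 1) / 2 = 2 * n ^ 2 + 6 * n + 5 := by
      have : (2 * n + 3) ^ 2 = 2 * (2 * n ^ 2 + 6 * n + 5) - 1 := by
        rw [eq_comm, Nat.sub_eq_iff_eq_add (by omega)]
        ring
      omega
    rw [e1, e2]
    ext i
    fin_cases i <;> simp [gensWeight]
    ring

/-- The lead monomials of `r₁, r₂` are `X₂^p` and `X₃^p`: within each pair the weights agree and the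
tie-break favours the `p`-th power. -/
theorem ker_eq_span_and_isRegular {r₁ r₂ : MvPolynomial (Fin 5) F}
    (h₁ : IsTeteATeteRelation (gens p M) (Finsupp.single 2 p) (Finsupp.single 1 (p + 2)) r₁)
    (h₂ : IsTeteATeteRelation (gens p M) (Finsupp.single 3 p)
      (Finsupp.single 1 ((p ^ 2 - 2 * p - 1) / 2) + Finsupp.single 2 ((p ^ 2 + 1) / 2)) r₂) :
    RingHom.ker (aeval (R := F) (gens p M)) = Ideal.span {r₁, r₂} ∧
      RingTheory.Sequence.IsRegular (MvPolynomial (Fin 5) F) [r₁, r₂] := by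
  have hp0 := (Fact.out : p.Prime).pos
  obtain ⟨w1, w2⟩ := gensWeight_relations hp h1234 h1235 h1357 (M := M)
  obtain ⟨d1, l1⟩ := degree_teteATeteRelation hp h1234 h1235 h1357 h₁
    ((gensOrder_lt_iff p _ _).2 (Or.inr ⟨w1, by simp [hp0]⟩))
  obtain ⟨d2, l2⟩ := degree_teteATeteRelation hp h1234 h1235 h1357 h₂
    ((gensOrder_lt_iff p _ _).2 (Or.inr ⟨w2, by simp [hp0]⟩))
  have hr1 : r₁ ≠ 0 := (gensOrder p).leadingCoeff_ne_zero_iff.1 (by rw [l1]; exact one_ne_zero)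
  have hr2 : r₂ ≠ 0 := (gensOrder p).leadingCoeff_ne_zero_iff.1 (by rw [l2]; exact one_ne_zero)
  have hker : RingHom.ker (aeval (R := F) (gens p M)) = Ideal.span {r₁, r₂} := by
    refine le_antisymm (fun f hf => ?_) (Ideal.span_le.2 ?_)
    -- No monomial of the remainder is divisible by `X₂^p` or `X₃^p`, and the remainder still lies
    -- in the kernel.
    · obtain ⟨g, q, hfq, -, hq⟩ := (gensOrder p).div (b := ![r₁, r₂]) (fun i => by
        fin_cases i
        · simp [l1]
        · simp [l2]) f
      have hlin : Finsupp.linearCombination _ ![r₁, r₂] g ∈ Ideal.span {r₁, r₂} := by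
        rw [Finsupp.linearCombination_apply, Finsupp.sum_fintype _ _ (by simp), Fin.sum_univ_two]
        exact add_mem (Ideal.mul_mem_left _ _ (Ideal.subset_span (by simp)))
          (Ideal.mul_mem_left _ _ (Ideal.subset_span (by simp)))
      have hsp : Ideal.span {r₁, r₂} ≤ RingHom.ker (aeval (R := F) (gens p M)) := by
        rw [Ideal.span_le]
        rintro r (rfl | rfl)
        · exact h₁.aeval_eq_zero
        · exact h₂.aeval_eq_zero
      have hq0 : q = 0 := by
        refine eq_zero_of_aeval_eq_zero hp h1234 h1235 h1357 (M := M) (fun I hI => ?_) ?_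
        · have h3 := hq I hI 0
          have h4 := hq I hI 1
          simp only [Matrix.cons_val_zero, Matrix.cons_val_one, d1, d2, Finsupp.single_le_iff,
            not_le] at h3 h4
          exact ⟨h3, h4⟩
        · have h3 := hsp hlin
          rw [RingHom.mem_ker] at hf h3
          rw [hfq, map_add, h3, zero_add] at hf
          exact hf
      rw [hfq, hq0, add_zero]
      exact hlin
    · rintro r (rfl | rfl)
      · exact h₁.aeval_eq_zero
      · exact h₂.aeval_eq_zero
  refine ⟨hker, ⟨?_, ?_⟩⟩
  · rw [RingTheory.Sequence.isWeaklyRegular_cons_iff,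
      RingTheory.Sequence.isWeaklyRegular_singleton_iff]
    refine ⟨fun a b hab => mul_left_cancel₀ hr1 hab, ?_⟩
    refine (isSMulRegular_quotient_iff_mem_of_smul_mem _ _).2 fun f hf => ?_
    obtain ⟨t, -, ht⟩ := (Submodule.mem_smul_pointwise_iff_exists _ _ _).1 hf
    obtain ⟨g, q, rfl, -, hq⟩ := (gensOrder p).div_single (by rw [l1]; exact isUnit_one) f
    rw [smul_eq_mul, smul_eq_mul] at ht
    -- Otherwise compare lead monomials in `r₁ (t - r₂ g) = r₂ q`: as `X₃^p` is prime to `X₂`, the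
    -- lead monomial of `q` would be divisible by `X₂^p`.
    have hq0 : q = 0 := by
      by_contra hq0
      have e : r₁ * (t - r₂ * g) = r₂ * q := by
        linear_combination ht
      have hne : r₁ * (t - r₂ * g) ≠ 0 := e ▸ mul_ne_zero hr2 hq0
      have e' := congrArg (gensOrder p).degree e
      rw [MonomialOrder.degree_mul hr1 (right_ne_zero_of_mul hne),
        MonomialOrder.degree_mul hr2 hq0, d1, d2] at e'
      have e2 := DFunLike.congr_fun e' 2
      have h3 := hq _ ((gensOrder p).degree_mem_support hq0)
      rw [d1, Finsupp.single_le_iff] at h3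
      simp at e2
      omega
    rw [hq0, add_zero]
    exact (Submodule.mem_smul_pointwise_iff_exists _ _ _).2 ⟨g, trivial, by rw [smul_eq_mul, mul_comm]⟩
  · rw [Ideal.ofList_cons, Ideal.ofList_singleton, ← Ideal.span_insert, ← hker, smul_eq_mul,
      Ideal.mul_top]
    exact (RingHom.ker_ne_top _).symm

theorem exists_powerProduct_degree_eq {f : MvPolynomial (Fin 3) F} (hf : f ∈ invariants p M)
    (hf0 : f ≠ 0) : ∃ I, powerProduct (gens p M) I ≠ 0 ∧
      grevlex.degree f = grevlex.degree (powerProduct (gens p M) I) := by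
  obtain ⟨I, hI⟩ := exists_degree_eq_gensWeight hp h1234 h1235 h1357 hf hf0
  exact ⟨I, powerProduct_ne_zero hp h1234 h1235 h1357 I,
    by rw [hI, powerProduct_degree hp h1234 h1235 h1357]⟩

theorem isCompleteIntersection_invariants {r₁ r₂ : MvPolynomial (Fin 5) F}
    (hker : RingHom.ker (aeval (R := F) (gens p M)) = Ideal.span {r₁, r₂})
    (hreg : RingTheory.Sequence.IsRegular (MvPolynomial (Fin 5) F) [r₁, r₂]) :
    IsCompleteIntersection F (invariants p M) := by
  have hmem := gens_mem hp h1234 h1235 h1357 (M := M)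
  have hadj := adjoin_range_eq hmem
    (fun f hf hf0 => exists_powerProduct_degree_eq hp h1234 h1235 h1357 hf hf0)
  rw [Algebra.adjoin_range_eq_range_aeval] at hadj
  have hr : ∀ P, aeval (gens p M) P ∈ invariants p M := fun P => by
    rw [← hadj]
    exact ⟨P, rfl⟩
  refine ⟨5, (aeval (gens p M)).codRestrict _ hr, [r₁, r₂], ?_, ?_, hreg⟩
  · rintro ⟨f, hf⟩
    rw [← hadj] at hf
    obtain ⟨P, hP⟩ := hf
    exact ⟨P, Subtype.ext hP⟩
  · rw [Ideal.ofList_cons, Ideal.ofList_singleton, ← Ideal.span_insert, ← hker]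
    ext P
    rw [RingHom.mem_ker, RingHom.mem_ker]
    exact Subtype.ext_iff

end Relations
end RankFour

/-! ### The main theorem -/

open RankFour
theorem mainTheorem6 {F : Type*} [Field F] (p : ℕ) [Fact p.Prime] [CharP F p] (hp : p ≠ 2)
    (M : Matrix (Fin 2) (Fin 4) F)
    (h1234 : gam p M 1 2 3 4 ≠ 0) (h1235 : gam p M 1 2 3 5 ≠ 0) (h1357 : gam p M 1 3 5 7 = 0) :
    -- the divisions by powers of `x` and by `γ₂₃₅₇` in the definitions of `h₂`, `h₃` are genuine
    (MvPolynomial.X 0 ^ (p ^ 3 - p ^ 2 - 2 * p) ∣ h2tilde p M ∧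
      MvPolynomial.X 0 ^ (2 * p ^ 2 - 1) ∣ h3tilde p M ∧ gam p M 2 3 5 7 ≠ 0) ∧
    -- `x, f̂₁, h₂, h₃, N_M(z)` form a SAGBI basis and a generating set, in the stated degrees
    IsSagbiBasis (Set.range (gens p M)) (invariants p M) ∧
    Algebra.adjoin F (Set.range (gens p M)) = invariants p M ∧
    (∀ i, gens p M i ≠ 0 ∧ (gens p M i).IsHomogeneous
      (![1, p ^ 2, p ^ 2 + 2 * p, p ^ 3 + 1, p ^ 4] i)) ∧
    -- complete intersection, with relations coming from the subduction of two tête-à-têtes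
    IsCompleteIntersection F (invariants p M) ∧
    (∃ r, IsTeteATeteRelation (gens p M) (Finsupp.single 2 p) (Finsupp.single 1 (p + 2)) r) ∧
    (∃ r, IsTeteATeteRelation (gens p M) (Finsupp.single 3 p)
      (Finsupp.single 1 ((p ^ 2 - 2 * p - 1) / 2) + Finsupp.single 2 ((p ^ 2 + 1) / 2)) r) ∧
    ∀ r₁ r₂ : MvPolynomial (Fin 5) F,
      IsTeteATeteRelation (gens p M) (Finsupp.single 2 p) (Finsupp.single 1 (p + 2)) r₁ →
      IsTeteATeteRelation (gens p M) (Finsupp.single 3 p)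
        (Finsupp.single 1 ((p ^ 2 - 2 * p - 1) / 2) + Finsupp.single 2 ((p ^ 2 + 1) / 2)) r₂ →
      RingHom.ker (MvPolynomial.aeval (R := F) (gens p M)) = Ideal.span {r₁, r₂} ∧
      RingTheory.Sequence.IsRegular (MvPolynomial (Fin 5) F) [r₁, r₂] := by
  have hmem := gens_mem hp h1234 h1235 h1357 (M := M)
  have hne := gens_ne_zero hp h1234 h1235 h1357 (M := M)
  have hlead : ∀ f ∈ invariants p M, f ≠ 0 → _ := fun f hf hf0 =>
    exists_powerProduct_degree_eq hp h1234 h1235 h1357 hf hf0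
  have hpp := powerProduct_ne_zero hp h1234 h1235 h1357 (M := M)
  have hdeg := powerProduct_degree hp h1234 h1235 h1357 (M := M)
  obtain ⟨w1, w2⟩ := gensWeight_relations hp h1234 h1235 h1357 (M := M)
  obtain ⟨r₁, hr₁⟩ := exists_isTeteATeteRelation hmem hlead (hpp (Finsupp.single 2 p))
    (hpp (Finsupp.single 1 (p + 2))) (by rw [hdeg, hdeg, w1])
  obtain ⟨r₂, hr₂⟩ := exists_isTeteATeteRelation hmem hlead (hpp (Finsupp.single 3 p))
    (hpp (Finsupp.single 1 ((p ^ 2 - 2 * p - 1) / 2) + Finsupp.single 2 ((p ^ 2 + 1) / 2)))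
    (by rw [hdeg, hdeg, w2])
  obtain ⟨hker, hreg⟩ := ker_eq_span_and_isRegular hp h1234 h1235 h1357 hr₁ hr₂
  refine ⟨⟨⟨_, h2tilde_eq hp h1234 h1235 h1357⟩, ?_, gam2357_ne_zero h1234 h1235 h1357⟩,
    isSagbiBasis_range hmem hlead hne, adjoin_range_eq hmem hlead,
    fun i => ⟨hne i, gens_isHomogeneous hp h1234 h1235 h1357 i⟩,
    isCompleteIntersection_invariants hp h1234 h1235 h1357 hker hreg, ⟨r₁, hr₁⟩, ⟨r₂, hr₂⟩,
    fun _ _ h₁ h₂ => ker_eq_span_and_isRegular hp h1234 h1235 h1357 h₁ h₂⟩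
  obtain ⟨t, ht⟩ := h3tilde_eq hp h1234 h1235 h1357
  exact ⟨_, ht⟩
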